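/- Let $a\in\mathbb R$, let $S^1=[-\pi,\pi]$ with endpoints identified, and let $$Hf(x)=\frac1{2\pi}\,\mathrm{P.V.}\!\int_{-\pi}^{\pi} f(y)\cot\Big(\frac{x-y}{2}\Big)\,dy$$ be the periodic Hilbert transform. Let $H^1(S^1)$ be the space of real $f\in L^2(S^1)$ with weak derivative $f_x\in L^2(S^1)$, with norm $(\|f\|_{L^2}^2+\|f_x\|_{L^2}^2)^{1/2}$. For $T>0$ and $\Omega_0,\omega_0\in H^1(S^1)$, a solution on $[0,T)$ with initial data $(\Omega_0,\omega_0)$ is a pair $$\Omega,\omega\in C^0([0,T);H^1(S^1))\cap C^1([0,T);L^2(S^1)),\qquad \Omega(0)=\Omega_0,\ \ \omega(0)=\omega_0,$$ such that for every $t\in[0,T)$ $$\Omega_t+a\,m\,\Omega_x-\omega\,p_x=0,\qquad \omega_t+a\,p\,\omega_x-\Omega\,m_x=0\qquad\text{in }L^2(S^1),$$ where $p(t),m(t)$ are the $2\pi$-periodic functions with $p_x=H\Omega$, $m_x=H\omega$ and $\int_{-\pi}^{\pi}p\,dx=\int_{-\pi}^{\pi}m\,dx=0$. **Theorem.** Let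 $0<T<\infty$, $\Omega_0,\omega_0\in H^1(S^1)$, and let $(\Omega,\omega)$ be a solution on $[0,T)$ with initial data $(\Omega_0,\omega_0)$. If $$\int_0^T\big(\|H\Omega(t)\|_{L^\infty}+\|H\omega(t)\|_{L^\infty}\big)\,dt<\infty,$$ then the solution can be extended beyond $T$ in $H^1(S^1)\times H^1(S^1)$: there exist $T'>T$ and a solution $(\Omega',\omega')$ on $[0,T')$ with initial data $(\Omega_0,\omega_0)$ such that $\Omega'(t)=\Omega(t)$ and $\omega'(t)=\omega(t)$ for all $t\in[0,T)$. -/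

import Mathlib

open MeasureTheory Filter Topology Set

noncomputable section

namespace MHD1D

instance two_pi_pos_fact : Fact (0 < 2 * Real.pi) := ⟨Real.two_pi_pos⟩

/-- The circle `S¹ = ℝ / 2πℤ`, i.e. the interval `[-π, π]` with its endpoints identified.
Its `volume` is Lebesgue measure, of total mass `2π`. -/
abbrev S1 : Type := AddCircle (2 * Real.pi)

/-- The real Hilbert space `L²(S¹)`. -/
abbrev L2 : Type := Lp ℝ 2 (volume : Measure S1)

/-- `g` is the weak derivative of `f` on the circle: `∫ f φ' = - ∫ g φ` for every smooth
`2π`-periodic test function `φ`. -/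
def HasWeakDeriv (f g : S1 → ℝ) : Prop :=
  ∀ φ : ℝ → ℝ, ContDiff ℝ ((⊤ : ℕ∞) : WithTop ℕ∞) φ → Function.Periodic φ (2 * Real.pi) →
    ∫ x in (-Real.pi)..Real.pi, f (x : S1) * deriv φ x =
      -∫ x in (-Real.pi)..Real.pi, g (x : S1) * φ x

theorem measurePreserving_coe :
    MeasurePreserving (fun x : ℝ => (x : S1))
      (volume.restrict (Ioc (-Real.pi) Real.pi)) volume := by
  have h := AddCircle.measurePreserving_mk (2 * Real.pi) (-Real.pi)
  rwa [show -Real.pi + 2 * Real.pi = Real.pi by ring] at h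

theorem neg_pi_le_pi : -Real.pi ≤ Real.pi := by linarith [Real.pi_pos]

theorem intervalIntegral_congr_coe {f g : S1 → ℝ} (h : f =ᵐ[volume] g) (φ : ℝ → ℝ) :
    ∫ x in (-Real.pi)..Real.pi, f (x : S1) * φ x =
      ∫ x in (-Real.pi)..Real.pi, g (x : S1) * φ x := by
  rw [intervalIntegral.integral_of_le neg_pi_le_pi, intervalIntegral.integral_of_le neg_pi_le_pi]
  refine integral_congr_ae ?_
  filter_upwards [measurePreserving_coe.quasiMeasurePreserving.ae h] with x hx
  rw [hx]

theorem intervalIntegrable_mul (f : L2) {φ : ℝ → ℝ} (hφ : Continuous φ) :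
    IntervalIntegrable (fun x : ℝ => f (x : S1) * φ x) volume (-Real.pi) Real.pi := by
  have h1 : Integrable (f : S1 → ℝ) volume := (Lp.memLp f).integrable (by norm_num)
  have h2 : IntervalIntegrable (fun x : ℝ => f (x : S1)) volume (-Real.pi) Real.pi := by
    rw [intervalIntegrable_iff_integrableOn_Ioc_of_le neg_pi_le_pi]
    exact measurePreserving_coe.integrable_comp_of_integrable h1
  exact h2.mul_continuousOn hφ.continuousOn

theorem hasWeakDeriv_zero : HasWeakDeriv (0 : L2) (0 : L2) := by
  intro φ _ _
  rw [intervalIntegral_congr_coe (Lp.coeFn_zero ℝ 2 _) (deriv φ),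
    intervalIntegral_congr_coe (Lp.coeFn_zero ℝ 2 _) φ]
  simp

theorem HasWeakDeriv.add {f₁ g₁ f₂ g₂ : L2} (h₁ : HasWeakDeriv f₁ g₁) (h₂ : HasWeakDeriv f₂ g₂) :
    HasWeakDeriv (f₁ + f₂ : L2) (g₁ + g₂ : L2) := by
  intro φ hφ hper
  have hc : Continuous (deriv φ) := hφ.continuous_deriv (by norm_cast)
  rw [intervalIntegral_congr_coe (Lp.coeFn_add f₁ f₂) (deriv φ),
    intervalIntegral_congr_coe (Lp.coeFn_add g₁ g₂) φ]
  simp only [Pi.add_apply, add_mul]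
  rw [intervalIntegral.integral_add (intervalIntegrable_mul f₁ hc) (intervalIntegrable_mul f₂ hc),
    intervalIntegral.integral_add (intervalIntegrable_mul g₁ hφ.continuous)
      (intervalIntegrable_mul g₂ hφ.continuous), h₁ φ hφ hper, h₂ φ hφ hper]
  ring

theorem HasWeakDeriv.smul {f g : L2} (c : ℝ) (h : HasWeakDeriv f g) :
    HasWeakDeriv (c • f : L2) (c • g : L2) := by
  intro φ hφ hper
  rw [intervalIntegral_congr_coe (Lp.coeFn_smul c f) (deriv φ),
    intervalIntegral_congr_coe (Lp.coeFn_smul c g) φ]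
  simp only [Pi.smul_apply, smul_eq_mul, mul_assoc, intervalIntegral.integral_const_mul]
  rw [h φ hφ hper]
  ring

/-- The Sobolev space `H¹(S¹)`, realised as the graph of the weak derivative: pairs `(f, f_x)` of
`L²` functions with `f_x` the weak derivative of `f`. The inner product inherited from
`WithLp 2 (L2 × L2)` is `(f, g) + (f_x, g_x)`. -/
def H1 : Submodule ℝ (WithLp 2 (L2 × L2)) where
  carrier := {u | HasWeakDeriv u.fst u.snd}
  add_mem' := fun hu hv => HasWeakDeriv.add hu hv
  zero_mem' := hasWeakDeriv_zero
  smul_mem' := fun c _ hu => HasWeakDeriv.smul c hu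

/-- The underlying `L²` function of an element of `H¹(S¹)`. -/
def fn (u : H1) : L2 := u.1.fst

/-- The weak derivative `u_x ∈ L²(S¹)` of `u ∈ H¹(S¹)`. -/
def dx (u : H1) : L2 := u.1.snd

/-- The truncated integral `(1/2π) ∫_{|x-y| > ε} f(y) cot((x-y)/2) dy` over the circle,
written with `y = x - s`, `s ∈ [-π, π]`. -/
def hilbertTrunc (f : S1 → ℝ) (ε : ℝ) (x : S1) : ℝ :=
  (1 / (2 * Real.pi)) *
    ∫ s in {s : ℝ | ε < |s| ∧ |s| ≤ Real.pi}, f (x - (s : S1)) * Real.cot (s / 2)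

/-- The periodic Hilbert transform
`H f(x) = (1/2π) P.V. ∫_{-π}^{π} f(y) cot((x-y)/2) dy`.
The limit exists for every `x` when `f ∈ H¹(S¹)`, the only case in which it is used. -/
def hilbert (f : S1 → ℝ) (x : S1) : ℝ :=
  limUnder (𝓝[>] (0 : ℝ)) (fun ε => hilbertTrunc f ε x)

/-- `p` is the velocity belonging to the vorticity `Ω`: `p_x = H Ω` and `∫ p = 0`. -/
def IsVelocity (p Ω : H1) : Prop :=
  (dx p =ᵐ[volume] hilbert (fn Ω)) ∧ ∫ x, fn p x = 0

/-- `(Ω, ω)` is a solution on `[0, T)` with initial data `(Ω₀, ω₀)`, in the class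
`C⁰([0,T); H¹(S¹)) ∩ C¹([0,T); L²(S¹))`, of the system
`Ω_t + a m Ω_x - ω p_x = 0`, `ω_t + a p ω_x - Ω m_x = 0`, `p_x = H Ω`, `m_x = H ω`,
with `p` and `m` of zero mean. The time derivative is that of a curve in `L²(S¹)`
(one-sided at `t = 0`). -/
structure IsSolution (a : ℝ) (Ω₀ ω₀ : H1) (T : ℝ) (Ω ω : ℝ → H1) : Prop where
  initial_Omega : Ω 0 = Ω₀
  initial_omega : ω 0 = ω₀
  continuousOn_Omega : ContinuousOn Ω (Ico 0 T)
  continuousOn_omega : ContinuousOn ω (Ico 0 T)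
  contDiffOn_Omega : ContDiffOn ℝ 1 (fun t => fn (Ω t)) (Ico 0 T)
  contDiffOn_omega : ContDiffOn ℝ 1 (fun t => fn (ω t)) (Ico 0 T)
  equations : ∀ t ∈ Ico 0 T, ∃ p m : H1, IsVelocity p (Ω t) ∧ IsVelocity m (ω t) ∧
    (∀ᵐ x : S1, derivWithin (fun τ => fn (Ω τ)) (Ico 0 T) t x
      + a * fn m x * dx (Ω t) x - fn (ω t) x * dx p x = 0) ∧
    (∀ᵐ x : S1, derivWithin (fun τ => fn (ω τ)) (Ico 0 T) t x
      + a * fn p x * dx (ω t) x - fn (Ω t) x * dx m x = 0)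

end MHD1D

end

/-! With u = (Ω, ω), Y = H¹ × H¹ and X = L² × L², the system reads u_t = B(u, u) with B bilinear
from Y × Y to X. The heart of the matter is the energy estimate |d/dt ‖u‖_Y²| ≤ C (‖HΩ‖_∞ + ‖Hω‖_∞)
‖u‖_Y². An integrable control quantity then keeps the Y-norm bounded up to T, and since the time of
local existence depends only on that norm, the solution can be restarted just before T and glued.

Transport terms lose no derivative, because ∫ p v_x v = -½ ∫ p_x v² and p_x is a Hilbert transform.
In the stretching term ω HΩ, paired with Ω_xx, one integration by parts leaves ∫ ω_x HΩ Ω_x, which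
is harmless, and ∫ ω (HΩ_x) Ω_x, where ‖ω‖_∞ is not controlled. It is saved by analyticity: (w +
iHw)(f + iHf)² has only nonnegative frequencies, so its integral is real and 2 ∫ w f Hf = ∫ Hw
((Hf)² - f²). Only Hw enters the bound (`inner_mulL_hilbert`, `abs_inner_mulL_hilbert_self_le`,
`abs_inner_force_dx_le`).

A solution that is merely continuous in H¹ is too rough for this computation, so the inequality is
proved for Galerkin approximations (`exists_galerkin`), passed to their limit by lower
semicontinuity of the Y-norm (`exists_local_solvesModes`), and transferred to an arbitrary solution
by uniqueness in X (`exists_comparison`, `norm_sq_le_mul_exp`). It holds forwards and backwards in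
time; hence norms are continuous, and with continuity in X this yields continuity in Y
(`exists_local`). All of this is done for an abstract `EvolutionSystem`, ending in
`exists_extension`.

The concrete half verifies the axioms with a real trigonometric basis, in which H, the derivative
and the velocity are multipliers, and shows that the principal value defining `hilbert` is that
multiplier for every H¹ function and at every point (`tendsto_hilbertTrunc`). `isSolution_iff` then
translates between the two settings. -/

noncomputable section

namespace MHD1D

open scoped RealInnerProductSpace

/-! ### Grönwall's inequality in both time directions -/

/-- Two-sided Grönwall inequality: if `|φ'| ≤ k φ`, then `φ t ≤ φ s * exp |∫ₛᵗ k|`. -/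
theorem le_mul_exp_of_abs_deriv_le {φ φ' k : ℝ → ℝ} {α β : ℝ} (hφ : ContinuousOn φ (Icc α β))
    (hd : ∀ t ∈ Ioo α β, HasDerivAt φ (φ' t) t) (hk : ContinuousOn k (Icc α β))
    (h0 : ∀ t ∈ Icc α β, 0 ≤ φ t) (hb : ∀ t ∈ Ioo α β, |φ' t| ≤ k t * φ t) {s t : ℝ}
    (hs : s ∈ Icc α β) (ht : t ∈ Icc α β) :
    φ t ≤ φ s * Real.exp |∫ r in s..t, k r| := by
  have hαβ : α ≤ β := hs.1.trans hs.2
  have hint : ∀ x ∈ Icc α β, ∀ y ∈ Icc α β, IntervalIntegrable k volume x y := fun x hx y hy =>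
    (hk.mono (uIcc_subset_Icc hx hy)).intervalIntegrable
  set P : ℝ → ℝ := fun t => ∫ r in α..t, k r with hP
  have hα : α ∈ Icc α β := ⟨le_rfl, hαβ⟩
  have hβ : β ∈ Icc α β := ⟨hαβ, le_rfl⟩
  have hPc : ContinuousOn P (Icc α β) := by
    have := intervalIntegral.continuousOn_primitive_interval' (hint α hα β hβ) (left_mem_uIcc)
    rwa [uIcc_of_le hαβ] at this
  have hPd : ∀ t ∈ Ioo α β, HasDerivAt P (k t) t := fun t ht => by
    refine intervalIntegral.integral_hasDerivAt_right (hint α hα t ⟨ht.1.le, ht.2.le⟩) ?_ ?_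
    · exact (hk.mono Ioo_subset_Icc_self).stronglyMeasurableAtFilter isOpen_Ioo t ht
    · exact hk.continuousAt (Icc_mem_nhds ht.1 ht.2)
  have hPst : ∫ r in s..t, k r = P t - P s := by
    rw [hP]; simp only
    rw [intervalIntegral.integral_interval_sub_left (hint α hα t ht) (hint α hα s hs)]
  rw [hPst]
  -- The bound on |φ'| makes φ exp(-P) nonincreasing and φ exp(P) nondecreasing; the first settles s
  -- ≤ t, the second t ≤ s.
  rcases le_total s t with hst | hst
  · have hanti : AntitoneOn (fun t => φ t * Real.exp (-P t)) (Icc α β) := by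
      have hd' : ∀ t ∈ Ioo α β, HasDerivAt (fun t => φ t * Real.exp (-P t))
          (φ' t * Real.exp (-P t) + φ t * (Real.exp (-P t) * (-k t))) t := fun t ht =>
        (hd t ht).mul ((hPd t ht).neg.exp)
      refine antitoneOn_of_deriv_nonpos (convex_Icc α β) (hφ.mul hPc.neg.rexp) ?_ ?_
      · rw [interior_Icc]; exact fun t ht => (hd' t ht).differentiableAt.differentiableWithinAt
      · rw [interior_Icc]; intro t ht
        rw [(hd' t ht).deriv]
        have h1 := (abs_le.1 (hb t ht)).2
        have h2 := Real.exp_pos (-P t)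
        nlinarith
    have h := hanti hs ht hst
    have h1 : φ t ≤ φ s * Real.exp (P t - P s) := by
      have h2 : Real.exp (P t - P s) = Real.exp (-P s) * Real.exp (P t) := by
        rw [← Real.exp_add]; ring_nf
      have h3 : Real.exp (-P t) * Real.exp (P t) = 1 := by rw [← Real.exp_add]; simp
      calc φ t = (φ t * Real.exp (-P t)) * Real.exp (P t) := by rw [mul_assoc, h3, mul_one]
        _ ≤ (φ s * Real.exp (-P s)) * Real.exp (P t) :=
          mul_le_mul_of_nonneg_right h (Real.exp_pos _).le
        _ = _ := by rw [h2, mul_assoc]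
    exact h1.trans (mul_le_mul_of_nonneg_left (Real.exp_le_exp.2 (le_abs_self _)) (h0 s hs))
  · have hmono : MonotoneOn (fun t => φ t * Real.exp (P t)) (Icc α β) := by
      have hd' : ∀ t ∈ Ioo α β, HasDerivAt (fun t => φ t * Real.exp (P t))
          (φ' t * Real.exp (P t) + φ t * (Real.exp (P t) * (k t))) t := fun t ht =>
        (hd t ht).mul ((hPd t ht).exp)
      refine monotoneOn_of_deriv_nonneg (convex_Icc α β) (hφ.mul hPc.rexp) ?_ ?_
      · rw [interior_Icc]; exact fun t ht => (hd' t ht).differentiableAt.differentiableWithinAt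
      · rw [interior_Icc]; intro t ht
        rw [(hd' t ht).deriv]
        have h1 := (abs_le.1 (hb t ht)).1
        have h2 := Real.exp_pos (P t)
        nlinarith
    have h := hmono ht hs hst
    have h1 : φ t ≤ φ s * Real.exp (-(P t - P s)) := by
      have h2 : Real.exp (-(P t - P s)) = Real.exp (P s) * Real.exp (-P t) := by
        rw [← Real.exp_add]; ring_nf
      have h3 : Real.exp (P t) * Real.exp (-P t) = 1 := by rw [← Real.exp_add]; simp
      calc φ t = (φ t * Real.exp (P t)) * Real.exp (-P t) := by rw [mul_assoc, h3, mul_one]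
        _ ≤ (φ s * Real.exp (P s)) * Real.exp (-P t) :=
          mul_le_mul_of_nonneg_right h (Real.exp_pos _).le
        _ = _ := by rw [h2, mul_assoc]
    exact h1.trans (mul_le_mul_of_nonneg_left (Real.exp_le_exp.2 (neg_le_abs _)) (h0 s hs))

/-! ### Abstract quadratic evolution equations and spectral truncation -/

/-- A quadratic evolution equation `J u' = B u u` between real Hilbert spaces `Y ⊆ X`, together with
the estimates that make it well posed in `Y`: the embedding `J` is diagonal with respect to a
Hilbert basis, differences are controlled in `X`, and the growth of the `Y`-norm is controlled
by the functional `K`. -/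
structure EvolutionSystem (X Y ι : Type*) [NormedAddCommGroup X] [InnerProductSpace ℝ X]
    [NormedAddCommGroup Y] [InnerProductSpace ℝ Y] where
  J : Y →L[ℝ] X
  J_injective : Function.Injective J
  b : HilbertBasis ι ℝ X
  e : ι → Y
  J_e : ∀ i, J (e i) = b i
  lam : ι → ℝ
  lam_pos : ∀ i, 0 < lam i
  finite_lam_le : ∀ r, {i | lam i ≤ r}.Finite
  inner_e : ∀ i u, ⟪e i, u⟫ = lam i * ⟪b i, J u⟫
  B : Y →L[ℝ] Y →L[ℝ] X
  K : Y → ℝ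
  c : ℝ
  c_pos : 0 < c
  K_nonneg : ∀ u, 0 ≤ K u
  K_le : ∀ u, K u ≤ c * ‖u‖
  -- Makes K continuous along sequences that converge in X and stay bounded in Y, the only
  -- convergence available for the Galerkin limits.
  K_sub_le : ∀ ε > 0, ∃ C, ∀ u w, |K u - K w| ≤ ε * ‖u - w‖ + C * ‖J (u - w)‖
  inner_B_self_le : ∀ u v, |⟪B u v, J v⟫| ≤ c * ‖u‖ * ‖J v‖ ^ 2
  norm_B_le : ∀ v w, ‖B v w‖ ≤ c * ‖J v‖ * ‖w‖
  -- Required only for finite combinations of modes; z stands for the operator with eigenvalues lam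
  -- applied to u, so that pairing with z in X is pairing with u in Y.
  energy_le : ∀ u ∈ Submodule.span ℝ (range e), ∀ z : X, (∀ i, ⟪b i, z⟫ = lam i * ⟪b i, J u⟫) →
    |⟪B u u, z⟫| ≤ K u * ‖u‖ ^ 2
  -- Each single mode of the nonlinearity makes sense with X-norms alone; this is what lets the
  -- equation pass to limits in X.
  inner_basis_B_le : ∀ i, ∃ C, ∀ u w, |⟪b i, B u w⟫| ≤ C * ‖J u‖ * ‖J w‖

namespace EvolutionSystem

variable {X Y ι : Type*} [NormedAddCommGroup X] [InnerProductSpace ℝ X]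
    [NormedAddCommGroup Y] [InnerProductSpace ℝ Y] (S : EvolutionSystem X Y ι)

/-- The finitely many modes of frequency at most `N`. -/
def modes (N : ℝ) : Finset ι := (S.finite_lam_le N).toFinset

theorem mem_modes {N : ℝ} {i : ι} : i ∈ S.modes N ↔ S.lam i ≤ N := by simp [modes]

/-- The combination of the modes in `s` with the coefficients of `x`. -/
def proj (s : Finset ι) : X →L[ℝ] Y := ∑ i ∈ s, (innerSL ℝ (S.b i)).smulRight (S.e i)

theorem proj_apply (s : Finset ι) (x : X) : S.proj s x = ∑ i ∈ s, ⟪S.b i, x⟫ • S.e i := by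
  simp [proj]

theorem J_proj (s : Finset ι) (x : X) : S.J (S.proj s x) = ∑ i ∈ s, ⟪S.b i, x⟫ • S.b i := by
  simp [proj_apply, S.J_e]

theorem inner_J_proj [DecidableEq ι] (s : Finset ι) (x : X) (i : ι) :
    ⟪S.b i, S.J (S.proj s x)⟫ = if i ∈ s then ⟪S.b i, x⟫ else 0 := by
  rw [J_proj, inner_sum]
  simp_rw [real_inner_smul_right, orthonormal_iff_ite.1 S.b.orthonormal]
  simp

theorem inner_J_proj_of_mem {s : Finset ι} (x : X) {i : ι} (hi : i ∈ s) :
    ⟪S.b i, S.J (S.proj s x)⟫ = ⟪S.b i, x⟫ := by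
  classical rw [inner_J_proj, if_pos hi]

theorem inner_proj (s : Finset ι) (x : X) (y : Y) :
    ⟪S.proj s x, y⟫ = ∑ i ∈ s, S.lam i * (⟪S.b i, x⟫ * ⟪S.b i, S.J y⟫) := by
  rw [proj_apply, sum_inner]
  refine Finset.sum_congr rfl fun i _ => ?_
  rw [real_inner_smul_left, S.inner_e]; ring

theorem norm_proj_sq (s : Finset ι) (x : X) :
    ‖S.proj s x‖ ^ 2 = ∑ i ∈ s, S.lam i * ⟪S.b i, x⟫ ^ 2 := by
  rw [← real_inner_self_eq_norm_sq, inner_proj]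
  refine Finset.sum_congr rfl fun i hi => ?_
  rw [S.inner_J_proj_of_mem x hi]; ring

theorem norm_proj_J_le (s : Finset ι) (y : Y) : ‖S.proj s (S.J y)‖ ≤ ‖y‖ := by
  have h : ‖S.proj s (S.J y)‖ ^ 2 = ⟪S.proj s (S.J y), y⟫ := by
    rw [norm_proj_sq, inner_proj]; simp_rw [sq]
  have h2 := real_inner_le_norm (S.proj s (S.J y)) y
  rw [← h] at h2
  by_contra! hlt
  nlinarith [norm_nonneg y]

theorem sum_lam_le (s : Finset ι) (y : Y) : ∑ i ∈ s, S.lam i * ⟪S.b i, S.J y⟫ ^ 2 ≤ ‖y‖ ^ 2 := by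
  rw [← norm_proj_sq]
  exact pow_le_pow_left₀ (norm_nonneg _) (S.norm_proj_J_le s y) 2

theorem hasSum_sq (x : X) : HasSum (fun i => ⟪S.b i, x⟫ ^ 2) (‖x‖ ^ 2) := by
  have h := S.b.hasSum_inner_mul_inner x x
  rw [real_inner_self_eq_norm_sq] at h
  simp_rw [real_inner_comm _ x, ← sq] at h
  exact h

theorem norm_J_proj_le (s : Finset ι) (x : X) : ‖S.J (S.proj s x)‖ ≤ ‖x‖ := by
  classical
  refine le_of_sq_le_sq ?_ (norm_nonneg _)
  refine hasSum_le (fun i => ?_) (S.hasSum_sq _) (S.hasSum_sq x)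
  rw [inner_J_proj]
  split_ifs
  · exact le_rfl
  · simpa using sq_nonneg _

/-- Beyond frequency N a squared coefficient is at most 1/N times its share of the squared Y-norm,
so a Y-bound makes the tail small in X. -/
theorem norm_J_sq_le {N : ℝ} (hN : 0 < N) (y : Y) :
    ‖S.J y‖ ^ 2 ≤ ∑ i ∈ S.modes N, ⟪S.b i, S.J y⟫ ^ 2 + ‖y‖ ^ 2 / N := by
  classical
  refine hasSum_le_of_sum_le (S.hasSum_sq (S.J y)) fun s => ?_
  rw [← Finset.sum_inter_add_sum_sdiff s (S.modes N)]
  refine add_le_add (Finset.sum_le_sum_of_subset_of_nonneg Finset.inter_subset_right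
    fun _ _ _ => sq_nonneg _) ?_
  rw [le_div_iff₀ hN, Finset.sum_mul]
  refine le_trans (Finset.sum_le_sum fun i hi => ?_) (S.sum_lam_le (s \ S.modes N) y)
  have : N < S.lam i := by
    have := (Finset.mem_sdiff.1 hi).2
    rw [mem_modes] at this; exact not_le.1 this
  nlinarith [sq_nonneg ⟪S.b i, S.J y⟫]

theorem norm_J_sub_proj_sq_le {N : ℝ} (hN : 0 < N) (y : Y) :
    ‖S.J (y - S.proj (S.modes N) (S.J y))‖ ^ 2 ≤ 4 * ‖y‖ ^ 2 / N := by
  refine (S.norm_J_sq_le hN _).trans ?_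
  rw [Finset.sum_eq_zero, zero_add]
  · refine div_le_div_of_nonneg_right ?_ hN.le
    have h1 := norm_sub_le y (S.proj (S.modes N) (S.J y))
    have h2 := S.norm_proj_J_le (S.modes N) y
    have h3 := norm_nonneg (y - S.proj (S.modes N) (S.J y))
    nlinarith [norm_nonneg y]
  · intro i hi
    rw [map_sub, inner_sub_right, S.inner_J_proj_of_mem _ hi]; simp

theorem proj_mem_span (s : Finset ι) (x : X) : S.proj s x ∈ Submodule.span ℝ (S.e '' s) := by
  rw [proj_apply]
  exact Submodule.sum_mem _ fun i hi =>
    Submodule.smul_mem _ _ (Submodule.subset_span (mem_image_of_mem _ hi))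

theorem tendsto_J_proj (y : Y) :
    Tendsto (fun N : ℕ => S.J (S.proj (S.modes N) (S.J y))) atTop (𝓝 (S.J y)) := by
  rw [tendsto_iff_norm_sub_tendsto_zero]
  have h : Tendsto (fun N : ℕ => Real.sqrt (4 * ‖y‖ ^ 2 / N)) atTop (𝓝 0) := by
    have := (tendsto_const_div_atTop_nhds_zero_nat (4 * ‖y‖ ^ 2)).sqrt
    rwa [Real.sqrt_zero] at this
  refine squeeze_zero' (Eventually.of_forall fun _ => norm_nonneg _) ?_ h
  filter_upwards [eventually_gt_atTop 0] with N hN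
  refine Real.le_sqrt_of_sq_le ?_
  rw [norm_sub_rev, ← map_sub]
  exact S.norm_J_sub_proj_sq_le (by exact_mod_cast hN) y

/-! ### Comparison and uniqueness in the weaker norm -/

/-- The curve `u` solves the equations of the modes in `A` on `[α, β]`. -/
def SolvesModes (A : Set ι) (u : ℝ → Y) (α β : ℝ) : Prop :=
  ∀ i ∈ A, ContinuousOn (fun t => ⟪S.b i, S.J (u t)⟫) (Icc α β) ∧
    ∀ t ∈ Ioo α β, HasDerivAt (fun t => ⟪S.b i, S.J (u t)⟫) ⟪S.b i, S.B (u t) (u t)⟫ t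

variable {S} in
theorem SolvesModes.mono {A A' : Set ι} {u : ℝ → Y} {α β α' β' : ℝ} (h : S.SolvesModes A u α β)
    (hA : A' ⊆ A) (hα : α ≤ α') (hβ : β' ≤ β) : S.SolvesModes A' u α' β' := fun i hi =>
  ⟨(h i (hA hi)).1.mono (Icc_subset_Icc hα hβ), fun t ht => (h i (hA hi)).2 t
    (Ioo_subset_Ioo hα hβ ht)⟩

/-- Two bounded curves that solve the equations of all modes of frequency at most `N` stay close
in `X`, up to an error which vanishes as `N → ∞`. -/
theorem exists_comparison (R : ℝ) : ∃ L > 0, ∃ ε : ℝ → ℝ, Tendsto ε atTop (𝓝 0) ∧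
    ∀ (N : ℝ) (_ : 0 < N) (u w : ℝ → Y) (α β : ℝ),
      S.SolvesModes (S.modes N) u α β → S.SolvesModes (S.modes N) w α β →
      (∀ t ∈ Icc α β, ‖u t‖ ≤ R) → (∀ t ∈ Icc α β, ‖w t‖ ≤ R) →
      ∀ s ∈ Icc α β, ∀ t ∈ Icc α β, ‖S.J (u t) - S.J (w t)‖ ^ 2 ≤
        (‖S.J (u s) - S.J (w s)‖ ^ 2 + ε N) * Real.exp (L * |t - s|) := by
  set c := S.c with hc
  have hcpos := S.c_pos
  set M : ℝ := 2 * c * ‖S.J‖ * R ^ 2 with hM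
  have hM0 : 0 ≤ M := by positivity
  -- Each of the two terms of B(u,u) - B(w,w) = B(u,v) + B(v,w) contributes c R, doubled by
  -- differentiating a square; the +1 keeps L positive for the division in η.
  set L : ℝ := 4 * c * |R| + 1 with hL
  have hLpos : 0 < L := by positivity
  -- Bounds the squared X-norm of the modes of u - w beyond N, since ‖u - w‖ ≤ 2R.
  set δ : ℝ → ℝ := fun N => 4 * R ^ 2 / N with hδ
  have hδt : Tendsto δ atTop (𝓝 0) := tendsto_const_nhds.div_atTop tendsto_id
  -- Chosen so that L (φ + η) equals L (φ + δ) plus the tail error: adding the constant η to φ makes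
  -- the Grönwall inequality homogeneous.
  set η : ℝ → ℝ := fun N => (L * δ N + 2 * M * Real.sqrt (4 * δ N)) / L with hη
  have hηt : Tendsto η atTop (𝓝 0) := by
    have h1 : Tendsto (fun N => Real.sqrt (4 * δ N)) atTop (𝓝 0) := by
      have := (hδt.const_mul 4).sqrt
      simpa using this
    have := ((hδt.const_mul L).add (h1.const_mul (2 * M))).div_const L
    simpa only [mul_zero, add_zero, zero_div] using this
  refine ⟨L, hLpos, fun N => η N + δ N, by simpa using hηt.add hδt, ?_⟩
  intro N hN u w α β hu hw hRu hRw s hs t ht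
  have hR : 0 ≤ R := (norm_nonneg _).trans (hRu s hs)
  have hδ0 : 0 ≤ δ N := by positivity
  have hη0 : 0 ≤ η N := by positivity
  set v : ℝ → Y := fun t => u t - w t with hv
  have hv2 : ∀ t ∈ Icc α β, ‖v t‖ ^ 2 ≤ 4 * R ^ 2 := fun t ht => by
    have h1 : ‖v t‖ ≤ 2 * R := (norm_sub_le _ _).trans (by linarith [hRu t ht, hRw t ht])
    nlinarith [norm_nonneg (v t)]
  set φ : ℝ → ℝ := fun t => ∑ i ∈ S.modes N, ⟪S.b i, S.J (v t)⟫ ^ 2 with hφ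
  have hφJ : ∀ t, φ t ≤ ‖S.J (v t)‖ ^ 2 := fun t =>
    sum_le_hasSum _ (fun _ _ => sq_nonneg _) (S.hasSum_sq _)
  have hJφ : ∀ t ∈ Icc α β, ‖S.J (v t)‖ ^ 2 ≤ φ t + δ N := fun t ht =>
    (S.norm_J_sq_le hN (v t)).trans
      (add_le_add le_rfl (div_le_div_of_nonneg_right (hv2 t ht) hN.le))
  set G : ℝ → X := fun t => S.B (u t) (u t) - S.B (w t) (w t) with hG
  set φ' : ℝ → ℝ := fun t => ∑ i ∈ S.modes N, 2 * ⟪S.b i, S.J (v t)⟫ * ⟪S.b i, G t⟫ with hφ'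
  have hcont : ContinuousOn φ (Icc α β) := by
    refine continuousOn_finsetSum _ fun i hi => ContinuousOn.pow ?_ 2
    refine ((hu i hi).1.sub (hw i hi).1).congr fun t _ => ?_
    simp [hv, inner_sub_right]
  have hderiv : ∀ t ∈ Ioo α β, HasDerivAt φ (φ' t) t := fun t ht => by
    refine HasDerivAt.fun_sum fun i hi => ?_
    have h1 : HasDerivAt (fun t => ⟪S.b i, S.J (v t)⟫) ⟪S.b i, G t⟫ t := by
      have := ((hu i hi).2 t ht).fun_sub ((hw i hi).2 t ht)
      simpa only [hv, hG, map_sub, inner_sub_right] using this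
    have := h1.fun_pow 2
    simpa using this
  have hbound : ∀ t ∈ Ioo α β, |φ' t| ≤ L * (φ t + η N) := fun t ht => by
    have ht' := Ioo_subset_Icc_self ht
    have hGe : G t = S.B (u t) (v t) + S.B (v t) (w t) := by
      simp [hG, hv]
    have hφ'e : φ' t = 2 * ⟪G t, S.J (S.proj (S.modes N) (S.J (v t)))⟫ := by
      rw [J_proj, inner_sum, Finset.mul_sum]
      refine Finset.sum_congr rfl fun i _ => ?_
      rw [real_inner_smul_right, real_inner_comm (S.b i) (G t)]; ring
    -- The estimate `inner_B_self_le` needs the full difference v, not its truncation. The discarded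
    -- tail q is small in X, while G is bounded there.
    have hsplit : S.J (S.proj (S.modes N) (S.J (v t))) =
        S.J (v t) - S.J (v t - S.proj (S.modes N) (S.J (v t))) := by
      rw [map_sub S.J (v t)]; exact (sub_sub_cancel _ _).symm
    set q := v t - S.proj (S.modes N) (S.J (v t)) with hq
    have hqn : ‖S.J q‖ ≤ Real.sqrt (4 * δ N) := by
      refine Real.le_sqrt_of_sq_le ((S.norm_J_sub_proj_sq_le hN (v t)).trans ?_)
      have := div_le_div_of_nonneg_right (hv2 t ht') hN.le
      rw [mul_div_assoc]; simp only [hδ]; linarith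
    have hun := hRu t ht'
    have hwn := hRw t ht'
    have hJv := hJφ t ht'
    have h1 : |⟪S.B (u t) (v t), S.J (v t)⟫| ≤ c * R * ‖S.J (v t)‖ ^ 2 :=
      (S.inner_B_self_le _ _).trans (by gcongr)
    have h2 : |⟪S.B (v t) (w t), S.J (v t)⟫| ≤ c * R * ‖S.J (v t)‖ ^ 2 := by
      refine (abs_real_inner_le_norm _ _).trans ?_
      calc ‖S.B (v t) (w t)‖ * ‖S.J (v t)‖ ≤ (c * ‖S.J (v t)‖ * R) * ‖S.J (v t)‖ := by
            gcongr; exact (S.norm_B_le _ _).trans (by gcongr)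
        _ = _ := by ring
    have hFn : ∀ y : Y, ‖y‖ ≤ R → ‖S.B y y‖ ≤ c * ‖S.J‖ * R ^ 2 := fun y hy => by
      refine (S.norm_B_le y y).trans ?_
      have := S.J.le_opNorm y
      calc c * ‖S.J y‖ * ‖y‖ ≤ c * (‖S.J‖ * R) * R := by
            gcongr; exact this.trans (by gcongr)
        _ = _ := by ring
    have h3 : |⟪G t, S.J q⟫| ≤ M * Real.sqrt (4 * δ N) := by
      refine (abs_real_inner_le_norm _ _).trans ?_
      have : ‖G t‖ ≤ M := (norm_sub_le _ _).trans (by linarith [hFn _ hun, hFn _ hwn])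
      gcongr
    have h4 : ⟪G t, S.J (v t)⟫ = ⟪S.B (u t) (v t), S.J (v t)⟫ + ⟪S.B (v t) (w t), S.J (v t)⟫ := by
      rw [hGe, inner_add_left]
    have h5 : |φ' t| ≤ 4 * c * R * ‖S.J (v t)‖ ^ 2 + 2 * M * Real.sqrt (4 * δ N) := by
      rw [hφ'e, hsplit, inner_sub_right, h4, abs_le]
      rw [abs_le] at h1 h2 h3
      constructor <;> linarith [h1.1, h1.2, h2.1, h2.2, h3.1, h3.2]
    have h6 : L * (φ t + η N) = L * (φ t + δ N) + 2 * M * Real.sqrt (4 * δ N) := by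
      simp only [hη]; field_simp; ring
    rw [h6]
    refine h5.trans (add_le_add ?_ le_rfl)
    have h7 : 4 * c * R ≤ L := by rw [hL, abs_of_nonneg hR]; linarith
    exact mul_le_mul h7 hJv (sq_nonneg _) hLpos.le
  have hgr := le_mul_exp_of_abs_deriv_le (φ := fun t => φ t + η N) (φ' := φ') (k := fun _ => L)
    (hcont.add continuousOn_const) (fun t ht => (hderiv t ht).add_const _) continuousOn_const
    (fun t _ => add_nonneg (Finset.sum_nonneg fun _ _ => sq_nonneg _) hη0) hbound hs ht
  have hint : |∫ _ in s..t, L| = L * |t - s| := by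
    rw [intervalIntegral.integral_const, smul_eq_mul, abs_mul, abs_of_pos hLpos, mul_comm]
  rw [hint] at hgr
  have he : 1 ≤ Real.exp (L * |t - s|) := Real.one_le_exp (by positivity)
  rw [← map_sub, ← map_sub]
  have h8 := hJφ t ht
  have h9 := hφJ s
  have h10 : δ N ≤ δ N * Real.exp (L * |t - s|) := le_mul_of_one_le_right hδ0 he
  have h11 := mul_le_mul_of_nonneg_right h9 (Real.exp_pos (L * |t - s|)).le
  simp only [hv] at h8 h9 h11 hgr ⊢
  nlinarith

/-- Bounded solutions of all modes are determined by their value at one time. -/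
theorem eq_of_solvesModes {u w : ℝ → Y} {α β R : ℝ} (hu : S.SolvesModes univ u α β)
    (hw : S.SolvesModes univ w α β) (hRu : ∀ t ∈ Icc α β, ‖u t‖ ≤ R)
    (hRw : ∀ t ∈ Icc α β, ‖w t‖ ≤ R) {s : ℝ} (hs : s ∈ Icc α β) (h : u s = w s) :
    ∀ t ∈ Icc α β, u t = w t := by
  obtain ⟨L, hL, ε, hε, hcmp⟩ := S.exists_comparison R
  intro t ht
  refine S.J_injective (sub_eq_zero.1 ?_)
  have hlim : Tendsto (fun N => (‖S.J (u s) - S.J (w s)‖ ^ 2 + ε N) * Real.exp (L * |t - s|)) atTop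
      (𝓝 0) := by
    have := (hε.const_add (‖S.J (u s) - S.J (w s)‖ ^ 2)).mul_const (Real.exp (L * |t - s|))
    simpa [h] using this
  have hle : ‖S.J (u t) - S.J (w t)‖ ^ 2 ≤ 0 := by
    refine ge_of_tendsto hlim ?_
    filter_upwards [eventually_gt_atTop 0] with N hN
    exact hcmp N hN u w α β (hu.mono (subset_univ _) le_rfl le_rfl)
      (hw.mono (subset_univ _) le_rfl le_rfl) hRu hRw s hs t ht
  have := le_antisymm hle (sq_nonneg _)
  simpa using this

end EvolutionSystem

/-! ### Convergence in X of curves bounded in Y -/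

namespace EvolutionSystem

variable {X Y ι : Type*} [NormedAddCommGroup X] [InnerProductSpace ℝ X]
    [NormedAddCommGroup Y] [InnerProductSpace ℝ Y] (S : EvolutionSystem X Y ι)

theorem orthonormal_normalized : Orthonormal ℝ fun i => (Real.sqrt (S.lam i))⁻¹ • S.e i := by
  classical
  rw [orthonormal_iff_ite]
  intro i j
  rw [real_inner_smul_left, real_inner_smul_right, S.inner_e, S.J_e,
    orthonormal_iff_ite.1 S.b.orthonormal]
  split_ifs with h
  · subst h
    have := Real.mul_self_sqrt (S.lam_pos i).le
    have h0 := (Real.sqrt_pos.2 (S.lam_pos i)).ne'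
    field_simp
    nlinarith
  · simp

theorem summable_smul_e [CompleteSpace Y] {a : ι → ℝ} {C : ℝ}
    (h : ∀ s : Finset ι, ∑ i ∈ s, S.lam i * a i ^ 2 ≤ C) : Summable fun i => a i • S.e i := by
  have h1 := (S.orthonormal_normalized.orthogonalFamily.summable_iff_norm_sq_summable
    (fun i => Real.sqrt (S.lam i) * a i)).2 ?_
  · refine h1.congr fun i => ?_
    have h0 := (Real.sqrt_pos.2 (S.lam_pos i)).ne'
    simp only [LinearIsometry.toSpanSingleton_apply, smul_smul]
    congr 1
    field_simp
  · refine summable_of_sum_le (c := C) (fun i => sq_nonneg _) fun s => ?_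
    refine le_trans (Finset.sum_le_sum fun i _ => ?_) (h s)
    rw [Real.norm_eq_abs, sq_abs, mul_pow, Real.sq_sqrt (S.lam_pos i).le]

theorem norm_sum_smul_e_sq (s : Finset ι) (a : ι → ℝ) :
    ‖∑ i ∈ s, a i • S.e i‖ ^ 2 = ∑ i ∈ s, S.lam i * a i ^ 2 := by
  classical
  rw [← real_inner_self_eq_norm_sq, sum_inner]
  refine Finset.sum_congr rfl fun i hi => ?_
  rw [real_inner_smul_left, S.inner_e, map_sum, inner_sum, Finset.sum_eq_single i]
  · rw [map_smul, S.J_e, real_inner_smul_right, orthonormal_iff_ite.1 S.b.orthonormal, if_pos rfl]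
    ring
  · intro j _ hj
    rw [map_smul, S.J_e, real_inner_smul_right, orthonormal_iff_ite.1 S.b.orthonormal,
      if_neg hj.symm, mul_zero]
  · exact fun h => absurd hi h

/-- Closed balls of `Y` are closed in `X`. -/
theorem exists_J_eq_of_tendsto [CompleteSpace Y] {y : ℕ → Y} {r : ℕ → ℝ} {r' : ℝ} {x : X}
    (hx : Tendsto (fun n => S.J (y n)) atTop (𝓝 x)) (hr : Tendsto r atTop (𝓝 r'))
    (hy : ∀ᶠ n in atTop, ‖y n‖ ≤ r n) : ∃ y', S.J y' = x ∧ ‖y'‖ ≤ r' := by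
  have hr0 : 0 ≤ r' := ge_of_tendsto hr (hy.mono fun n hn => (norm_nonneg _).trans hn)
  have hsum : ∀ s : Finset ι, ∑ i ∈ s, S.lam i * ⟪S.b i, x⟫ ^ 2 ≤ r' ^ 2 := fun s => by
    have h1 : Tendsto (fun n => ∑ i ∈ s, S.lam i * ⟪S.b i, S.J (y n)⟫ ^ 2) atTop
        (𝓝 (∑ i ∈ s, S.lam i * ⟪S.b i, x⟫ ^ 2)) :=
      tendsto_finsetSum _ fun i _ => ((tendsto_const_nhds.inner hx).pow 2).const_mul _
    refine le_of_tendsto_of_tendsto h1 (hr.pow 2) ?_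
    filter_upwards [hy] with n hn
    exact (S.sum_lam_le s (y n)).trans (pow_le_pow_left₀ (norm_nonneg _) hn 2)
  have hs := S.summable_smul_e hsum
  refine ⟨∑' i, ⟪S.b i, x⟫ • S.e i, ?_, ?_⟩
  · rw [S.J.map_tsum hs]
    have h2 := S.b.hasSum_repr x
    simp only [HilbertBasis.repr_apply_apply] at h2
    exact (tsum_congr fun i => by rw [map_smul, S.J_e]).trans h2.tsum_eq
  · refine le_of_tendsto hs.hasSum.norm (Eventually.of_forall fun s => ?_)
    refine le_of_sq_le_sq ?_ hr0
    rw [norm_sum_smul_e_sq]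
    exact hsum s

theorem hasSum_smul_e [CompleteSpace Y] (y : Y) : HasSum (fun i => ⟪S.b i, S.J y⟫ • S.e i) y := by
  have hs := S.summable_smul_e (a := fun i => ⟪S.b i, S.J y⟫) fun s => S.sum_lam_le s y
  have : ∑' i, ⟪S.b i, S.J y⟫ • S.e i = y := by
    refine S.J_injective ?_
    rw [S.J.map_tsum hs]
    have h2 := S.b.hasSum_repr (S.J y)
    simp only [HilbertBasis.repr_apply_apply] at h2
    exact (tsum_congr fun i => by rw [map_smul, S.J_e]).trans h2.tsum_eq
  simpa only [this] using hs.hasSum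

/-- Convergence in `X` together with convergence of the `Y`-norms implies convergence in `Y`. -/
theorem tendsto_of_tendsto_norm [CompleteSpace Y] {α : Type*} {l : Filter α} {u : α → Y} {y : Y}
    (hJ : Tendsto (fun a => S.J (u a)) l (𝓝 (S.J y)))
    (hn : Tendsto (fun a => ‖u a‖ ^ 2) l (𝓝 (‖y‖ ^ 2))) : Tendsto u l (𝓝 y) := by
  rw [Metric.tendsto_nhds]
  intro ε hε
  obtain ⟨s, hs⟩ := ((Metric.tendsto_nhds.1 (S.hasSum_smul_e y)) (ε / 2) (half_pos hε)).exists
  -- The Y-inner product with a finite combination p of modes depends only on the image in X, so ‖u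
  -- - p‖ → ‖y - p‖, which is small.
  set p : Y := ∑ i ∈ s, ⟪S.b i, S.J y⟫ • S.e i with hp
  have hinner : ∀ w : Y, ⟪w, p⟫ = ∑ i ∈ s, ⟪S.b i, S.J y⟫ * (S.lam i * ⟪S.b i, S.J w⟫) := by
    intro w
    rw [hp, inner_sum]
    refine Finset.sum_congr rfl fun i _ => ?_
    rw [real_inner_smul_right, real_inner_comm (S.e i) w, S.inner_e]
  have h1 : Tendsto (fun a => ⟪u a, p⟫) l (𝓝 ⟪y, p⟫) := by
    simp_rw [hinner]
    exact tendsto_finsetSum _ fun i _ => ((tendsto_const_nhds.inner hJ).const_mul _).const_mul _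
  have h2 : Tendsto (fun a => ‖u a - p‖ ^ 2) l (𝓝 (‖y - p‖ ^ 2)) := by
    simp_rw [norm_sub_sq_real]
    exact (hn.sub (h1.const_mul 2)).add tendsto_const_nhds
  rw [dist_comm, dist_eq_norm] at hs
  have h3 : ‖y - p‖ ^ 2 < (ε / 2) ^ 2 := pow_lt_pow_left₀ hs (norm_nonneg _) two_ne_zero
  filter_upwards [h2.eventually (gt_mem_nhds h3)] with a ha
  have h4 := lt_of_pow_lt_pow_left₀ 2 (half_pos hε).le ha
  rw [dist_eq_norm]
  calc ‖u a - y‖ ≤ ‖u a - p‖ + ‖y - p‖ := by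
        rw [show u a - y = (u a - p) - (y - p) by abel]; exact norm_sub_le _ _
    _ < ε := by linarith

theorem continuous_K : Continuous S.K := by
  obtain ⟨C, hC⟩ := S.K_sub_le 1 one_pos
  rw [continuous_iff_continuousAt]
  intro u
  rw [ContinuousAt, tendsto_iff_norm_sub_tendsto_zero]
  have : Tendsto (fun w => 1 * ‖w - u‖ + C * ‖S.J (w - u)‖) (𝓝 u) (𝓝 0) := by
    have : Continuous fun w => 1 * ‖w - u‖ + C * ‖S.J (w - u)‖ := by fun_prop
    have := this.tendsto u
    simpa using this
  exact squeeze_zero (fun _ => norm_nonneg _) (fun w => hC w u) this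

/-- On a Y-bounded family the term ε ‖u - w‖ is made small by choosing ε against the bound; the
remaining term tends to 0 in X. -/
theorem tendsto_K {α : Type*} {l : Filter α} {u : α → Y} {y : Y} {R : ℝ}
    (hJ : Tendsto (fun a => S.J (u a)) l (𝓝 (S.J y))) (hR : ∀ᶠ a in l, ‖u a‖ ≤ R) :
    Tendsto (fun a => S.K (u a)) l (𝓝 (S.K y)) := by
  rw [Metric.tendsto_nhds]
  intro ε hε
  obtain ⟨C, hC⟩ := S.K_sub_le (ε / (2 * (|R| + ‖y‖ + 1))) (by positivity)
  have h1 : Tendsto (fun a => C * ‖S.J (u a - y)‖) l (𝓝 0) := by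
    have := (tendsto_iff_norm_sub_tendsto_zero.1 hJ).const_mul C
    simpa using this
  filter_upwards [hR, h1.eventually (gt_mem_nhds (half_pos hε))] with a ha ha'
  rw [Real.dist_eq]
  refine (hC _ _).trans_lt ?_
  have h2 : ‖u a - y‖ ≤ |R| + ‖y‖ + 1 :=
    (norm_sub_le _ _).trans (by linarith [le_abs_self R])
  have h3 : ε / (2 * (|R| + ‖y‖ + 1)) * ‖u a - y‖ ≤ ε / 2 := by
    calc ε / (2 * (|R| + ‖y‖ + 1)) * ‖u a - y‖
        ≤ ε / (2 * (|R| + ‖y‖ + 1)) * (|R| + ‖y‖ + 1) := by gcongr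
      _ = ε / 2 := by field_simp
  linarith

theorem tendsto_inner_B {α : Type*} {l : Filter α} {u : α → Y} {y : Y}
    (hJ : Tendsto (fun a => S.J (u a)) l (𝓝 (S.J y))) (i : ι) :
    Tendsto (fun a => ⟪S.b i, S.B (u a) (u a)⟫) l (𝓝 ⟪S.b i, S.B y y⟫) := by
  obtain ⟨C, hC⟩ := S.inner_basis_B_le i
  rw [tendsto_iff_norm_sub_tendsto_zero]
  have h1 : Tendsto (fun a => C * ‖S.J (u a)‖ * ‖S.J (u a - y)‖ + C * ‖S.J (u a - y)‖ * ‖S.J y‖) l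
      (𝓝 0) := by
    have h0 : Tendsto (fun a => ‖S.J (u a - y)‖) l (𝓝 0) := by
      simpa using tendsto_iff_norm_sub_tendsto_zero.1 hJ
    have := ((hJ.norm.const_mul C).mul h0).add ((h0.const_mul C).mul_const ‖S.J y‖)
    simpa using this
  refine squeeze_zero (fun _ => norm_nonneg _) (fun a => ?_) h1
  have : ⟪S.b i, S.B (u a) (u a)⟫ - ⟪S.b i, S.B y y⟫ =
      ⟪S.b i, S.B (u a) (u a - y)⟫ + ⟪S.b i, S.B (u a - y) y⟫ := by
    simp [inner_sub_right]
  rw [this]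
  exact (abs_add_le _ _).trans (add_le_add (hC _ _) (hC _ _))

theorem norm_B_self_le (y : Y) : ‖S.B y y‖ ≤ S.c * ‖S.J‖ * ‖y‖ ^ 2 := by
  refine (S.norm_B_le y y).trans ?_
  have := S.c_pos
  calc S.c * ‖S.J y‖ * ‖y‖ ≤ S.c * (‖S.J‖ * ‖y‖) * ‖y‖ := by
        gcongr; exact S.J.le_opNorm y
    _ = _ := by ring

/-! ### Galerkin approximations on a uniform time interval -/

/-- A time for which every solution with `Y`-norm at most `R` initially exists. -/
def lifespan (R : ℝ) : ℝ := 1 / (6 * S.c * R + 1)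

theorem lifespan_pos {R : ℝ} (hR : 0 < R) : 0 < S.lifespan R := by
  have := S.c_pos
  unfold lifespan; positivity

/-- As long as ‖u‖ ≤ 3R, the squared norm grows at rate at most 2K ≤ 6cR. A factor below 4 for the
square then keeps the norm within 2R. -/
theorem exp_lifespan_lt {R : ℝ} (hR : 0 < R) : Real.exp (6 * S.c * R * S.lifespan R) < 4 := by
  have := S.c_pos
  have h1 : 6 * S.c * R * S.lifespan R ≤ 1 := by
    unfold lifespan
    rw [mul_one_div, div_le_one (by positivity)]; linarith
  have h2 := Real.exp_le_exp.2 h1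
  linarith [Real.exp_one_lt_d9]

/-- The Galerkin approximations exist on a time interval which does not depend on the level. -/
theorem exists_galerkin {R : ℝ} (hR : 0 < R) (s : Finset ι) {u₀ : Y} (hu₀ : ‖u₀‖ ≤ R) :
    ∃ u : ℝ → Y, u 0 = S.proj s (S.J u₀) ∧
      ∀ t ∈ Ioo (-S.lifespan R) (S.lifespan R), ‖u t‖ ≤ 2 * R ∧
        HasDerivAt u (S.proj s (S.B (u t) (u t))) t ∧
        ‖u t‖ ^ 2 ≤ ‖u₀‖ ^ 2 * Real.exp |∫ r in (0 : ℝ)..t, 2 * S.K (u r)| := by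
  have hc := S.c_pos
  set τ := S.lifespan R with hτ
  have hτ0 : 0 < τ := S.lifespan_pos hR
  set W : Submodule ℝ Y := Submodule.span ℝ (S.e '' s) with hW
  have : FiniteDimensional ℝ W := FiniteDimensional.span_of_finite ℝ (s.finite_toSet.image _)
  set P : X →L[ℝ] W := (S.proj s).codRestrict W (S.proj_mem_span s) with hP
  -- The cutoff, equal to 1 on the ball of radius 2R and 0 beyond 3R, makes the finite-dimensional
  -- field bounded and globally Lipschitz, so that Picard–Lindelöf covers all of [-τ, τ]. It is
  -- removed once ‖u‖ ≤ 2R is known.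
  set χ : ContDiffBump (0 : W) := ⟨2 * R, 3 * R, by positivity, by linarith⟩ with hχ
  set G : W → W := fun w => χ w • P (S.B w w) with hG
  have hGd : ContDiff ℝ 1 G := by
    refine χ.contDiff.smul (P.contDiff.comp ?_)
    have h1 : ContDiff ℝ 1 fun w : W => S.B (w : Y) :=
      (S.B.contDiff).comp W.subtypeL.contDiff
    exact h1.clm_apply W.subtypeL.contDiff
  have hGs : HasCompactSupport G := χ.hasCompactSupport.smul_right
  obtain ⟨Lk, hLk⟩ := hGd.lipschitzWith_of_hasCompactSupport hGs one_ne_zero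
  obtain ⟨D, hD⟩ := hGs.exists_bound_of_continuous hGd.continuous
  set D' : NNReal := Real.toNNReal D
  have hpl : IsPicardLindelof (fun _ => G) (tmin := -τ) (tmax := τ)
      ⟨0, by simp [hτ0.le]⟩ (P (S.J u₀)) (D' * Real.toNNReal τ) 0 D' Lk := by
    refine ⟨fun t _ => hLk.lipschitzOnWith, fun _ _ => continuousOn_const, fun t _ x _ => ?_, ?_⟩
    · exact (hD x).trans (Real.le_coe_toNNReal D)
    · simp [hτ0.le]
  obtain ⟨w, hw0, hw⟩ := hpl.exists_eq_forall_mem_Icc_hasDerivWithinAt₀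
  have hw0 : w 0 = P (S.J u₀) := hw0
  set u : ℝ → Y := fun t => (w t : Y) with hu
  have hucont : ContinuousOn u (Icc (-τ) τ) := fun t ht =>
    W.subtypeL.continuous.continuousAt.comp_continuousWithinAt (hw t ht).continuousWithinAt
  have huderiv : ∀ t ∈ Ioo (-τ) τ, HasDerivAt u (χ (w t) • S.proj s (S.B (u t) (u t))) t := by
    intro t ht
    exact W.subtypeL.hasFDerivAt.comp_hasDerivAt t
      ((hw t (Ioo_subset_Icc_self ht)).hasDerivAt (Icc_mem_nhds ht.1 ht.2))
  have hu0 : u 0 = S.proj s (S.J u₀) := by simp [hu, hw0, hP]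
  have huspan : ∀ t, u t ∈ Submodule.span ℝ (range S.e) := fun t =>
    Submodule.span_mono (image_subset_range _ _) (w t).2
  have hEderiv : ∀ t ∈ Ioo (-τ) τ, HasDerivAt (fun t => ‖u t‖ ^ 2)
      (2 * ⟪u t, χ (w t) • S.proj s (S.B (u t) (u t))⟫) t := fun t ht => (huderiv t ht).norm_sq
  -- Ensures that the finite sum z below has the coefficients required by `energy_le` at every
  -- index, not only in s.
  have hmodes : ∀ t, ∀ i, i ∉ s → ⟪S.b i, S.J (u t)⟫ = 0 := by
    intro t i hi
    have : ∀ y ∈ W, ⟪S.b i, S.J y⟫ = 0 := by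
      intro y hy
      induction hy using Submodule.span_induction with
      | mem y hy =>
        obtain ⟨j, hj, rfl⟩ := hy
        rw [S.J_e]
        exact S.b.orthonormal.2 fun h => hi (h ▸ hj)
      | zero => simp
      | add y z _ _ hy hz => rw [map_add, inner_add_right, hy, hz, add_zero]
      | smul a y _ hy => rw [map_smul, real_inner_smul_right, hy, mul_zero]
    exact this _ (w t).2
  have henergy : ∀ t, |2 * ⟪u t, χ (w t) • S.proj s (S.B (u t) (u t))⟫| ≤
      χ (w t) * (2 * S.K (u t) * ‖u t‖ ^ 2) := by
    intro t
    classical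
    set z : X := ∑ i ∈ s, (S.lam i * ⟪S.b i, S.J (u t)⟫) • S.b i with hz
    have hz' : ∀ i, ⟪S.b i, z⟫ = S.lam i * ⟪S.b i, S.J (u t)⟫ := by
      intro i
      rw [hz, inner_sum]
      simp_rw [real_inner_smul_right, orthonormal_iff_ite.1 S.b.orthonormal]
      by_cases hi : i ∈ s
      · simp [hi]
      · simp [hi, hmodes t i hi]
    have h1 := S.energy_le (u t) (huspan t) z hz'
    have h2 : ⟪u t, S.proj s (S.B (u t) (u t))⟫ = ⟪S.B (u t) (u t), z⟫ := by
      rw [real_inner_comm, inner_proj, hz, inner_sum]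
      refine Finset.sum_congr rfl fun i _ => ?_
      rw [real_inner_smul_right, real_inner_comm (S.b i)]; ring
    rw [real_inner_smul_right, h2, abs_mul, abs_mul, abs_of_nonneg χ.nonneg, abs_two]
    have := mul_le_mul_of_nonneg_left h1 (χ.nonneg (x := w t))
    linarith
  have hKc : ContinuousOn (fun t => 2 * S.K (u t)) (Icc (-τ) τ) :=
    continuousOn_const.mul (S.continuous_K.comp_continuousOn hucont)
  have hsmall : ∀ t ∈ Icc (-τ) τ, ‖u t‖ ≤ 2 * R := by
    intro t ht
    have hgr := le_mul_exp_of_abs_deriv_le (φ := fun t => ‖u t‖ ^ 2)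
      (k := fun _ => 6 * S.c * R) (hucont.norm.pow 2) hEderiv continuousOn_const
      (fun _ _ => sq_nonneg _) (fun t ht => ?_) (s := 0) ⟨by linarith, hτ0.le⟩ ht
    · have hint : |∫ _ in (0 : ℝ)..t, 6 * S.c * R| ≤ 6 * S.c * R * τ := by
        rw [intervalIntegral.integral_const, smul_eq_mul, sub_zero, abs_mul, mul_comm,
          abs_of_pos (show 0 < 6 * S.c * R by positivity)]
        gcongr
        exact abs_le.2 ht
      have h1 : ‖u 0‖ ≤ R := by rw [hu0]; exact (S.norm_proj_J_le s u₀).trans hu₀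
      have h2 : ‖u t‖ ^ 2 ≤ R ^ 2 * 4 := by
        refine hgr.trans ?_
        gcongr
        exact (Real.exp_le_exp.2 hint).trans (S.exp_lifespan_lt hR).le
      refine le_of_sq_le_sq ?_ (by positivity)
      linarith
    · refine (henergy t).trans ?_
      -- Within 3R the bound on K gives the rate 6cR; beyond it the truncated field vanishes.
      by_cases h3 : ‖u t‖ ≤ 3 * R
      · have h4 : S.K (u t) ≤ S.c * (3 * R) := (S.K_le _).trans (by gcongr)
        have h5 := mul_le_mul_of_nonneg_right h4 (sq_nonneg ‖u t‖)
        have h6 := S.K_nonneg (u t)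
        calc χ (w t) * (2 * S.K (u t) * ‖u t‖ ^ 2) ≤ 1 * (2 * S.K (u t) * ‖u t‖ ^ 2) := by
              gcongr; exact χ.le_one
          _ ≤ _ := by linarith
      · have : χ (w t) = 0 := χ.zero_of_le_dist (by
          rw [dist_zero_right]; exact (not_le.1 h3).le)
        rw [this, zero_mul]; positivity
  have hχ1 : ∀ t ∈ Icc (-τ) τ, χ (w t) = 1 := fun t ht =>
    χ.one_of_mem_closedBall (by rw [mem_closedBall_zero_iff]; exact hsmall t ht)
  refine ⟨u, hu0, fun t ht => ⟨hsmall t (Ioo_subset_Icc_self ht), ?_, ?_⟩⟩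
  · have := huderiv t ht
    rwa [hχ1 t (Ioo_subset_Icc_self ht), one_smul] at this
  · have hgr := le_mul_exp_of_abs_deriv_le (φ := fun t => ‖u t‖ ^ 2)
      (k := fun t => 2 * S.K (u t)) (hucont.norm.pow 2) hEderiv hKc
      (fun _ _ => sq_nonneg _) (fun t ht => ?_) (s := 0) ⟨by linarith, hτ0.le⟩
      (Ioo_subset_Icc_self ht)
    · refine hgr.trans ?_
      gcongr
      rw [hu0]; exact S.norm_proj_J_le s u₀
    · exact (henergy t).trans_eq (by rw [hχ1 t (Ioo_subset_Icc_self ht), one_mul])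

end EvolutionSystem

/-! ### Galerkin limit and local well-posedness -/

namespace EvolutionSystem

variable {X Y ι : Type*} [NormedAddCommGroup X] [InnerProductSpace ℝ X]
    [NormedAddCommGroup Y] [InnerProductSpace ℝ Y] (S : EvolutionSystem X Y ι)

theorem continuous_B_self : Continuous fun y : Y => S.B y y := by fun_prop

theorem solvesModes_of_hasDerivAt {A : Set ι} {u : ℝ → Y} {α β : ℝ}
    (h : ∀ i ∈ A, ∀ t ∈ Icc α β,
      HasDerivAt (fun t => ⟪S.b i, S.J (u t)⟫) ⟪S.b i, S.B (u t) (u t)⟫ t) :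
    S.SolvesModes A u α β := fun i hi =>
  ⟨fun t ht => (h i hi t ht).continuousAt.continuousWithinAt,
    fun t ht => h i hi t (Ioo_subset_Icc_self ht)⟩

theorem hasDerivAt_inner_galerkin {s : Finset ι} {u : ℝ → Y} {t : ℝ}
    (h : HasDerivAt u (S.proj s (S.B (u t) (u t))) t) {i : ι} (hi : i ∈ s) :
    HasDerivAt (fun t => ⟪S.b i, S.J (u t)⟫) ⟪S.b i, S.B (u t) (u t)⟫ t := by
  rw [← S.inner_J_proj_of_mem (S.B (u t) (u t)) hi]
  exact ((innerSL ℝ (S.b i)).comp S.J).hasFDerivAt.comp_hasDerivAt t h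

theorem uIcc_subset_Ioo {a b s t : ℝ} (hs : s ∈ Ioo a b) (ht : t ∈ Ioo a b) :
    uIcc s t ⊆ Ioo a b := ordConnected_Ioo.uIcc_subset hs ht

/-- Local existence of bounded solutions of all modes. -/
theorem exists_local_solvesModes [CompleteSpace X] [CompleteSpace Y] {R : ℝ} (hR : 0 < R) {u₀ : Y}
    (hu₀ : ‖u₀‖ ≤ R) : ∃ u : ℝ → Y, u 0 = u₀ ∧
      ∀ t ∈ Ioo (-S.lifespan R) (S.lifespan R), ‖u t‖ ≤ 2 * R ∧
        ContinuousAt (fun t => S.J (u t)) t ∧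
        (∀ i, HasDerivAt (fun t => ⟪S.b i, S.J (u t)⟫) ⟪S.b i, S.B (u t) (u t)⟫ t) ∧
        ‖u t‖ ^ 2 ≤ ‖u₀‖ ^ 2 * Real.exp |∫ r in (0 : ℝ)..t, 2 * S.K (u r)| := by
  have hc := S.c_pos
  set τ := S.lifespan R with hτ
  have hτ0 : 0 < τ := S.lifespan_pos hR
  have h0I : (0 : ℝ) ∈ Ioo (-τ) τ := ⟨by linarith, hτ0⟩
  choose U hU0 hU using fun N : ℕ => S.exists_galerkin hR (S.modes N) hu₀
  have hUR : ∀ N, ∀ t ∈ Ioo (-τ) τ, ‖U N t‖ ≤ 2 * R := fun N t ht => (hU N t ht).1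
  have hUd : ∀ N, ∀ t ∈ Ioo (-τ) τ,
      HasDerivAt (U N) (S.proj (S.modes N) (S.B (U N t) (U N t))) t := fun N t ht => (hU N t ht).2.1
  have hUc : ∀ N, ContinuousOn (U N) (Ioo (-τ) τ) := fun N t ht =>
    (hUd N t ht).continuousAt.continuousWithinAt
  have hmono : ∀ {N M : ℕ}, N ≤ M → (S.modes N : Set ι) ⊆ S.modes M := fun {N M} h i hi => by
    have h1 := S.mem_modes.1 hi
    exact S.mem_modes.2 (h1.trans (by exact_mod_cast h))
  have hUm : ∀ {N M : ℕ}, N ≤ M → ∀ {α β : ℝ}, Icc α β ⊆ Ioo (-τ) τ →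
      S.SolvesModes (S.modes N) (U M) α β := fun {N M} h α β hI =>
    S.solvesModes_of_hasDerivAt fun i hi t ht =>
      S.hasDerivAt_inner_galerkin (hUd M t (hI ht)) (hmono h hi)
  obtain ⟨L, hL, ε, hε, hcmp⟩ := S.exists_comparison (2 * R)
  -- For M ≥ N both approximations solve the modes up to N exactly, so the comparison estimate
  -- applies at level N, and the data differ only by tails.
  have hcauchy : ∀ t ∈ Ioo (-τ) τ, CauchySeq fun N => S.J (U N t) := by
    intro t ht
    rw [Metric.cauchySeq_iff']
    intro δ hδ
    have hlim : Tendsto (fun N : ℕ => (16 * R ^ 2 / N + ε N) * Real.exp (L * |t - 0|)) atTop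
        (𝓝 0) := by
      have h1 := tendsto_const_div_atTop_nhds_zero_nat (16 * R ^ 2)
      have h2 : Tendsto (fun N : ℕ => ε N) atTop (𝓝 0) := hε.comp tendsto_natCast_atTop_atTop
      simpa using (h1.add h2).mul_const (Real.exp (L * |t - 0|))
    have hev := hlim.eventually (gt_mem_nhds (show 0 < δ ^ 2 by positivity))
    obtain ⟨N, hN, hN0⟩ := (hev.and (eventually_gt_atTop 0)).exists
    refine ⟨N, fun M hM => ?_⟩
    have hN0' : (0 : ℝ) < N := by exact_mod_cast hN0
    have hI : Icc (min 0 t) (max 0 t) ⊆ Ioo (-τ) τ := uIcc_subset_Ioo h0I ht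
    have h1 := hcmp N hN0' (U M) (U N) (min 0 t) (max 0 t) (hUm hM hI) (hUm le_rfl hI)
      (fun r hr => hUR M r (hI hr)) (fun r hr => hUR N r (hI hr)) 0 (left_mem_uIcc) t
      (right_mem_uIcc)
    have h2 : ∀ M : ℕ, N ≤ M → ‖S.J (u₀ - U M 0)‖ ^ 2 ≤ 4 * R ^ 2 / N := fun M hM => by
      rw [hU0]
      have hM' : (0 : ℝ) < M := by exact_mod_cast lt_of_lt_of_le hN0 hM
      have hNM : (N : ℝ) ≤ M := by exact_mod_cast hM
      refine (S.norm_J_sub_proj_sq_le hM' u₀).trans ?_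
      gcongr
    have h3 : ‖S.J (U M 0) - S.J (U N 0)‖ ^ 2 ≤ 16 * R ^ 2 / N := by
      have h4 : ‖S.J (U M 0) - S.J (U N 0)‖ ≤ ‖S.J (u₀ - U M 0)‖ + ‖S.J (u₀ - U N 0)‖ := by
        have : S.J (U M 0) - S.J (U N 0) = S.J (u₀ - U N 0) - S.J (u₀ - U M 0) := by
          simp only [map_sub]; exact (sub_sub_sub_cancel_left _ _ _).symm
        rw [this, add_comm]; exact norm_sub_le _ _
      have h5 := h2 M hM
      have h6 := h2 N le_rfl
      -- From (x + y)² ≤ 2x² + 2y² with x² and y² each at most 4R²/N.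
      have h7 : 16 * R ^ 2 / N = 4 * (4 * R ^ 2 / (N : ℝ)) := by ring
      rw [h7]
      nlinarith [norm_nonneg (S.J (U M 0) - S.J (U N 0)), sq_nonneg (‖S.J (u₀ - U M 0)‖ -
        ‖S.J (u₀ - U N 0)‖), norm_nonneg (S.J (u₀ - U M 0)), norm_nonneg (S.J (u₀ - U N 0))]
    rw [dist_eq_norm]
    refine lt_of_pow_lt_pow_left₀ 2 hδ.le (h1.trans_lt (lt_of_le_of_lt ?_ hN))
    gcongr
  -- The time restriction sits inside the existential so that a total function can be chosen; its
  -- values outside the interval play no role.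
  have hex : ∀ t, ∃ y : Y, t ∈ Ioo (-τ) τ →
      Tendsto (fun N => S.J (U N t)) atTop (𝓝 (S.J y)) ∧ ‖y‖ ≤ 2 * R := by
    intro t
    by_cases ht : t ∈ Ioo (-τ) τ
    · obtain ⟨x, hx⟩ := cauchySeq_tendsto_of_complete (hcauchy t ht)
      obtain ⟨y, rfl, hy⟩ := S.exists_J_eq_of_tendsto hx tendsto_const_nhds
        (Eventually.of_forall fun N => hUR N t ht)
      exact ⟨y, fun _ => ⟨hx, hy⟩⟩
    · exact ⟨0, fun h => absurd h ht⟩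
  choose u hu using hex
  have hulim : ∀ t ∈ Ioo (-τ) τ, Tendsto (fun N => S.J (U N t)) atTop (𝓝 (S.J (u t))) :=
    fun t ht => (hu t ht).1
  have huR : ∀ t ∈ Ioo (-τ) τ, ‖u t‖ ≤ 2 * R := fun t ht => (hu t ht).2
  have hu0 : u 0 = u₀ := by
    refine S.J_injective (tendsto_nhds_unique (hulim 0 h0I) ?_)
    simp_rw [hU0]
    exact S.tendsto_J_proj u₀
  -- The time derivatives are bounded in X uniformly in N, so the limit is Lipschitz with values in
  -- X.
  have hlip : ∀ s ∈ Ioo (-τ) τ, ∀ t ∈ Ioo (-τ) τ,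
      ‖S.J (u t) - S.J (u s)‖ ≤ S.c * ‖S.J‖ * (2 * R) ^ 2 * ‖t - s‖ := by
    intro s hs t ht
    refine le_of_tendsto ((hulim t ht).sub (hulim s hs)).norm (Eventually.of_forall fun N => ?_)
    refine Convex.norm_image_sub_le_of_norm_hasDerivWithin_le (f := fun t => S.J (U N t))
      (f' := fun t => S.J (S.proj (S.modes N) (S.B (U N t) (U N t)))) (s := Ioo (-τ) τ)
      (fun r hr => (S.J.hasFDerivAt.comp_hasDerivAt r (hUd N r hr)).hasDerivWithinAt)
      (fun r hr => ?_) (convex_Ioo _ _) hs ht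
    refine (S.norm_J_proj_le _ _).trans ((S.norm_B_self_le _).trans ?_)
    have := hUR N r hr
    gcongr
  have hJc : ∀ t ∈ Ioo (-τ) τ, ContinuousAt (fun t => S.J (u t)) t := by
    intro t ht
    rw [ContinuousAt, tendsto_iff_norm_sub_tendsto_zero]
    have hlim : Tendsto (fun r => S.c * ‖S.J‖ * (2 * R) ^ 2 * ‖r - t‖) (𝓝 t) (𝓝 0) := by
      have : Continuous fun r => S.c * ‖S.J‖ * (2 * R) ^ 2 * ‖r - t‖ := by fun_prop
      simpa using this.tendsto t
    refine squeeze_zero' (Eventually.of_forall fun _ => norm_nonneg _) ?_ hlim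
    filter_upwards [Ioo_mem_nhds ht.1 ht.2] with r hr
    exact hlip t ht r hr
  have hFc : ∀ i, ∀ t ∈ Ioo (-τ) τ, ContinuousAt (fun t => ⟪S.b i, S.B (u t) (u t)⟫) t :=
    fun i t ht => S.tendsto_inner_B (hJc t ht) i
  have hI : ∀ t ∈ Ioo (-τ) τ, uIcc 0 t ⊆ Ioo (-τ) τ := fun t ht => uIcc_subset_Ioo h0I ht
  have hint : ∀ i, ∀ t ∈ Ioo (-τ) τ, ⟪S.b i, S.J (u t)⟫ =
      ⟪S.b i, S.J (u 0)⟫ + ∫ r in (0 : ℝ)..t, ⟪S.b i, S.B (u r) (u r)⟫ := by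
    intro i t ht
    have hUcont : ∀ N, ContinuousOn (fun r => ⟪S.b i, S.B (U N r) (U N r)⟫) (uIcc 0 t) := fun N =>
      continuousOn_const.inner (S.continuous_B_self.comp_continuousOn ((hUc N).mono (hI t ht)))
    have h1 : Tendsto (fun N => ∫ r in (0 : ℝ)..t, ⟪S.b i, S.B (U N r) (U N r)⟫) atTop
        (𝓝 (∫ r in (0 : ℝ)..t, ⟪S.b i, S.B (u r) (u r)⟫)) := by
      refine intervalIntegral.tendsto_integral_filter_of_dominated_convergence
        (fun _ => S.c * ‖S.J‖ * (2 * R) ^ 2) ?_ ?_ intervalIntegrable_const ?_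
      · exact Eventually.of_forall fun N =>
          ((hUcont N).mono uIoc_subset_uIcc).aestronglyMeasurable measurableSet_uIoc
      · refine Eventually.of_forall fun N => Eventually.of_forall fun r hr => ?_
        have h3 := hUR N r (hI t ht (uIoc_subset_uIcc hr))
        refine (norm_inner_le_norm _ _).trans ?_
        rw [S.b.orthonormal.1, one_mul]
        refine (S.norm_B_self_le _).trans ?_
        gcongr
      · exact Eventually.of_forall fun r hr =>
          S.tendsto_inner_B (hulim r (hI t ht (uIoc_subset_uIcc hr))) i
    have h2 : Tendsto (fun N => ⟪S.b i, S.J (U N t)⟫ - ⟪S.b i, S.J (U N 0)⟫) atTop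
        (𝓝 (⟪S.b i, S.J (u t)⟫ - ⟪S.b i, S.J (u 0)⟫)) :=
      (tendsto_const_nhds.inner (hulim t ht)).sub (tendsto_const_nhds.inner (hulim 0 h0I))
    have h3 : ∀ᶠ N : ℕ in atTop, ∫ r in (0 : ℝ)..t, ⟪S.b i, S.B (U N r) (U N r)⟫ =
        ⟪S.b i, S.J (U N t)⟫ - ⟪S.b i, S.J (U N 0)⟫ := by
      -- The i-th mode is retained, and its equation exact, once N ≥ lam i.
      filter_upwards [tendsto_natCast_atTop_atTop.eventually_ge_atTop (S.lam i)] with N hN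
      exact intervalIntegral.integral_eq_sub_of_hasDerivAt
        (fun r hr => S.hasDerivAt_inner_galerkin (hUd N r (hI t ht hr)) (S.mem_modes.2 hN))
        (hUcont N).intervalIntegrable
    have h4 := tendsto_nhds_unique (h1.congr' h3) h2
    linarith
  refine ⟨u, hu0, fun t ht => ⟨huR t ht, hJc t ht, fun i => ?_, ?_⟩⟩
  · have hcont : ContinuousOn (fun r => ⟪S.b i, S.B (u r) (u r)⟫) (Ioo (-τ) τ) := fun r hr =>
      (hFc i r hr).continuousWithinAt
    have h1 := (intervalIntegral.integral_hasDerivAt_right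
      ((hcont.mono (hI t ht)).intervalIntegrable)
      (hcont.stronglyMeasurableAtFilter isOpen_Ioo t ht) (hFc i t ht)).const_add
        ⟪S.b i, S.J (u 0)⟫
    refine h1.congr_of_eventuallyEq ?_
    filter_upwards [Ioo_mem_nhds ht.1 ht.2] with r hr
    exact hint i r hr
  · have h1 : Tendsto (fun N => ∫ r in (0 : ℝ)..t, 2 * S.K (U N r)) atTop
        (𝓝 (∫ r in (0 : ℝ)..t, 2 * S.K (u r))) := by
      refine intervalIntegral.tendsto_integral_filter_of_dominated_convergence
        (fun _ => 2 * (S.c * (2 * R))) ?_ ?_ intervalIntegrable_const ?_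
      · exact Eventually.of_forall fun N => (continuousOn_const.mul (S.continuous_K.comp_continuousOn
          ((hUc N).mono (uIoc_subset_uIcc.trans (hI t ht))))).aestronglyMeasurable measurableSet_uIoc
      · refine Eventually.of_forall fun N => Eventually.of_forall fun r hr => ?_
        have h3 := hUR N r (hI t ht (uIoc_subset_uIcc hr))
        have h4 := S.K_nonneg (U N r)
        rw [Real.norm_of_nonneg (by positivity)]
        have := S.K_le (U N r)
        gcongr
        exact this.trans (by gcongr)
      · exact Eventually.of_forall fun r hr =>
          (S.tendsto_K (hulim r (hI t ht (uIoc_subset_uIcc hr)))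
            (Eventually.of_forall fun N => hUR N r (hI t ht (uIoc_subset_uIcc hr)))).const_mul 2
    have h2 := ((h1.abs.rexp).const_mul (‖u₀‖ ^ 2)).sqrt
    -- The right-hand sides of the energy inequality converge because K does, while the Y-norm is
    -- lower semicontinuous under convergence in X.
    obtain ⟨y, hy, hyle⟩ := S.exists_J_eq_of_tendsto (hulim t ht) h2
      (Eventually.of_forall fun N => Real.le_sqrt_of_sq_le (hU N t ht).2.2)
    rw [S.J_injective hy] at hyle
    exact (Real.le_sqrt (norm_nonneg _) (by positivity)).1 hyle

/-- A bounded solution of all modes obeys the energy inequality on short time intervals, forwards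
and backwards. -/
theorem norm_sq_le_mul_exp [CompleteSpace X] [CompleteSpace Y] {u : ℝ → Y} {α β R : ℝ} (hR : 0 < R)
    (hu : S.SolvesModes univ u α β) (hRu : ∀ t ∈ Icc α β, ‖u t‖ ≤ R) {s t : ℝ} (hs : s ∈ Icc α β)
    (ht : t ∈ Icc α β) (hst : |t - s| < S.lifespan R) :
    ‖u t‖ ^ 2 ≤ ‖u s‖ ^ 2 * Real.exp |∫ r in s..t, 2 * S.K (u r)| := by
  -- The Galerkin limit restarted from u s obeys the inequality by construction; uniqueness
  -- identifies it with u between s and t.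
  obtain ⟨w, hw0, hw⟩ := S.exists_local_solvesModes hR (hRu s hs)
  have hI : ∀ r ∈ uIcc s t, r - s ∈ Ioo (-S.lifespan R) (S.lifespan R) := by
    intro r hr
    have := abs_sub_left_of_mem_uIcc hr
    exact abs_lt.1 (this.trans_lt hst)
  have hsub : uIcc s t ⊆ Icc α β := ordConnected_Icc.uIcc_subset hs ht
  have hwm : S.SolvesModes univ (fun r => w (r - s)) (min s t) (max s t) :=
    S.solvesModes_of_hasDerivAt fun i _ r hr => by
      have := (hw (r - s) (hI r hr)).2.2.1 i
      exact HasDerivAt.comp_sub_const r s this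
  have heq := S.eq_of_solvesModes (R := 2 * R)
    (hu.mono subset_rfl (le_min hs.1 ht.1) (max_le hs.2 ht.2)) hwm
    (fun r hr => (hRu r (hsub hr)).trans (by linarith)) (fun r hr => (hw _ (hI r hr)).1)
    (s := s) left_mem_uIcc (by simp [hw0])
  have h1 := (hw (t - s) (hI t right_mem_uIcc)).2.2.2
  have h2 : ∫ r in (0 : ℝ)..(t - s), 2 * S.K (w r) = ∫ r in s..t, 2 * S.K (u r) := by
    have h3 := intervalIntegral.integral_comp_sub_right (a := s) (b := t)
      (fun r => 2 * S.K (w r)) s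
    rw [sub_self] at h3
    rw [← h3]
    exact intervalIntegral.integral_congr fun r hr => by simp only [heq r hr]
  rw [h2] at h1
  rw [heq t right_mem_uIcc]
  exact h1

/-- Continuity of u in Y makes B(u, u) continuous in X, so the integrated equations of the modes
assemble into one X-valued integral, which can be differentiated. -/
theorem hasDerivAt_J_of_continuousOn [CompleteSpace X] {u : ℝ → Y} {α β : ℝ}
    (hc : ContinuousOn u (Ioo α β))
    (hu : ∀ t ∈ Ioo α β, ∀ i, HasDerivAt (fun t => ⟪S.b i, S.J (u t)⟫) ⟪S.b i, S.B (u t) (u t)⟫ t)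
    {t : ℝ} (ht : t ∈ Ioo α β) : HasDerivAt (fun t => S.J (u t)) (S.B (u t) (u t)) t := by
  have hFc : ContinuousOn (fun t => S.B (u t) (u t)) (Ioo α β) :=
    S.continuous_B_self.comp_continuousOn hc
  have hint : ∀ r ∈ Ioo α β, IntervalIntegrable (fun t => S.B (u t) (u t)) volume t r :=
    fun r hr => (hFc.mono (uIcc_subset_Ioo ht hr)).intervalIntegrable
  have heq : ∀ r ∈ Ioo α β, S.J (u r) = S.J (u t) + ∫ x in t..r, S.B (u x) (u x) := by
    intro r hr
    refine S.b.repr.injective (lp.ext (funext fun i => ?_))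
    rw [S.b.repr_apply_apply, S.b.repr_apply_apply, inner_add_right]
    have h1 : ⟪S.b i, ∫ x in t..r, S.B (u x) (u x)⟫ = ∫ x in t..r, ⟪S.b i, S.B (u x) (u x)⟫ :=
      ((innerSL ℝ (S.b i)).intervalIntegral_comp_comm (hint r hr)).symm
    have h2 := intervalIntegral.integral_eq_sub_of_hasDerivAt
      (fun x hx => hu x (uIcc_subset_Ioo ht hr hx) i)
      (((continuousOn_const.inner hFc).mono (uIcc_subset_Ioo ht hr)).intervalIntegrable)
    rw [h1, h2]; ring
  have h1 := (intervalIntegral.integral_hasDerivAt_right (hint t ht)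
    (hFc.stronglyMeasurableAtFilter isOpen_Ioo t ht)
    (hFc.continuousAt (Ioo_mem_nhds ht.1 ht.2))).const_add (S.J (u t))
  refine h1.congr_of_eventuallyEq ?_
  filter_upwards [Ioo_mem_nhds ht.1 ht.2] with r hr
  exact heq r hr

/-- Local existence of strong solutions, on a time interval that depends only on the size of the
data. -/
theorem exists_local [CompleteSpace X] [CompleteSpace Y] {R : ℝ} (hR : 0 < R) {u₀ : Y}
    (hu₀ : ‖u₀‖ ≤ R) : ∃ u : ℝ → Y, u 0 = u₀ ∧ ContinuousOn u (Ioo (-S.lifespan R) (S.lifespan R)) ∧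
      ∀ t ∈ Ioo (-S.lifespan R) (S.lifespan R),
        ‖u t‖ ≤ 2 * R ∧ HasDerivAt (fun t => S.J (u t)) (S.B (u t) (u t)) t := by
  obtain ⟨u, hu0, hu⟩ := S.exists_local_solvesModes hR hu₀
  set τ := S.lifespan R
  have hcont : ContinuousOn u (Ioo (-τ) τ) := by
    intro t ht
    refine ContinuousAt.continuousWithinAt ?_
    have hcpos := S.c_pos
    set M : ℝ := 2 * (S.c * (2 * R)) with hM
    have hR2 : 0 < 2 * R := by positivity
    have hev : ∀ᶠ r in 𝓝 t, r ∈ Ioo (-τ) τ ∧ |r - t| < S.lifespan (2 * R) :=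
      Filter.Eventually.and (Ioo_mem_nhds ht.1 ht.2)
        (Metric.ball_mem_nhds t (S.lifespan_pos hR2))
    -- The solution is bounded by 2R, hence the lifespan at 2R and the bound M for 2K.
    have hstep : ∀ s ∈ Ioo (-τ) τ, ∀ r ∈ Ioo (-τ) τ, |r - s| < S.lifespan (2 * R) →
        ‖u r‖ ^ 2 ≤ ‖u s‖ ^ 2 * Real.exp (M * |r - s|) := by
      intro s hs r hr hsr
      have hsub : uIcc s r ⊆ Ioo (-τ) τ := uIcc_subset_Ioo hs hr
      have h1 := S.norm_sq_le_mul_exp (u := u) (α := min s r) (β := max s r) hR2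
        (S.solvesModes_of_hasDerivAt fun i _ x hx => (hu x (hsub hx)).2.2.1 i)
        (fun x hx => (hu x (hsub hx)).1) (s := s) (t := r) left_mem_uIcc right_mem_uIcc hsr
      have hb : ∀ x ∈ uIoc s r, ‖2 * S.K (u x)‖ ≤ M := fun x hx => by
        have h3 := (hu x (hsub (uIoc_subset_uIcc hx))).1
        have h4 := S.K_nonneg (u x)
        rw [Real.norm_of_nonneg (by positivity)]
        have := S.K_le (u x)
        rw [hM]
        gcongr
        exact this.trans (by gcongr)
      refine h1.trans ?_
      gcongr
      exact intervalIntegral.norm_integral_le_of_norm_le_const hb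
    refine S.tendsto_of_tendsto_norm (hu t ht).2.1 ?_
    have hexp : ∀ a : ℝ, Tendsto (fun r => ‖u t‖ ^ 2 * Real.exp (a * |r - t|)) (𝓝 t)
        (𝓝 (‖u t‖ ^ 2)) := by
      intro a
      have : Continuous fun r => ‖u t‖ ^ 2 * Real.exp (a * |r - t|) := by fun_prop
      simpa using this.tendsto t
    -- The energy inequality from r to t bounds ‖u r‖ from below, the one from t to r bounds it from
    -- above. This is where reversibility in time is used.
    refine tendsto_of_tendsto_of_tendsto_of_le_of_le' (hexp (-M)) (hexp M) ?_ ?_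
    · filter_upwards [hev] with r hr
      have h1 := hstep r hr.1 t ht (by rw [abs_sub_comm]; exact hr.2)
      rw [abs_sub_comm] at h1
      have h2 := mul_le_mul_of_nonneg_right h1 (Real.exp_pos (-M * |r - t|)).le
      have h3 : Real.exp (M * |r - t|) * Real.exp (-M * |r - t|) = 1 := by
        rw [← Real.exp_add]; simp
      rwa [mul_assoc, h3, mul_one] at h2
    · filter_upwards [hev] with r hr
      exact hstep t ht r hr.1 hr.2
  exact ⟨u, hu0, hcont, fun t ht => ⟨(hu t ht).1,
    S.hasDerivAt_J_of_continuousOn hcont (fun r hr => (hu r hr).2.2.1) ht⟩⟩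

theorem solvesModes_of_hasDerivWithinAt {u : ℝ → Y} {T : ℝ} (hc : ContinuousOn u (Ico 0 T))
    (hd : ∀ t ∈ Ico 0 T, HasDerivWithinAt (fun t => S.J (u t)) (S.B (u t) (u t)) (Ico 0 T) t)
    {α β : ℝ} (hα : 0 ≤ α) (hβ : β < T) : S.SolvesModes univ u α β := fun i _ => by
  have hsub : Icc α β ⊆ Ico 0 T := fun t ht => ⟨hα.trans ht.1, ht.2.trans_lt hβ⟩
  refine ⟨continuousOn_const.inner (S.J.continuous.comp_continuousOn (hc.mono hsub)),
    fun t ht => ?_⟩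
  have h1 := (hd t (hsub (Ioo_subset_Icc_self ht))).hasDerivAt
    (Ico_mem_nhds (hα.trans_lt ht.1) (ht.2.trans hβ))
  exact (innerSL ℝ (S.b i)).hasFDerivAt.comp_hasDerivAt t h1

/-! ### Continuation beyond T -/

/-- A solution on `[0, T)` along which the growth functional is integrable stays bounded. -/
theorem norm_sq_le_of_integral_le [CompleteSpace X] [CompleteSpace Y] {u : ℝ → Y} {T M : ℝ}
    (hc : ContinuousOn u (Ico 0 T))
    (hd : ∀ t ∈ Ico 0 T, HasDerivWithinAt (fun t => S.J (u t)) (S.B (u t) (u t)) (Ico 0 T) t)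
    (hM : ∀ t ∈ Ico 0 T, ∫ r in (0 : ℝ)..t, S.K (u r) ≤ M) {t : ℝ} (ht : t ∈ Ico 0 T) :
    ‖u t‖ ^ 2 ≤ ‖u 0‖ ^ 2 * Real.exp (2 * M) := by
  have hsub : ∀ {x y : ℝ}, 0 ≤ x → y ≤ t → Icc x y ⊆ Ico 0 T := fun hx hy r hr =>
    ⟨hx.trans hr.1, (hr.2.trans hy).trans_lt ht.2⟩
  -- This crude bound on [0, t] only fixes the step length; it does not enter the final estimate.
  obtain ⟨R₁, hR₁⟩ := isCompact_Icc.exists_bound_of_continuousOn (hc.mono (hsub le_rfl le_rfl))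
  set R : ℝ := |R₁| + 1
  have hR : 0 < R := by positivity
  have hRu : ∀ r ∈ Icc 0 t, ‖u r‖ ≤ R := fun r hr =>
    (hR₁ r hr).trans ((le_abs_self _).trans (by simp [R]))
  have hτ := S.lifespan_pos hR
  set τ := S.lifespan R
  have hmodes := S.solvesModes_of_hasDerivWithinAt hc hd le_rfl ht.2
  have hKc : ContinuousOn (fun r => 2 * S.K (u r)) (Icc 0 t) :=
    continuousOn_const.mul (S.continuous_K.comp_continuousOn (hc.mono (hsub le_rfl le_rfl)))
  have hKi : ∀ x ∈ Icc 0 t, ∀ y ∈ Icc 0 t,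
      IntervalIntegrable (fun r => 2 * S.K (u r)) volume x y := fun x hx y hy =>
    (hKc.mono (ordConnected_Icc.uIcc_subset hx hy)).intervalIntegrable
  -- The short-time inequality is chained over steps of length τ/2; the exponents add up to a single
  -- integral of 2K.
  have hstep : ∀ n : ℕ, ∀ r ∈ Icc 0 t, r ≤ n * (τ / 2) →
      ‖u r‖ ^ 2 ≤ ‖u 0‖ ^ 2 * Real.exp (∫ x in (0 : ℝ)..r, 2 * S.K (u x)) := by
    intro n
    induction n with
    | zero =>
      intro r hr hrn
      have : r = 0 := le_antisymm (by simpa using hrn) hr.1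
      subst this; simp
    | succ n ih =>
      intro r hr hrn
      set s := max 0 (r - τ / 2) with hs
      have hs0 : 0 ≤ s := le_max_left _ _
      have hsr : s ≤ r := max_le hr.1 (by linarith)
      have hsI : s ∈ Icc 0 t := ⟨hs0, hsr.trans hr.2⟩
      have hsn : s ≤ n * (τ / 2) := max_le (by positivity) (by push_cast at hrn; linarith)
      have h1 := ih s hsI hsn
      have h2 := S.norm_sq_le_mul_exp hR hmodes hRu hsI hr (by
        rw [abs_of_nonneg (by linarith)]
        have := le_max_right 0 (r - τ / 2)
        linarith)
      have h3 : 0 ≤ ∫ x in s..r, 2 * S.K (u x) :=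
        intervalIntegral.integral_nonneg hsr fun x _ => by have := S.K_nonneg (u x); positivity
      rw [abs_of_nonneg h3] at h2
      have h0 : (0 : ℝ) ∈ Icc 0 t := ⟨le_rfl, ht.1⟩
      calc ‖u r‖ ^ 2 ≤ _ := h2
        _ ≤ (‖u 0‖ ^ 2 * Real.exp (∫ x in (0 : ℝ)..s, 2 * S.K (u x))) *
            Real.exp (∫ x in s..r, 2 * S.K (u x)) := by gcongr
        _ = _ := by
          rw [mul_assoc, ← Real.exp_add,
            intervalIntegral.integral_add_adjacent_intervals (hKi 0 h0 s hsI) (hKi s hsI r hr)]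
  obtain ⟨n, hn⟩ := exists_nat_ge (t / (τ / 2))
  have h1 := hstep n t ⟨ht.1, le_rfl⟩ ((div_le_iff₀ (by positivity)).1 hn)
  refine h1.trans ?_
  gcongr
  rw [intervalIntegral.integral_const_mul]
  linarith [hM t ht]

/-- A solution on `[0, T)` along which the growth functional is integrable extends beyond `T`. -/
theorem exists_extension [CompleteSpace X] [CompleteSpace Y] {u : ℝ → Y} {T M : ℝ} (hT : 0 < T)
    (hc : ContinuousOn u (Ico 0 T))
    (hd : ∀ t ∈ Ico 0 T, HasDerivWithinAt (fun t => S.J (u t)) (S.B (u t) (u t)) (Ico 0 T) t)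
    (hM : ∀ t ∈ Ico 0 T, ∫ r in (0 : ℝ)..t, S.K (u r) ≤ M) :
    ∃ T' > T, ∃ u' : ℝ → Y, (∀ t ∈ Ico 0 T, u' t = u t) ∧ ContinuousOn u' (Ico 0 T') ∧
      ∀ t ∈ Ico 0 T', HasDerivWithinAt (fun t => S.J (u' t)) (S.B (u' t) (u' t)) (Ico 0 T') t := by
  set R : ℝ := Real.sqrt (‖u 0‖ ^ 2 * Real.exp (2 * M)) + 1
  have hR : 0 < R := by positivity
  have hRu : ∀ t ∈ Ico 0 T, ‖u t‖ ≤ R := fun t ht =>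
    (Real.le_sqrt_of_sq_le (S.norm_sq_le_of_integral_le hc hd hM ht)).trans (by simp [R])
  have hτ := S.lifespan_pos hR
  set τ := S.lifespan R with hτdef
  set s := max 0 (T - τ / 2) with hs
  have hs0 : 0 ≤ s := le_max_left _ _
  have hsT : s < T := max_lt hT (by linarith)
  -- Restarting at most τ/2 before T, a solution of lifespan τ reaches past T to T + τ/2.
  have hsτ : T - τ / 2 ≤ s := le_max_right _ _
  obtain ⟨w, hw0, hwc, hw⟩ := S.exists_local hR (hRu s ⟨hs0, hsT⟩)
  set T' := T + τ / 2 with hT'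
  have hI : ∀ t, s ≤ t → t < T' → t - s ∈ Ioo (-τ) τ := fun t h1 h2 =>
    ⟨by linarith, by linarith⟩
  have hwd : ∀ t, s ≤ t → t < T' → HasDerivAt (fun t => S.J (w (t - s)))
      (S.B (w (t - s)) (w (t - s))) t := fun t h1 h2 =>
    HasDerivAt.comp_sub_const t s (hw (t - s) (hI t h1 h2)).2
  have heq : ∀ t, s ≤ t → t < T → u t = w (t - s) := by
    intro t hst htT
    refine S.eq_of_solvesModes (α := s) (β := t) (R := 2 * R) (w := fun t => w (t - s))
      (S.solvesModes_of_hasDerivWithinAt hc hd hs0 htT)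
      (S.solvesModes_of_hasDerivAt fun i _ r hr => ?_)
      (fun r hr => (hRu r ⟨hs0.trans hr.1, hr.2.trans_lt htT⟩).trans (by linarith))
      (fun r hr => (hw _ (hI r hr.1 (by linarith [hr.2]))).1)
      (s := s) ⟨le_rfl, hst⟩ (by simp [hw0]) t ⟨hst, le_rfl⟩
    exact (innerSL ℝ (S.b i)).hasFDerivAt.comp_hasDerivAt r (hwd r hr.1 (by linarith [hr.2]))
  set u' : ℝ → Y := fun t => if t < T then u t else w (t - s) with hu'
  have hu'u : ∀ t, t < T → u' t = u t := fun t ht => if_pos ht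
  have hu'w : ∀ t, s ≤ t → u' t = w (t - s) := fun t ht => by
    by_cases h : t < T
    · rw [hu'u t h, heq t ht h]
    · exact if_neg h
  -- The regions t < T and t > s overlap and cover [0, T'), and near each of their points u'
  -- coincides with one of the two solutions, so no matching at T is needed.
  have hnear : ∀ t ∈ Ico 0 T', t < T ∨ s < t := fun t _ => by
    rcases lt_or_ge t T with h | h
    · exact Or.inl h
    · exact Or.inr (hsT.trans_le h)
  have hmem : ∀ t ∈ Ico 0 T', t < T → Ico 0 T ∈ 𝓝[Ico 0 T'] t := fun t ht htT => by
    filter_upwards [self_mem_nhdsWithin, mem_nhdsWithin_of_mem_nhds (Iio_mem_nhds htT)] with r h1 h2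
    exact ⟨h1.1, h2⟩
  refine ⟨T', by linarith, u', fun t ht => hu'u t ht.2, fun t ht => ?_, fun t ht => ?_⟩
  · rcases hnear t ht with h | h
    · refine (((hc t ⟨ht.1, h⟩).mono_of_mem_nhdsWithin (hmem t ht h))).congr_of_eventuallyEq ?_
        (hu'u t h)
      filter_upwards [mem_nhdsWithin_of_mem_nhds (Iio_mem_nhds h)] with r hr
      exact hu'u r hr
    · have h1 : ContinuousAt (fun t => w (t - s)) t :=
        ContinuousAt.comp (f := fun t => t - s) (g := w)
          (hwc.continuousAt (Ioo_mem_nhds (hI t h.le ht.2).1 (hI t h.le ht.2).2)) (by fun_prop)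
      refine (h1.congr_of_eventuallyEq ?_).continuousWithinAt
      filter_upwards [Ioi_mem_nhds h] with r hr
      exact hu'w r (le_of_lt hr)
  · rcases hnear t ht with h | h
    · rw [hu'u t h]
      refine (((hd t ⟨ht.1, h⟩).mono_of_mem_nhdsWithin (hmem t ht h))).congr_of_eventuallyEq ?_ ?_
      · filter_upwards [mem_nhdsWithin_of_mem_nhds (Iio_mem_nhds h)] with r hr
        rw [hu'u r hr]
      · rw [hu'u t h]
    · rw [hu'w t h.le]
      refine ((hwd t h.le ht.2).congr_of_eventuallyEq ?_).hasDerivWithinAt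
      filter_upwards [Ioi_mem_nhds h] with r hr
      rw [hu'w r (le_of_lt hr)]

end EvolutionSystem

/-! ### The real trigonometric basis of L² -/

theorem intervalIntegral_coe {E : Type*} [NormedAddCommGroup E] [NormedSpace ℝ E] (f : S1 → E) :
    ∫ x in (-Real.pi)..Real.pi, f (x : S1) = ∫ x : S1, f x := by
  have h := AddCircle.intervalIntegral_preimage (2 * Real.pi) (-Real.pi) f
  rwa [show -Real.pi + 2 * Real.pi = Real.pi by ring] at h

theorem integral_fourier (n : ℤ) :
    ∫ x : S1, (fourier n x : ℂ) = if n = 0 then (2 * Real.pi : ℂ) else 0 := by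
  have h := congrFun (fourierCoeff_fourier (T := 2 * Real.pi) n) 0
  rw [fourierCoeff, AddCircle.integral_haarAddCircle] at h
  have hpi : (2 * Real.pi : ℝ) ≠ 0 := Real.two_pi_pos.ne'
  simp only [neg_zero, fourier_zero, one_smul] at h
  have h2 : ∫ x : S1, (fourier n x : ℂ) = (2 * Real.pi : ℝ) • (Pi.single n (1 : ℂ) : ℤ → ℂ) 0 := by
    rw [← h, smul_inv_smul₀ hpi]
  rw [h2]
  by_cases hn : n = 0
  · subst hn; simp
  · rw [if_neg hn, Pi.single_eq_of_ne (Ne.symm hn), smul_zero]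

/-- The amplitude of the `j`-th function of the real trigonometric basis. -/
def trigCoef (j : ℤ) : ℂ :=
  if j = 0 then ((Real.sqrt (2 * Real.pi))⁻¹ : ℝ)
  else if 0 < j then ((Real.sqrt Real.pi)⁻¹ : ℝ) else -Complex.I * ((Real.sqrt Real.pi)⁻¹ : ℝ)

/-- The analytic signal `c_j e^{i|j|x}` whose real part is the `j`-th trigonometric function. -/
def trigC (j : ℤ) : C(S1, ℂ) := trigCoef j • fourier |j|

theorem trigC_apply (j : ℤ) (x : S1) : trigC j x = trigCoef j * fourier |j| x := rfl

/-- The real orthonormal trigonometric basis: a multiple of `cos (j x)` for `0 ≤ j`, and of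
`sin (|j| x)` for `j < 0`. -/
def trig (j : ℤ) : C(S1, ℝ) := ⟨fun x => (trigC j x).re, by fun_prop⟩

theorem trig_apply (j : ℤ) (x : S1) : trig j x = (trigC j x).re := rfl

theorem trigCoef_zero : trigCoef 0 = ((Real.sqrt (2 * Real.pi))⁻¹ : ℝ) := by simp [trigCoef]

theorem trigCoef_of_pos {j : ℤ} (h : 0 < j) : trigCoef j = ((Real.sqrt Real.pi)⁻¹ : ℝ) := by
  simp [trigCoef, h.ne', h]

theorem trigCoef_of_neg {j : ℤ} (h : j < 0) :
    trigCoef j = -Complex.I * ((Real.sqrt Real.pi)⁻¹ : ℝ) := by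
  simp [trigCoef, h.ne, h.not_gt]

/-- The imaginary part of the analytic signal is the conjugate function, so `trigC j` is `trig j`
plus i times its Hilbert transform. -/
theorem trigC_im (j : ℤ) (x : S1) : (trigC j x).im = (j.sign : ℝ) * trig (-j) x := by
  rcases lt_trichotomy j 0 with h | rfl | h
  · have h' : 0 < -j := by omega
    rw [trig_apply, trigC_apply, trigC_apply, trigCoef_of_neg h, trigCoef_of_pos h', abs_neg,
      Int.sign_eq_neg_one_of_neg h]
    simp
  · simp [trigC_apply, trigCoef_zero]
  · have h' : -j < 0 := by omega
    rw [trig_apply, trigC_apply, trigC_apply, trigCoef_of_neg h', trigCoef_of_pos h, abs_neg,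
      Int.sign_eq_one_of_pos h]
    simp

theorem norm_trigCoef_le (j : ℤ) : ‖trigCoef j‖ ≤ 1 := by
  have h1 : (Real.sqrt Real.pi)⁻¹ ≤ 1 := inv_le_one_of_one_le₀ (Real.one_le_sqrt.2
    (by linarith [Real.pi_gt_three]))
  have h2 : (Real.sqrt (2 * Real.pi))⁻¹ ≤ 1 := inv_le_one_of_one_le₀ (Real.one_le_sqrt.2
    (by linarith [Real.pi_gt_three]))
  have h3 : 0 ≤ (Real.sqrt Real.pi)⁻¹ := by positivity
  have h4 : 0 ≤ (Real.sqrt (2 * Real.pi))⁻¹ := by positivity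
  rcases lt_trichotomy j 0 with h | rfl | h
  · rw [trigCoef_of_neg h, norm_mul, norm_neg, Complex.norm_I, one_mul, Complex.norm_real,
      Real.norm_of_nonneg h3]
    exact h1
  · rw [trigCoef_zero, Complex.norm_real, Real.norm_of_nonneg h4]; exact h2
  · rw [trigCoef_of_pos h, Complex.norm_real, Real.norm_of_nonneg h3]; exact h1

theorem norm_trigC_apply_le (j : ℤ) (x : S1) : ‖trigC j x‖ ≤ 1 := by
  rw [trigC_apply, norm_mul, fourier_apply, Circle.norm_coe, mul_one]
  exact norm_trigCoef_le j

theorem norm_trig_le (j : ℤ) : ‖trig j‖ ≤ 1 := by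
  rw [ContinuousMap.norm_le _ zero_le_one]
  exact fun x => (Complex.abs_re_le_norm _).trans (norm_trigC_apply_le j x)

theorem trigC_coe (j : ℤ) (x : ℝ) :
    trigC j (x : S1) = trigCoef j * Complex.exp (Complex.I * (|j| : ℤ) * x) := by
  rw [trigC_apply, fourier_coe_apply]
  congr 2
  have hpi : (Real.pi : ℂ) ≠ 0 := by exact_mod_cast Real.pi_ne_zero
  push_cast
  field_simp

theorem hasDerivAt_trigC (j : ℤ) (x : ℝ) :
    HasDerivAt (fun x : ℝ => trigC j (x : S1)) (Complex.I * (|j| : ℤ) * trigC j (x : S1)) x := by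
  have h : HasDerivAt (fun x : ℝ => trigCoef j * Complex.exp (Complex.I * (|j| : ℤ) * x))
      (trigCoef j * (Complex.exp (Complex.I * (|j| : ℤ) * x) * (Complex.I * (|j| : ℤ) * 1))) x := by
    refine HasDerivAt.const_mul _ (HasDerivAt.cexp ?_)
    exact (Complex.ofRealCLM.hasDerivAt (x := x)).const_mul _
  simp_rw [trigC_coe]
  convert h using 1
  ring

theorem hasDerivAt_trig (j : ℤ) (x : ℝ) :
    HasDerivAt (fun x : ℝ => trig j (x : S1)) (-(j : ℝ) * trig (-j) (x : S1)) x := by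
  have h := Complex.reCLM.hasFDerivAt.comp_hasDerivAt x (hasDerivAt_trigC j x)
  have h2 : Complex.reCLM (Complex.I * (|j| : ℤ) * trigC j (x : S1)) =
      -(j : ℝ) * trig (-j) (x : S1) := by
    have h3 : ((|j| : ℤ) : ℝ) * (j.sign : ℝ) = j := by
      exact_mod_cast (mul_comm _ _).trans (Int.sign_mul_abs j)
    have h4 := trigC_im j (x : S1)
    have h5 : Complex.reCLM (Complex.I * (|j| : ℤ) * trigC j (x : S1)) =
        -(((|j| : ℤ) : ℝ) * (trigC j (x : S1)).im) := by
      simp [Complex.mul_re, Complex.mul_im]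
    rw [h5, h4, ← mul_assoc, h3]; ring
  rw [h2] at h
  exact h

theorem contDiff_trig (j : ℤ) :
    ContDiff ℝ ((⊤ : ℕ∞) : WithTop ℕ∞) (fun x : ℝ => trig j (x : S1)) := by
  have : (fun x : ℝ => trig j (x : S1)) =
      fun x : ℝ => Complex.reCLM (trigCoef j * Complex.exp (Complex.I * (|j| : ℤ) * x)) := by
    funext x
    rw [trig_apply, trigC_coe]; rfl
  rw [this]
  have h1 : ContDiff ℝ ((⊤ : ℕ∞) : WithTop ℕ∞) (fun x : ℝ => (x : ℂ)) := Complex.ofRealCLM.contDiff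
  exact Complex.reCLM.contDiff.comp (contDiff_const.mul (contDiff_const.mul h1).cexp)

theorem periodic_coe {E : Type*} (f : S1 → E) :
    Function.Periodic (fun x : ℝ => f (x : S1)) (2 * Real.pi) := fun x => by
  simp only [AddCircle.coe_add_period]

theorem integrable_coe (f : C(S1, ℝ)) : Integrable f := f.continuous.integrable_of_hasCompactSupport
  (HasCompactSupport.of_compactSpace _)

theorem integrable_coeC (f : C(S1, ℂ)) : Integrable f :=
  f.continuous.integrable_of_hasCompactSupport (HasCompactSupport.of_compactSpace _)

/-- From Re z · Re w = ½ Re (z w + z w̄); orthogonality is then a matter of the frequencies |i| ±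
|j|. -/
theorem trig_mul_trig (i j : ℤ) (x : S1) : trig i x * trig j x =
    (trigCoef i * trigCoef j * fourier (|i| + |j|) x +
      trigCoef i * (starRingEnd ℂ) (trigCoef j) * fourier (|i| - |j|) x).re / 2 := by
  have h1 : trigCoef i * trigCoef j * fourier (|i| + |j|) x = trigC i x * trigC j x := by
    rw [fourier_add, trigC_apply, trigC_apply]; ring
  have h2 : trigCoef i * (starRingEnd ℂ) (trigCoef j) * fourier (|i| - |j|) x =
      trigC i x * (starRingEnd ℂ) (trigC j x) := by
    rw [sub_eq_add_neg, fourier_add, fourier_neg, trigC_apply, trigC_apply, map_mul]; ring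
  rw [h1, h2, trig_apply, trig_apply]
  simp [Complex.mul_re]

theorem integral_trig_mul_trig (i j : ℤ) :
    ∫ x : S1, trig i x * trig j x = if i = j then 1 else 0 := by
  have hint : ∀ (c : ℂ) (n : ℤ), Integrable (fun x : S1 => c * fourier n x) := fun c n =>
    (integrable_coeC (fourier n)).const_mul c
  simp_rw [trig_mul_trig]
  have hre := integral_re (𝕜 := ℂ) ((hint (trigCoef i * trigCoef j) (|i| + |j|)).add
    (hint (trigCoef i * (starRingEnd ℂ) (trigCoef j)) (|i| - |j|)))
  simp only [Pi.add_apply, RCLike.re_to_complex] at hre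
  rw [integral_div, hre, integral_add (hint _ _) (hint _ _), integral_const_mul, integral_const_mul,
    integral_fourier, integral_fourier]
  have hpi := Real.pi_pos
  have hs : Real.sqrt Real.pi * Real.sqrt Real.pi = Real.pi := Real.mul_self_sqrt hpi.le
  have hs0 : Real.sqrt Real.pi ≠ 0 := (Real.sqrt_pos.2 hpi).ne'
  have hs20 : Real.sqrt (2 * Real.pi) ≠ 0 := (Real.sqrt_pos.2 (by positivity)).ne'
  have hs3 : Real.sqrt 2 ^ 2 = 2 := Real.sq_sqrt zero_le_two
  have hs4 : Real.sqrt Real.pi ^ 2 = Real.pi := Real.sq_sqrt hpi.le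
  by_cases hij : |i| = |j|
  · rcases abs_eq_abs.1 hij with rfl | rfl
    · rw [if_pos rfl, sub_self, if_pos rfl]
      rcases lt_trichotomy i 0 with h | rfl | h
      · rw [if_neg (by have := abs_pos.2 h.ne; omega), trigCoef_of_neg h]
        simp
        field_simp
        nlinarith
      · rw [if_pos (by simp), trigCoef_zero]
        simp
        field_simp
        simp only [hs3, hs4]; ring
      · rw [if_neg (by have := abs_pos.2 h.ne'; omega), trigCoef_of_pos h]
        simp
        field_simp
        nlinarith
    -- Here i = -j: for j ≠ 0 a cosine meets the sine of the same frequency, and the product of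
    -- amplitudes is purely imaginary.
    · rw [abs_neg, sub_self, if_pos rfl]
      rcases lt_trichotomy j 0 with h | rfl | h
      · rw [if_neg (by have := abs_pos.2 h.ne; omega), if_neg (by omega),
          trigCoef_of_pos (by omega : 0 < -j), trigCoef_of_neg h]
        simp
      · rw [if_pos (by simp), if_pos (by simp), neg_zero, trigCoef_zero]
        simp
        field_simp
        simp only [hs3, hs4]; ring
      · rw [if_neg (by have := abs_pos.2 h.ne'; omega), if_neg (by omega),
          trigCoef_of_neg (by omega : -j < 0), trigCoef_of_pos h]
        simp
  · have h1 := abs_nonneg i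
    have h2 := abs_nonneg j
    rw [if_neg (by omega : ¬|i| + |j| = 0), if_neg (by omega : ¬|i| - |j| = 0),
      if_neg fun h => hij (by rw [h])]
    simp

theorem exists_fourier_eq (m : ℤ) :
    ∃ a b : ℂ, ∀ x : S1, fourier m x = a * (trig m x : ℂ) + b * (trig (-m) x : ℂ) := by
  have hs0 : (Real.sqrt Real.pi : ℂ) ≠ 0 := by
    exact_mod_cast (Real.sqrt_pos.2 Real.pi_pos).ne'
  have hs1 : (Real.sqrt (2 * Real.pi) : ℂ) ≠ 0 := by
    exact_mod_cast (Real.sqrt_pos.2 Real.two_pi_pos).ne'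
  have hpos : ∀ m : ℤ, 0 < m → ∀ x : S1, fourier m x =
      (Real.sqrt Real.pi : ℂ) * ((trig m x : ℂ) + Complex.I * (trig (-m) x : ℂ)) := by
    intro m hm x
    have h1 := trigC_im m x
    rw [Int.sign_eq_one_of_pos hm] at h1
    have h2 : (trigC m x) = (trig m x : ℂ) + Complex.I * (trig (-m) x : ℂ) := by
      rw [trig_apply]
      apply Complex.ext
      · simp
      · simp [h1]
    rw [← h2, trigC_apply, trigCoef_of_pos hm, abs_of_pos hm]
    push_cast
    field_simp
  rcases lt_trichotomy m 0 with h | rfl | h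
  · refine ⟨-(Real.sqrt Real.pi : ℂ) * Complex.I, Real.sqrt Real.pi, fun x => ?_⟩
    have h1 := hpos (-m) (by omega) x
    rw [fourier_neg] at h1
    have h2 := congrArg (starRingEnd ℂ) h1
    rw [Complex.conj_conj] at h2
    rw [h2]
    simp
    ring
  · refine ⟨Real.sqrt (2 * Real.pi), 0, fun x => ?_⟩
    rw [trig_apply, trigC_apply, trigCoef_zero]
    simp
    field_simp
    rw [← Complex.ofReal_pow, Real.sq_sqrt zero_le_two]
    simp
  · refine ⟨Real.sqrt Real.pi, Real.sqrt Real.pi * Complex.I, fun x => ?_⟩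
    rw [hpos m h x]; ring

theorem inner_L2 (f g : L2) : ⟪f, g⟫ = ∫ x : S1, f x * g x := by
  rw [L2.inner_def]
  exact integral_congr_ae (Eventually.of_forall fun x => by simp [mul_comm])

/-- The trigonometric basis in `L²`. -/
def trigL (j : ℤ) : L2 := ContinuousMap.toLp 2 volume ℝ (trig j)

theorem coeFn_trigL (j : ℤ) : trigL j =ᵐ[volume] trig j := ContinuousMap.coeFn_toLp _ _

theorem inner_toLp (φ : C(S1, ℝ)) (f : L2) :
    ⟪(ContinuousMap.toLp 2 volume ℝ φ : L2), f⟫ = ∫ x : S1, φ x * f x := by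
  rw [inner_L2]
  refine integral_congr_ae ?_
  filter_upwards [ContinuousMap.coeFn_toLp (p := 2) (𝕜 := ℝ) volume φ] with x hx
  rw [hx]

theorem inner_trigL (j : ℤ) (f : L2) : ⟪trigL j, f⟫ = ∫ x : S1, trig j x * f x := inner_toLp _ _

theorem orthonormal_trigL : Orthonormal ℝ trigL := by
  rw [orthonormal_iff_ite]
  intro i j
  rw [← integral_trig_mul_trig, inner_trigL]
  refine integral_congr_ae ?_
  filter_upwards [coeFn_trigL j] with x hx
  rw [hx]

/-- Completeness is inherited from the complex Fourier basis: each exponential is a combination of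
`trig m` and `trig (-m)`, and Haar measure is a multiple of the volume. -/
theorem eq_zero_of_inner_trigL {f : L2} (h : ∀ j, ⟪trigL j, f⟫ = 0) : f = 0 := by
  have hint : Integrable (f : S1 → ℝ) := (Lp.memLp f).integrable (by norm_num)
  have hmem : MemLp (fun x : S1 => (f x : ℂ)) 2 AddCircle.haarAddCircle :=
    memLp_haarAddCircle_iff.2 ((Lp.memLp f).ofReal)
  have hintm : ∀ j, Integrable fun x : S1 => ((trig j x * f x : ℝ) : ℂ) := fun j =>
    (hint.bdd_mul (c := 1) (trig j).continuous.aestronglyMeasurable (Eventually.of_forall fun x =>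
      ((trig j).norm_coe_le_norm x).trans (norm_trig_le j))).ofReal
  have hzero : ∀ m : ℤ, ∫ x : S1, fourier m x * (f x : ℂ) = 0 := by
    intro m
    obtain ⟨a, b, hab⟩ := exists_fourier_eq m
    have h1 : ∀ x : S1, fourier m x * (f x : ℂ) =
        a * ((trig m x * f x : ℝ) : ℂ) + b * ((trig (-m) x * f x : ℝ) : ℂ) := fun x => by
      rw [hab]; push_cast; ring
    simp_rw [h1]
    rw [integral_add ((hintm _).const_mul _) ((hintm _).const_mul _), integral_const_mul,
      integral_const_mul, integral_complex_ofReal, integral_complex_ofReal, ← inner_trigL, ← inner_trigL, h, h]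
    simp
  set g : Lp ℂ 2 (@AddCircle.haarAddCircle (2 * Real.pi) _) := hmem.toLp _ with hg
  have hg0 : g = 0 := by
    refine fourierBasis.repr.injective (lp.ext (funext fun n => ?_))
    rw [fourierBasis_repr, fourierCoeff_congr_ae hmem.coeFn_toLp, fourierCoeff,
      AddCircle.integral_haarAddCircle]
    simp only [smul_eq_mul]
    rw [hzero]
    simp
  have h2 : (fun x : S1 => (f x : ℂ)) =ᵐ[AddCircle.haarAddCircle] 0 := by
    have h3 := hmem.coeFn_toLp
    rw [← hg, hg0] at h3
    exact h3.symm.trans (Lp.coeFn_zero _ _ _)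
  rw [Lp.eq_zero_iff_ae_eq_zero]
  have h4 : (fun x : S1 => (f x : ℂ)) =ᵐ[volume] 0 :=
    (Measure.smul_absolutelyContinuous (c := ENNReal.ofReal (2 * Real.pi))).ae_le h2
  filter_upwards [h4] with x hx
  simpa using hx

/-- The trigonometric Hilbert basis of `L²(S¹)`. -/
def trigBasis : HilbertBasis ℤ ℝ L2 :=
  HilbertBasis.mkOfOrthogonalEqBot orthonormal_trigL (by
    rw [Submodule.eq_bot_iff]
    intro f hf
    refine eq_zero_of_inner_trigL fun j => ?_
    exact (Submodule.mem_orthogonal _ _).1 hf _ (Submodule.subset_span (mem_range_self j)))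

theorem trigBasis_apply (j : ℤ) : trigBasis j = trigL j := by
  rw [trigBasis, HilbertBasis.coe_mkOfOrthogonalEqBot]

theorem ext_trigL {f g : L2} (h : ∀ j, ⟪trigL j, f⟫ = ⟪trigL j, g⟫) : f = g := by
  rw [← sub_eq_zero]
  exact eq_zero_of_inner_trigL fun j => by rw [inner_sub_right, h, sub_self]

theorem hasSum_of_eq {f g : ℤ → ℝ} {a : ℝ} (h : ∀ j, f j = g j) (hg : HasSum g a) :
    HasSum f a := by rwa [funext h]

theorem hasSum_sq_inner_trigL (f : L2) : HasSum (fun j => ⟪trigL j, f⟫ ^ 2) (‖f‖ ^ 2) := by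
  have h := trigBasis.hasSum_inner_mul_inner f f
  rw [real_inner_self_eq_norm_sq] at h
  simp_rw [real_inner_comm _ f, ← sq, trigBasis_apply] at h
  exact h

theorem hasSum_inner_trigL_mul (f g : L2) :
    HasSum (fun j => ⟪trigL j, f⟫ * ⟪trigL j, g⟫) ⟪f, g⟫ := by
  have h := trigBasis.hasSum_inner_mul_inner f g
  simp_rw [real_inner_comm _ f, trigBasis_apply] at h
  rwa [real_inner_comm f g] at h

theorem exists_inner_trigL_eq {c : ℤ → ℝ} (hc : Summable fun j => c j ^ 2) :
    ∃ f : L2, ∀ j, ⟪trigL j, f⟫ = c j := by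
  have hmem : Memℓp c 2 := by
    refine memℓp_gen ?_
    simpa using hc
  refine ⟨trigBasis.repr.symm ⟨c, hmem⟩, fun j => ?_⟩
  rw [← trigBasis_apply, ← HilbertBasis.repr_apply_apply, LinearIsometryEquiv.apply_symm_apply]

/-- The permutation is needed because in a real basis the Hilbert transform exchanges sine and
cosine, that is j and -j. -/
theorem summable_multiplier {a : ℤ → ℝ} {A : ℝ} (ha : ∀ j, |a j| ≤ A) (σ : ℤ ≃ ℤ) (f : L2) :
    Summable fun j => (a j * ⟪trigL (σ j), f⟫) ^ 2 := by
  have h1 : Summable fun j => A ^ 2 * ⟪trigL (σ j), f⟫ ^ 2 :=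
    ((σ.summable_iff).2 (hasSum_sq_inner_trigL f).summable).mul_left _
  refine h1.of_nonneg_of_le (fun _ => sq_nonneg _) fun j => ?_
  rw [mul_pow]
  refine mul_le_mul_of_nonneg_right ?_ (sq_nonneg _)
  rw [← sq_abs (a j)]
  exact pow_le_pow_left₀ (abs_nonneg _) (ha j) 2

/-- The bounded operator on `L²(S¹)` with coefficients `a j * f (σ j)`. -/
def multiplier (a : ℤ → ℝ) (A : ℝ) (ha : ∀ j, |a j| ≤ A) (σ : ℤ ≃ ℤ) : L2 →L[ℝ] L2 :=
  LinearMap.mkContinuous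
    { toFun := fun f => (exists_inner_trigL_eq (summable_multiplier ha σ f)).choose
      map_add' := fun f g => ext_trigL fun j => by
        rw [inner_add_right, (exists_inner_trigL_eq (summable_multiplier ha σ (f + g))).choose_spec,
          (exists_inner_trigL_eq (summable_multiplier ha σ f)).choose_spec,
          (exists_inner_trigL_eq (summable_multiplier ha σ g)).choose_spec, inner_add_right, mul_add]
      map_smul' := fun c f => ext_trigL fun j => by
        rw [RingHom.id_apply, real_inner_smul_right,
          (exists_inner_trigL_eq (summable_multiplier ha σ (c • f))).choose_spec,
          (exists_inner_trigL_eq (summable_multiplier ha σ f)).choose_spec, real_inner_smul_right]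
        ring } A (fun f => by
    have hA : 0 ≤ A := (abs_nonneg _).trans (ha 0)
    refine le_of_sq_le_sq ?_ (by positivity)
    have h1 := hasSum_sq_inner_trigL (exists_inner_trigL_eq (summable_multiplier ha σ f)).choose
    have h2 := ((σ.hasSum_iff).2 (hasSum_sq_inner_trigL f)).mul_left (A ^ 2)
    rw [mul_pow]
    refine hasSum_le (fun j => ?_) h1 h2
    rw [(exists_inner_trigL_eq (summable_multiplier ha σ f)).choose_spec, mul_pow,
      ← sq_abs (a j)]
    exact mul_le_mul_of_nonneg_right (pow_le_pow_left₀ (abs_nonneg _) (ha j) 2) (sq_nonneg _))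

theorem inner_multiplier {a : ℤ → ℝ} {A : ℝ} (ha : ∀ j, |a j| ≤ A) (σ : ℤ ≃ ℤ) (f : L2) (j : ℤ) :
    ⟪trigL j, multiplier a A ha σ f⟫ = a j * ⟪trigL (σ j), f⟫ :=
  (exists_inner_trigL_eq (summable_multiplier ha σ f)).choose_spec j

theorem norm_multiplier_le {a : ℤ → ℝ} {A : ℝ} (ha : ∀ j, |a j| ≤ A) (σ : ℤ ≃ ℤ) (f : L2) :
    ‖multiplier a A ha σ f‖ ≤ A * ‖f‖ :=
  ContinuousLinearMap.le_of_opNorm_le _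
    (LinearMap.mkContinuous_norm_le _ ((abs_nonneg _).trans (ha 0)) _) f

theorem inner_trigL_neg_coe (j : ℤ) (f : L2) :
    ∫ x in (-Real.pi)..Real.pi, f (x : S1) * trig j (x : S1) = ⟪trigL j, f⟫ := by
  rw [intervalIntegral_coe (fun x : S1 => f x * trig j x), inner_trigL]
  simp_rw [mul_comm]

/-! ### H¹ through Fourier coefficients -/

/-- The weak derivative in terms of Fourier coefficients. -/
theorem hasWeakDeriv_iff {f g : L2} :
    HasWeakDeriv f g ↔ ∀ j, ⟪trigL j, g⟫ = (j : ℝ) * ⟪trigL (-j), f⟫ := by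
  constructor
  · intro h j
    have h1 := h (fun x => trig j (x : S1)) (contDiff_trig j) (periodic_coe _)
    have h2 : deriv (fun x : ℝ => trig j (x : S1)) = fun x : ℝ => -(j : ℝ) * trig (-j) (x : S1) :=
      funext fun x => (hasDerivAt_trig j x).deriv
    have h3 : ∀ x : ℝ, f (x : S1) * (-(j : ℝ) * trig (-j) (x : S1)) =
        -(j : ℝ) * (f (x : S1) * trig (-j) (x : S1)) := fun x => by ring
    simp only [h2, h3, intervalIntegral.integral_const_mul, inner_trigL_neg_coe] at h1
    linarith
  · intro h φ hφ hper
    have hφ' : Continuous (deriv φ) := hφ.continuous_deriv (by norm_cast)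
    have hper' : Function.Periodic (deriv φ) (2 * Real.pi) := fun x => by
      rw [← deriv_comp_add_const]
      congr 1
      exact funext hper
    let Φ : C(S1, ℝ) := ⟨hper.lift, continuous_coinduced_dom.2 hφ.continuous⟩
    let Φ' : C(S1, ℝ) := ⟨hper'.lift, continuous_coinduced_dom.2 hφ'⟩
    have hΦ : ∀ x : ℝ, Φ (x : S1) = φ x := fun x => rfl
    have hΦ' : ∀ x : ℝ, Φ' (x : S1) = deriv φ x := fun x => rfl
    have hint : ∀ (k : L2) (Ψ : C(S1, ℝ)), ∫ x in (-Real.pi)..Real.pi, k (x : S1) * Ψ (x : S1) =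
        ⟪k, (ContinuousMap.toLp 2 volume ℝ Ψ : L2)⟫ := fun k Ψ => by
      rw [intervalIntegral_coe (fun x : S1 => k x * Ψ x), real_inner_comm, inner_toLp]
      simp_rw [mul_comm]
    -- The smooth test function obeys the coefficient relation by classical integration by parts
    -- over a period; Parseval then carries it to f and g.
    have hcoef : ∀ j, ⟪trigL j, (ContinuousMap.toLp 2 volume ℝ Φ' : L2)⟫ =
        (j : ℝ) * ⟪trigL (-j), (ContinuousMap.toLp 2 volume ℝ Φ : L2)⟫ := by
      intro j
      have hswap : ∀ (i : ℤ) (Ψ : C(S1, ℝ)), ⟪trigL i, (ContinuousMap.toLp 2 volume ℝ Ψ : L2)⟫ =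
          ∫ x in (-Real.pi)..Real.pi, trig i (x : S1) * Ψ (x : S1) := fun i Ψ => by
        rw [intervalIntegral_coe (fun x : S1 => trig i x * Ψ x), real_inner_comm, inner_toLp]
        refine integral_congr_ae ?_
        filter_upwards [coeFn_trigL i] with x hx
        rw [hx, mul_comm]
      have hparts := intervalIntegral.integral_mul_deriv_eq_deriv_mul (a := -Real.pi) (b := Real.pi)
        (u := fun x : ℝ => trig j (x : S1)) (v := φ)
        (u' := fun x : ℝ => -(j : ℝ) * trig (-j) (x : S1)) (v' := deriv φ)
        (fun x _ => hasDerivAt_trig j x)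
        (fun x _ => (hφ.differentiable (by simp)).differentiableAt.hasDerivAt)
        ((continuous_const.mul ((contDiff_trig (-j)).continuous)).intervalIntegrable _ _)
        (hφ'.intervalIntegrable _ _)
      have hend : φ Real.pi = φ (-Real.pi) := by
        rw [← hper (-Real.pi)]; congr 1; ring
      have hend2 : trig j ((Real.pi : ℝ) : S1) = trig j ((-Real.pi : ℝ) : S1) := by
        have := periodic_coe (trig j) (-Real.pi)
        rw [show -Real.pi + 2 * Real.pi = Real.pi by ring] at this
        exact this
      rw [hswap, hswap]
      simp only [hΦ, hΦ']
      rw [hparts, hend, hend2, sub_self, zero_sub]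
      have h3 : ∀ x : ℝ, -(j : ℝ) * trig (-j) (x : S1) * φ x =
        -(j : ℝ) * (trig (-j) (x : S1) * φ x) := fun x => by ring
      simp only [h3, intervalIntegral.integral_const_mul]
      ring
    have h1 := hint f Φ'
    have h2 := hint g Φ
    simp only [hΦ, hΦ'] at h1 h2
    rw [h1, h2]
    have h3 := hasSum_inner_trigL_mul f (ContinuousMap.toLp 2 volume ℝ Φ' : L2)
    have h4 := ((Equiv.neg ℤ).hasSum_iff.2
      (hasSum_inner_trigL_mul g (ContinuousMap.toLp 2 volume ℝ Φ : L2))).neg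
    refine h3.unique ?_
    refine hasSum_of_eq (fun j => ?_) h4
    simp only [Function.comp_apply, Equiv.neg_apply, h, hcoef, neg_neg]
    push_cast
    ring

theorem inner_trigL_dx (u : H1) (j : ℤ) : ⟪trigL j, dx u⟫ = (j : ℝ) * ⟪trigL (-j), fn u⟫ :=
  hasWeakDeriv_iff.1 u.2 j

/-- The element of `H¹(S¹)` with given function and weak derivative. -/
def mkH1 (f g : L2) (h : ∀ j, ⟪trigL j, g⟫ = (j : ℝ) * ⟪trigL (-j), f⟫) : H1 :=
  ⟨WithLp.toLp 2 (f, g), hasWeakDeriv_iff.2 h⟩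

@[simp] theorem fn_mkH1 (f g : L2) (h) : fn (mkH1 f g h) = f := rfl
@[simp] theorem dx_mkH1 (f g : L2) (h) : dx (mkH1 f g h) = g := rfl
@[simp] theorem fn_add (u v : H1) : fn (u + v) = fn u + fn v := rfl
@[simp] theorem dx_add (u v : H1) : dx (u + v) = dx u + dx v := rfl
@[simp] theorem fn_smul (c : ℝ) (u : H1) : fn (c • u) = c • fn u := rfl
@[simp] theorem dx_smul (c : ℝ) (u : H1) : dx (c • u) = c • dx u := rfl

theorem fn_injective : Function.Injective fn := by
  intro u v h
  have h2 : dx u = dx v := ext_trigL fun j => by rw [inner_trigL_dx, inner_trigL_dx, h]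
  exact Subtype.ext (WithLp.ofLp_injective 2 (Prod.ext h h2))

/-- `fn` as a bounded operator. -/
def fnL : H1 →L[ℝ] L2 := (WithLp.fstL 2 ℝ L2 L2).comp H1.subtypeL

/-- `dx` as a bounded operator. -/
def dxL : H1 →L[ℝ] L2 := (WithLp.sndL 2 ℝ L2 L2).comp H1.subtypeL

theorem norm_H1_sq (u : H1) : ‖u‖ ^ 2 = ‖fn u‖ ^ 2 + ‖dx u‖ ^ 2 :=
  WithLp.prod_norm_sq_eq_of_L2 u.1

theorem inner_H1 (u v : H1) : ⟪u, v⟫ = ⟪fn u, fn v⟫ + ⟪dx u, dx v⟫ :=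
  WithLp.prod_inner_apply u.1 v.1

theorem norm_fn_le (u : H1) : ‖fn u‖ ≤ ‖u‖ :=
  le_of_sq_le_sq (by rw [norm_H1_sq]; nlinarith [sq_nonneg ‖dx u‖]) (norm_nonneg _)

theorem norm_dx_le (u : H1) : ‖dx u‖ ≤ ‖u‖ :=
  le_of_sq_le_sq (by rw [norm_H1_sq]; nlinarith [sq_nonneg ‖fn u‖]) (norm_nonneg _)

theorem norm_H1_le (u : H1) : ‖u‖ ≤ ‖fn u‖ + ‖dx u‖ :=
  le_of_sq_le_sq (by rw [norm_H1_sq]; nlinarith [norm_nonneg (fn u), norm_nonneg (dx u)])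
    (by positivity)

/-- Each coefficient relation defines a closed set, so the graph of the weak derivative is closed.
-/
instance completeSpace_H1 : CompleteSpace H1 := by
  have h : (H1 : Set (WithLp 2 (L2 × L2))) = ⋂ j : ℤ, {u : WithLp 2 (L2 × L2) |
      ⟪trigL j, WithLp.sndL 2 ℝ L2 L2 u⟫ = (j : ℝ) * ⟪trigL (-j), WithLp.fstL 2 ℝ L2 L2 u⟫} := by
    ext u
    simp only [mem_iInter, mem_ofPred_eq]
    exact hasWeakDeriv_iff
  have hc : IsClosed (H1 : Set (WithLp 2 (L2 × L2))) := by
    rw [h]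
    exact isClosed_iInter fun j => isClosed_eq (by fun_prop) (by fun_prop)
  exact hc.completeSpace_coe

theorem inner_trigL_trigL (i j : ℤ) : ⟪trigL i, trigL j⟫ = if i = j then (1 : ℝ) else 0 :=
  orthonormal_iff_ite.1 orthonormal_trigL i j

/-- The trigonometric functions as elements of `H¹(S¹)`. -/
def trigH (j : ℤ) : H1 := mkH1 (trigL j) (-(j : ℝ) • trigL (-j)) fun i => by
  rw [real_inner_smul_right, inner_trigL_trigL, inner_trigL_trigL]
  by_cases h : i = -j
  · subst h; simp
  · rw [if_neg h, if_neg (by omega)]; simp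

@[simp] theorem fn_trigH (j : ℤ) : fn (trigH j) = trigL j := rfl
@[simp] theorem dx_trigH (j : ℤ) : dx (trigH j) = -(j : ℝ) • trigL (-j) := rfl

theorem inner_trigH (j : ℤ) (u : H1) : ⟪trigH j, u⟫ = (1 + (j : ℝ) ^ 2) * ⟪trigL j, fn u⟫ := by
  rw [inner_H1, fn_trigH, dx_trigH, real_inner_smul_left, inner_trigL_dx, neg_neg]
  push_cast
  ring

theorem hasSum_norm_H1 (u : H1) :
    HasSum (fun j : ℤ => (1 + (j : ℝ) ^ 2) * ⟪trigL j, fn u⟫ ^ 2) (‖u‖ ^ 2) := by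
  rw [norm_H1_sq]
  refine hasSum_of_eq (fun j => ?_) ((hasSum_sq_inner_trigL (fn u)).add
    ((Equiv.neg ℤ).hasSum_iff.2 (hasSum_sq_inner_trigL (dx u))))
  simp only [Function.comp_apply, Equiv.neg_apply, inner_trigL_dx, neg_neg]
  push_cast
  ring

/-! ### The Hilbert transform and the velocity as multipliers -/

/-- The periodic Hilbert transform as a Fourier multiplier on `L²(S¹)`. -/
def hilbertL : L2 →L[ℝ] L2 :=
  multiplier (fun j => -(j.sign : ℝ)) 1 (fun j => by
    rcases lt_trichotomy j 0 with h | rfl | h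
    · rw [Int.sign_eq_neg_one_of_neg h]; simp
    · simp
    · rw [Int.sign_eq_one_of_pos h]; simp) (Equiv.neg ℤ)

theorem inner_hilbertL (f : L2) (j : ℤ) :
    ⟪trigL j, hilbertL f⟫ = -(j.sign : ℝ) * ⟪trigL (-j), f⟫ := inner_multiplier _ _ f j

theorem norm_hilbertL_le (f : L2) : ‖hilbertL f‖ ≤ ‖f‖ :=
  (norm_multiplier_le _ _ f).trans_eq (one_mul _)

theorem hilbertL_trigL (j : ℤ) : hilbertL (trigL j) = (j.sign : ℝ) • trigL (-j) :=
  ext_trigL fun i => by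
    rw [inner_hilbertL, real_inner_smul_right, inner_trigL_trigL, inner_trigL_trigL]
    by_cases h : i = -j
    · subst h; simp
    · rw [if_neg h, if_neg (by omega)]; simp

theorem sign_mul_self_cast (j : ℤ) : (j.sign : ℝ) * j = |(j : ℝ)| := by
  exact_mod_cast Int.sign_mul_self_eq_abs j

/-- The linear map underlying the Hilbert transform on `H¹(S¹)`. -/
def hilbertHₗ : H1 →ₗ[ℝ] H1 where
  toFun u := mkH1 (hilbertL (fn u)) (hilbertL (dx u)) fun j => by
    rw [inner_hilbertL, inner_hilbertL, inner_trigL_dx, neg_neg, Int.sign_neg]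
    push_cast
    ring
  map_add' u v := fn_injective (by simp only [fn_add, fn_mkH1, map_add])
  map_smul' c u := fn_injective (by simp only [fn_smul, fn_mkH1, map_smul, RingHom.id_apply])

theorem norm_hilbertHₗ_le (u : H1) : ‖hilbertHₗ u‖ ≤ 1 * ‖u‖ := by
  have h1 : ‖hilbertHₗ u‖ ^ 2 = ‖hilbertL (fn u)‖ ^ 2 + ‖hilbertL (dx u)‖ ^ 2 := norm_H1_sq _
  rw [one_mul]
  refine le_of_sq_le_sq ?_ (norm_nonneg _)
  rw [h1, norm_H1_sq u]
  exact add_le_add (pow_le_pow_left₀ (norm_nonneg _) (norm_hilbertL_le _) 2)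
    (pow_le_pow_left₀ (norm_nonneg _) (norm_hilbertL_le _) 2)

/-- The Hilbert transform on `H¹(S¹)`. -/
def hilbertH : H1 →L[ℝ] H1 := hilbertHₗ.mkContinuous 1 norm_hilbertHₗ_le

@[simp] theorem fn_hilbertH (u : H1) : fn (hilbertH u) = hilbertL (fn u) := rfl
@[simp] theorem dx_hilbertH (u : H1) : dx (hilbertH u) = hilbertL (dx u) := rfl

theorem norm_hilbertH_le (u : H1) : ‖hilbertH u‖ ≤ ‖u‖ :=
  (ContinuousLinearMap.le_of_opNorm_le _ (LinearMap.mkContinuous_norm_le _ zero_le_one _) u).trans_eq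
    (one_mul _)

/-- The multiplier `-|D|⁻¹`, with zero mean. -/
def potential : L2 →L[ℝ] L2 :=
  multiplier (fun j => -|(j : ℝ)|⁻¹) 1 (fun j => by
    rw [abs_neg, abs_inv, abs_abs]
    by_cases h : j = 0
    · simp [h]
    · exact inv_le_one_of_one_le₀ (by exact_mod_cast Int.one_le_abs h)) (Equiv.refl ℤ)

/-- At j = 0 the convention 0⁻¹ = 0 makes the coefficient vanish; this is the zero-mean
normalization of the velocity. -/
theorem inner_potential (f : L2) (j : ℤ) :
    ⟪trigL j, potential f⟫ = -|(j : ℝ)|⁻¹ * ⟪trigL j, f⟫ := inner_multiplier _ _ f j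

theorem norm_potential_le (f : L2) : ‖potential f‖ ≤ ‖f‖ :=
  (norm_multiplier_le _ _ f).trans_eq (one_mul _)

/-- The velocity `p` with `p_x = H f` and zero mean. -/
def velocity : L2 →L[ℝ] H1 :=
  LinearMap.mkContinuous
    { toFun := fun f => mkH1 (potential f) (hilbertL f) fun j => by
        rw [inner_hilbertL, inner_potential]
        push_cast
        rw [abs_neg]
        by_cases h : (j : ℝ) = 0
        · have : j = 0 := by exact_mod_cast h
          subst this; simp
        · have h1 := sign_mul_self_cast j
          have h2 : |(j : ℝ)| ≠ 0 := abs_ne_zero.2 h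
          have h3 : (j.sign : ℝ) = j * |(j : ℝ)|⁻¹ := by
            have h4 : |(j : ℝ)| * |(j : ℝ)| = j * j := abs_mul_abs_self _
            field_simp
            have : (j.sign : ℝ) * |(j : ℝ)| * j = j * j := by
              rw [mul_right_comm, h1, h4]
            exact mul_right_cancel₀ h this
          rw [h3]; ring
      map_add' := fun u v => fn_injective (by simp)
      map_smul' := fun c u => fn_injective (by simp) } 2 fun u => by
    refine (norm_H1_le _).trans ?_
    have h1 := norm_potential_le u
    have h2 := norm_hilbertL_le u
    simp only [LinearMap.coe_mk, AddHom.coe_mk, fn_mkH1, dx_mkH1]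
    linarith

@[simp] theorem fn_velocity (f : L2) : fn (velocity f) = potential f := rfl
@[simp] theorem dx_velocity (f : L2) : dx (velocity f) = hilbertL f := rfl

theorem norm_velocity_le (f : L2) : ‖velocity f‖ ≤ 2 * ‖f‖ :=
  ContinuousLinearMap.le_of_opNorm_le _ (LinearMap.mkContinuous_norm_le _ zero_le_two _) f

/-! ### Sobolev embedding with a small constant -/

theorem summable_inv_one_add_sq : Summable fun j : ℤ => (1 + (j : ℝ) ^ 2)⁻¹ := by
  refine (Real.summable_one_div_int_pow.2 one_lt_two).of_norm_bounded_eventually ?_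
  have : ({0}ᶜ : Set ℤ) ∈ cofinite := (finite_singleton 0).compl_mem_cofinite
  filter_upwards [this] with j hj
  have hj0 : (0 : ℝ) < (j : ℝ) ^ 2 := by
    have : (j : ℝ) ≠ 0 := by exact_mod_cast hj
    positivity
  rw [Real.norm_of_nonneg (by positivity), one_div]
  exact inv_anti₀ hj0 (by linarith)

/-- Off a finite set A the weights 1/(1 + j²) sum to at most ε², and Cauchy–Schwarz gives ε ‖u‖;
each coefficient in A costs at most the L² norm. The arbitrarily small ε is what `K_sub_le` asks
for. -/
theorem exists_sum_abs_inner_trigL_le {ε : ℝ} (hε : 0 < ε) : ∃ C ≥ 0, ∀ (u : H1) (s : Finset ℤ),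
    ∑ j ∈ s, |⟪trigL j, fn u⟫| ≤ ε * ‖u‖ + C * ‖fn u‖ := by
  classical
  obtain ⟨A, hA⟩ := summable_iff_vanishing_norm.1 summable_inv_one_add_sq (ε ^ 2) (by positivity)
  refine ⟨A.card, by positivity, fun u s => ?_⟩
  rw [← Finset.sum_inter_add_sum_sdiff s A, add_comm]
  refine add_le_add ?_ ?_
  · have h1 : ∀ j ∈ s \ A, |⟪trigL j, fn u⟫| = Real.sqrt ((1 + (j : ℝ) ^ 2)⁻¹) *
        (Real.sqrt (1 + (j : ℝ) ^ 2) * |⟪trigL j, fn u⟫|) := fun j _ => by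
      have : Real.sqrt (1 + (j : ℝ) ^ 2) ≠ 0 := (Real.sqrt_pos.2 (by positivity)).ne'
      rw [Real.sqrt_inv]; field_simp
    rw [Finset.sum_congr rfl h1]
    refine (Real.sum_mul_le_sqrt_mul_sqrt _ _ _).trans ?_
    have h2 : ∑ j ∈ s \ A, Real.sqrt ((1 + (j : ℝ) ^ 2)⁻¹) ^ 2 ≤ ε ^ 2 := by
      have h3 := hA (s \ A) Finset.sdiff_disjoint
      refine le_trans (le_of_eq (Finset.sum_congr rfl fun j _ => ?_)) ((le_abs_self _).trans h3.le)
      exact Real.sq_sqrt (by positivity)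
    have h4 : ∑ j ∈ s \ A, (Real.sqrt (1 + (j : ℝ) ^ 2) * |⟪trigL j, fn u⟫|) ^ 2 ≤ ‖u‖ ^ 2 := by
      refine le_trans (le_of_eq (Finset.sum_congr rfl fun j _ => ?_))
        (sum_le_hasSum (s \ A) (fun j _ => by positivity) (hasSum_norm_H1 u))
      rw [mul_pow, sq_abs, Real.sq_sqrt (by positivity)]
    have h5 := Real.sqrt_le_sqrt h2
    have h6 := Real.sqrt_le_sqrt h4
    rw [Real.sqrt_sq hε.le] at h5
    rw [Real.sqrt_sq (norm_nonneg _)] at h6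
    exact mul_le_mul h5 h6 (Real.sqrt_nonneg _) hε.le
  · refine (Finset.sum_le_sum_of_subset_of_nonneg Finset.inter_subset_right
      fun _ _ _ => abs_nonneg _).trans ?_
    refine (Finset.sum_le_card_nsmul A _ ‖fn u‖ fun j _ => ?_).trans_eq (nsmul_eq_mul _ _)
    refine (abs_real_inner_le_norm _ _).trans_eq ?_
    rw [orthonormal_trigL.1, one_mul]

theorem summable_abs_inner_trigL (u : H1) : Summable fun j => |⟪trigL j, fn u⟫| := by
  obtain ⟨C, _, hC⟩ := exists_sum_abs_inner_trigL_le one_pos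
  exact summable_of_sum_le (fun _ => abs_nonneg _) (hC u)

theorem summable_trig (u : H1) : Summable fun j => ⟪trigL j, fn u⟫ • trig j := by
  refine (summable_abs_inner_trigL u).of_norm_bounded fun j => ?_
  rw [norm_smul]
  exact mul_le_of_le_one_right (norm_nonneg _) (norm_trig_le j)

theorem norm_tsum_trig_le {ε C : ℝ} {u : H1}
    (h : ∀ s : Finset ℤ, ∑ j ∈ s, |⟪trigL j, fn u⟫| ≤ ε * ‖u‖ + C * ‖fn u‖) :
    ‖∑' j, ⟪trigL j, fn u⟫ • trig j‖ ≤ ε * ‖u‖ + C * ‖fn u‖ := by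
  refine le_of_tendsto (summable_trig u).hasSum.norm (Eventually.of_forall fun s => ?_)
  refine (norm_sum_le _ _).trans ((Finset.sum_le_sum fun j _ => ?_).trans (h s))
  rw [norm_smul]
  exact mul_le_of_le_one_right (norm_nonneg _) (norm_trig_le j)

/-- The continuous representative of an element of `H¹(S¹)`. -/
def contRep : H1 →L[ℝ] C(S1, ℝ) :=
  LinearMap.mkContinuousOfExistsBound
    { toFun := fun u => ∑' j, ⟪trigL j, fn u⟫ • trig j
      map_add' := fun u v => by
        rw [← (summable_trig u).tsum_add (summable_trig v)]
        exact tsum_congr fun j => by rw [fn_add, inner_add_right, add_smul]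
      map_smul' := fun c u => by
        rw [RingHom.id_apply, ← (summable_trig u).tsum_const_smul]
        exact tsum_congr fun j => by rw [fn_smul, real_inner_smul_right, mul_smul] }
    (by
      obtain ⟨C, hC0, hC⟩ := exists_sum_abs_inner_trigL_le one_pos
      refine ⟨1 + C, fun u => (norm_tsum_trig_le (hC u)).trans ?_⟩
      have := mul_le_mul_of_nonneg_left (norm_fn_le u) hC0
      linarith)

theorem hasSum_contRep (u : H1) : HasSum (fun j => ⟪trigL j, fn u⟫ • trig j) (contRep u) :=
  (summable_trig u).hasSum

theorem exists_norm_contRep_le {ε : ℝ} (hε : 0 < ε) :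
    ∃ C ≥ 0, ∀ u : H1, ‖contRep u‖ ≤ ε * ‖u‖ + C * ‖fn u‖ := by
  obtain ⟨C, hC0, hC⟩ := exists_sum_abs_inner_trigL_le hε
  exact ⟨C, hC0, fun u => norm_tsum_trig_le (hC u)⟩

theorem toLp_contRep (u : H1) : (ContinuousMap.toLp 2 volume ℝ (contRep u) : L2) = fn u := by
  have h1 := (hasSum_contRep u).mapL (ContinuousMap.toLp 2 volume ℝ : C(S1, ℝ) →L[ℝ] L2)
  have h2 := trigBasis.hasSum_repr (fn u)
  simp only [HilbertBasis.repr_apply_apply, trigBasis_apply] at h2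
  refine h1.unique ?_
  simp only [map_smul]
  exact h2

theorem coeFn_contRep (u : H1) : fn u =ᵐ[volume] contRep u := by
  rw [← toLp_contRep]
  exact ContinuousMap.coeFn_toLp _ _

/-- The real Banach space `L^∞(S¹)`. -/
abbrev Linf : Type := Lp ℝ ⊤ (volume : Measure S1)

/-- The Sobolev embedding `H¹(S¹) → L^∞(S¹)`. -/
def supL : H1 →L[ℝ] Linf := (ContinuousMap.toLp ⊤ volume ℝ).comp contRep

theorem coeFn_supL (u : H1) : supL u =ᵐ[volume] fn u :=
  (ContinuousMap.coeFn_toLp volume (contRep u)).trans (coeFn_contRep u).symm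

theorem norm_supL_le_norm_contRep (u : H1) : ‖supL u‖ ≤ ‖contRep u‖ := by
  have h := ContinuousMap.toLp_norm_le (α := S1) (E := ℝ) (μ := volume) (p := ⊤) (𝕜 := ℝ)
  simp only [ENNReal.toReal_top, inv_zero] at h
  exact (ContinuousLinearMap.le_of_opNorm_le _ h _).trans_eq (by simp)

theorem exists_norm_supL_le {ε : ℝ} (hε : 0 < ε) :
    ∃ C ≥ 0, ∀ u : H1, ‖supL u‖ ≤ ε * ‖u‖ + C * ‖fn u‖ := by
  obtain ⟨C, hC0, hC⟩ := exists_norm_contRep_le hε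
  exact ⟨C, hC0, fun u => (norm_supL_le_norm_contRep u).trans (hC u)⟩

/-! ### Products and integration by parts in H¹ -/

/-- Multiplication `L^∞ × L² → L²`. -/
def mulL : Linf →L[ℝ] L2 →L[ℝ] L2 := (ContinuousLinearMap.mul ℝ ℝ).holderL volume ⊤ 2 2

theorem coeFn_mulL (g : Linf) (f : L2) : mulL g f =ᵐ[volume] fun x => g x * f x :=
  (ContinuousLinearMap.mul ℝ ℝ).coeFn_holder g f

theorem norm_mulL_le (g : Linf) (f : L2) : ‖mulL g f‖ ≤ ‖g‖ * ‖f‖ := by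
  have h := (ContinuousLinearMap.mul ℝ ℝ).norm_holder_apply_apply_le (r := 2) g f
  rwa [ContinuousLinearMap.opNorm_mul, one_mul] at h

theorem inner_mulL (g : Linf) (f h : L2) : ⟪mulL g f, h⟫ = ∫ x : S1, g x * f x * h x := by
  rw [inner_L2]
  refine integral_congr_ae ?_
  filter_upwards [coeFn_mulL g f] with x hx
  rw [hx]

theorem inner_mulL_comm (g : Linf) (f h : L2) : ⟪mulL g f, h⟫ = ⟪mulL g h, f⟫ := by
  rw [inner_mulL, inner_mulL]
  exact integral_congr_ae (Eventually.of_forall fun x => by ring)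

theorem abs_inner_mulL_le (g : Linf) (f h : L2) : |⟪mulL g f, h⟫| ≤ ‖g‖ * ‖f‖ * ‖h‖ :=
  (abs_real_inner_le_norm _ _).trans
    (mul_le_mul_of_nonneg_right (norm_mulL_le g f) (norm_nonneg _))

theorem mulL_supL_comm (u v : H1) : mulL (supL u) (fn v) = mulL (supL v) (fn u) := by
  refine Lp.ext ?_
  filter_upwards [coeFn_mulL (supL u) (fn v), coeFn_mulL (supL v) (fn u), coeFn_supL u,
    coeFn_supL v] with x h1 h2 h3 h4
  rw [h1, h2, h3, h4, mul_comm]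

@[fun_prop] theorem continuous_fn : Continuous fn := fnL.continuous
@[fun_prop] theorem continuous_dx : Continuous dx := dxL.continuous

/-- Trigonometric polynomials are dense: a vector orthogonal to every `trigH j` has (1 + j²) times
each coefficient equal to 0. -/
theorem H1_induction {P : H1 → Prop} (hc : IsClosed {u | P u}) (h0 : P 0)
    (hadd : ∀ u v, P u → P v → P (u + v)) (hsmul : ∀ (c : ℝ) u, P u → P (c • u))
    (ht : ∀ j, P (trigH j)) (u : H1) : P u := by
  have hdense : (Submodule.span ℝ (range trigH)).topologicalClosure = ⊤ := by
    rw [Submodule.topologicalClosure_eq_top_iff, Submodule.eq_bot_iff]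
    intro v hv
    refine fn_injective (eq_zero_of_inner_trigL fun j => ?_)
    have h1 := (Submodule.mem_orthogonal _ _).1 hv _ (Submodule.subset_span (mem_range_self j))
    rw [inner_trigH] at h1
    exact (mul_eq_zero.1 h1).resolve_left (by positivity)
  have hsub : (Submodule.span ℝ (range trigH) : Set H1) ⊆ {u | P u} := by
    intro v hv
    induction hv using Submodule.span_induction with
    | mem v hv => obtain ⟨j, rfl⟩ := hv; exact ht j
    | zero => exact h0
    | add v w _ _ hv hw => exact hadd _ _ hv hw
    | smul c v _ hv => exact hsmul _ _ hv
  have hu : u ∈ (Submodule.span ℝ (range trigH)).topologicalClosure := hdense ▸ Submodule.mem_top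
  exact closure_minimal hsub hc hu

theorem L2_induction {P : L2 → Prop} (hc : IsClosed {u | P u}) (h0 : P 0)
    (hadd : ∀ u v, P u → P v → P (u + v)) (hsmul : ∀ (c : ℝ) u, P u → P (c • u))
    (ht : ∀ j, P (trigL j)) (u : L2) : P u := by
  have hsub : (Submodule.span ℝ (range trigBasis) : Set L2) ⊆ {u | P u} := by
    intro v hv
    induction hv using Submodule.span_induction with
    | mem v hv => obtain ⟨j, rfl⟩ := hv; rw [trigBasis_apply]; exact ht j
    | zero => exact h0
    | add v w _ _ hv hw => exact hadd _ _ hv hw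
    | smul c v _ hv => exact hsmul _ _ hv
  have hu : u ∈ (Submodule.span ℝ (range trigBasis)).topologicalClosure :=
    trigBasis.dense_span ▸ Submodule.mem_top
  exact closure_minimal hsub hc hu

theorem contRep_trigH (j : ℤ) : contRep (trigH j) = trig j :=
  ContinuousMap.toLp_injective (p := 2) (𝕜 := ℝ) (volume : Measure S1) (toLp_contRep (trigH j))

theorem inner_mulL_toLp (a b c : C(S1, ℝ)) :
    ⟪mulL (ContinuousMap.toLp ⊤ volume ℝ a) (ContinuousMap.toLp 2 volume ℝ b),
      (ContinuousMap.toLp 2 volume ℝ c : L2)⟫ = ∫ x : S1, a x * b x * c x := by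
  rw [inner_mulL]
  refine integral_congr_ae ?_
  filter_upwards [ContinuousMap.coeFn_toLp (p := ⊤) (𝕜 := ℝ) volume a,
    ContinuousMap.coeFn_toLp (p := 2) (𝕜 := ℝ) volume b,
    ContinuousMap.coeFn_toLp (p := 2) (𝕜 := ℝ) volume c] with x h1 h2 h3
  rw [h1, h2, h3]

theorem inner_mulL_trig (i j k : ℤ) :
    ⟪mulL (supL (trigH i)) (trigL j), trigL k⟫ = ∫ x : S1, trig i x * trig j x * trig k x := by
  have : supL (trigH i) = ContinuousMap.toLp ⊤ volume ℝ (trig i) := by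
    rw [← contRep_trigH]; rfl
  rw [this]
  exact inner_mulL_toLp _ _ _

/-- Integration by parts for a product of three `H¹` functions. -/
theorem inner_mulL_parts (m v w : H1) : ⟪mulL (supL m) (dx v), fn w⟫ +
    ⟪mulL (supL v) (dx m), fn w⟫ + ⟪mulL (supL m) (fn v), dx w⟫ = 0 := by
  -- The identity is linear and continuous in each argument, so density reduces the three slots in
  -- turn to trigonometric functions, where a derivative is integrated over a period.
  revert v w
  refine H1_induction (P := fun m => ∀ v w : H1, ⟪mulL (supL m) (dx v), fn w⟫ +
    ⟪mulL (supL v) (dx m), fn w⟫ + ⟪mulL (supL m) (fn v), dx w⟫ = 0) ?_ ?_ ?_ ?_ ?_ m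
  · simp only [ofPred_forall]
    exact isClosed_iInter fun v => isClosed_iInter fun w =>
      isClosed_eq (by fun_prop) continuous_const
  · intro v w
    have : dx 0 = 0 := rfl
    simp [this]
  · intro u u' h h' v w
    have h1 := h v w
    have h2 := h' v w
    simp only [dx_add, map_add, add_apply, inner_add_left]
    linarith
  · intro c u h v w
    have h1 := h v w
    simp only [dx_smul, map_smul, smul_apply, real_inner_smul_left]
    rw [← mul_add, ← mul_add, h1, mul_zero]
  intro i v
  refine H1_induction (P := fun v => ∀ w : H1, ⟪mulL (supL (trigH i)) (dx v), fn w⟫ +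
    ⟪mulL (supL v) (dx (trigH i)), fn w⟫ + ⟪mulL (supL (trigH i)) (fn v), dx w⟫ = 0)
    ?_ ?_ ?_ ?_ ?_ v
  · simp only [ofPred_forall]
    exact isClosed_iInter fun w => isClosed_eq (by fun_prop) continuous_const
  · intro w
    have h1 : dx 0 = 0 := rfl
    have h2 : fn 0 = 0 := rfl
    simp [h1, h2]
  · intro u u' h h' w
    have h1 := h w
    have h2 := h' w
    simp only [dx_add, fn_add, map_add, add_apply, inner_add_left]
    linarith
  · intro c u h w
    have h1 := h w
    simp only [dx_smul, fn_smul, map_smul, smul_apply, real_inner_smul_left]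
    rw [← mul_add, ← mul_add, h1, mul_zero]
  intro j w
  refine H1_induction (P := fun w => ⟪mulL (supL (trigH i)) (dx (trigH j)), fn w⟫ +
    ⟪mulL (supL (trigH j)) (dx (trigH i)), fn w⟫ +
    ⟪mulL (supL (trigH i)) (fn (trigH j)), dx w⟫ = 0) ?_ ?_ ?_ ?_ ?_ w
  · exact isClosed_eq (by fun_prop) continuous_const
  · have h1 : dx 0 = 0 := rfl
    have h2 : fn 0 = 0 := rfl
    simp [h1, h2]
  · intro u u' h1 h2
    simp only [dx_add, fn_add, inner_add_right]
    linarith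
  · intro c u h1
    simp only [dx_smul, fn_smul, real_inner_smul_right]
    rw [← mul_add, ← mul_add, h1, mul_zero]
  intro k
  have hd : ∀ x : ℝ, HasDerivAt (fun x : ℝ => trig i (x : S1) * trig j (x : S1) * trig k (x : S1))
      ((-(i : ℝ) * trig (-i) (x : S1) * trig j (x : S1) +
        trig i (x : S1) * (-(j : ℝ) * trig (-j) (x : S1))) * trig k (x : S1) +
        trig i (x : S1) * trig j (x : S1) * (-(k : ℝ) * trig (-k) (x : S1))) x := fun x =>
    ((hasDerivAt_trig i x).mul (hasDerivAt_trig j x)).mul (hasDerivAt_trig k x)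
  have hcont : ∀ l : ℤ, Continuous fun x : ℝ => trig l (x : S1) := fun l =>
    (contDiff_trig l).continuous
  have h1 := intervalIntegral.integral_eq_sub_of_hasDerivAt (a := -Real.pi) (b := Real.pi)
    (fun x _ => hd x) (by
      refine Continuous.intervalIntegrable ?_ _ _
      have := hcont i; have := hcont j; have := hcont k
      have := hcont (-i); have := hcont (-j); have := hcont (-k)
      fun_prop)
  have hend := periodic_coe (fun y : S1 => trig i y * trig j y * trig k y) (-Real.pi)
  rw [show -Real.pi + 2 * Real.pi = Real.pi by ring] at hend
  simp only at hend
  rw [hend, sub_self] at h1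
  rw [intervalIntegral_coe (fun y : S1 => (-(i : ℝ) * trig (-i) y * trig j y +
        trig i y * (-(j : ℝ) * trig (-j) y)) * trig k y +
        trig i y * trig j y * (-(k : ℝ) * trig (-k) y))] at h1
  simp only [dx_trigH, fn_trigH, map_smul, real_inner_smul_left, real_inner_smul_right,
    inner_mulL_trig]
  rw [← h1]
  have hint : ∀ p q r : ℤ, Integrable fun y : S1 => trig p y * trig q y * trig r y := fun p q r =>
    integrable_coe (trig p * trig q * trig r)
  rw [← integral_const_mul, ← integral_const_mul, ← integral_const_mul,
    ← integral_add ((hint _ _ _).const_mul _) ((hint _ _ _).const_mul _), ← integral_add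
      (((hint _ _ _).const_mul _).fun_add ((hint _ _ _).const_mul _)) ((hint _ _ _).const_mul _)]
  exact integral_congr_ae (Eventually.of_forall fun y => by ring)

/-! ### The analytic-signal cancellation -/

theorem hilbertH_trigH (j : ℤ) : hilbertH (trigH j) = (j.sign : ℝ) • trigH (-j) :=
  fn_injective (by rw [fn_hilbertH, fn_smul, fn_trigH, fn_trigH, hilbertL_trigL])

/-- The product is a single exponential of frequency |i| + |j| + |k|; its integral vanishes unless
all three are 0, and then the product is a real constant. -/
theorem integral_trigC_im (i j k : ℤ) : ∫ x : S1, (trigC i x * trigC j x * trigC k x).im = 0 := by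
  have h1 : ∀ x : S1, trigC i x * trigC j x * trigC k x =
      trigCoef i * trigCoef j * trigCoef k * fourier (|i| + |j| + |k|) x := fun x => by
    rw [fourier_add, fourier_add, trigC_apply, trigC_apply, trigC_apply]; ring
  simp_rw [h1]
  have him := integral_im (𝕜 := ℂ)
    ((integrable_coeC (fourier (|i| + |j| + |k|))).const_mul
      (trigCoef i * trigCoef j * trigCoef k))
  simp only [RCLike.im_to_complex] at him
  rw [him, integral_const_mul, integral_fourier]
  split_ifs with h
  · have hi := abs_nonneg i
    have hj := abs_nonneg j
    have hk := abs_nonneg k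
    have hi0 : i = 0 := abs_eq_zero.1 (by omega)
    have hj0 : j = 0 := abs_eq_zero.1 (by omega)
    have hk0 : k = 0 := abs_eq_zero.1 (by omega)
    subst hi0 hj0 hk0
    rw [trigCoef_zero, show (2 * Real.pi : ℂ) = ((2 * Real.pi : ℝ) : ℂ) by push_cast; ring]
    simp only [← Complex.ofReal_mul, Complex.ofReal_im]
  · simp

/-- The Hilbert transform of a product of analytic signals, in weak form. -/
theorem inner_mulL_hilbert (w : H1) (f g : L2) :
    ⟪mulL (supL w) f, hilbertL g⟫ + ⟪mulL (supL w) g, hilbertL f⟫ +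
      ⟪mulL (supL (hilbertH w)) f, g⟫ -
      ⟪mulL (supL (hilbertH w)) (hilbertL f), hilbertL g⟫ = 0 := by
  -- The left-hand side is the integral of Im ((w + iHw)(f + iHf)(g + iHg)); being trilinear and
  -- continuous, it needs checking on basis functions only.
  revert f g
  refine H1_induction (P := fun w => ∀ f g : L2, ⟪mulL (supL w) f, hilbertL g⟫ +
      ⟪mulL (supL w) g, hilbertL f⟫ + ⟪mulL (supL (hilbertH w)) f, g⟫ -
      ⟪mulL (supL (hilbertH w)) (hilbertL f), hilbertL g⟫ = 0) ?_ ?_ ?_ ?_ ?_ w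
  · simp only [ofPred_forall]
    exact isClosed_iInter fun v => isClosed_iInter fun w =>
      isClosed_eq (by fun_prop) continuous_const
  · intro f g; simp
  · intro u u' h h' f g
    have h1 := h f g
    have h2 := h' f g
    simp only [map_add, add_apply, inner_add_left]
    linarith
  · intro c u h f g
    have h1 := h f g
    simp only [map_smul, smul_apply, real_inner_smul_left]
    rw [← mul_add, ← mul_add, ← mul_sub, h1, mul_zero]
  intro i f
  refine L2_induction (P := fun f => ∀ g : L2, ⟪mulL (supL (trigH i)) f, hilbertL g⟫ +
      ⟪mulL (supL (trigH i)) g, hilbertL f⟫ + ⟪mulL (supL (hilbertH (trigH i))) f, g⟫ -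
      ⟪mulL (supL (hilbertH (trigH i))) (hilbertL f), hilbertL g⟫ = 0) ?_ ?_ ?_ ?_ ?_ f
  · simp only [ofPred_forall]
    exact isClosed_iInter fun w => isClosed_eq (by fun_prop) continuous_const
  · intro g; simp
  · intro u u' h h' g
    have h1 := h g
    have h2 := h' g
    simp only [map_add, inner_add_left, inner_add_right]
    linarith
  · intro c u h g
    have h1 := h g
    simp only [map_smul, real_inner_smul_left, real_inner_smul_right]
    rw [← mul_add, ← mul_add, ← mul_sub, h1, mul_zero]
  intro j g
  refine L2_induction (P := fun g => ⟪mulL (supL (trigH i)) (trigL j), hilbertL g⟫ +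
      ⟪mulL (supL (trigH i)) g, hilbertL (trigL j)⟫ +
      ⟪mulL (supL (hilbertH (trigH i))) (trigL j), g⟫ -
      ⟪mulL (supL (hilbertH (trigH i))) (hilbertL (trigL j)), hilbertL g⟫ = 0) ?_ ?_ ?_ ?_ ?_ g
  · exact isClosed_eq (by fun_prop) continuous_const
  · simp
  · intro u u' h1 h2
    simp only [map_add, inner_add_left, inner_add_right]
    linarith
  · intro c u h1
    simp only [map_smul, real_inner_smul_left, real_inner_smul_right]
    rw [← mul_add, ← mul_add, ← mul_sub, h1, mul_zero]
  intro k
  simp only [hilbertL_trigL, hilbertH_trigH, map_smul, smul_apply,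
    real_inner_smul_left, real_inner_smul_right, inner_mulL_trig]
  rw [← integral_trigC_im i j k]
  have hint : ∀ p q r : ℤ, Integrable fun y : S1 => trig p y * trig q y * trig r y := fun p q r =>
    integrable_coe (trig p * trig q * trig r)
  simp only [← integral_const_mul]
  rw [← integral_add ((hint _ _ _).const_mul _) ((hint _ _ _).const_mul _), ← integral_add
      (((hint _ _ _).const_mul _).fun_add ((hint _ _ _).const_mul _)) ((hint _ _ _).const_mul _),
      ← integral_sub ((((hint _ _ _).const_mul _).fun_add ((hint _ _ _).const_mul _)).fun_add
        ((hint _ _ _).const_mul _)) ((((hint _ _ _).const_mul _).const_mul _).const_mul _)]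
  refine integral_congr_ae (Eventually.of_forall fun y => ?_)
  simp only [Complex.mul_im, Complex.mul_re, trigC_im, ← trig_apply]
  ring

/-! ### Estimates for transport and stretching -/

/-- The bilinear map `(f, v) ↦ p v_x`, where `p` is the velocity belonging to `f`. -/
def transport : L2 →L[ℝ] H1 →L[ℝ] L2 := mulL.bilinearComp (supL.comp velocity) dxL

theorem transport_apply (f : L2) (v : H1) :
    transport f v = mulL (supL (velocity f)) (dx v) := rfl

/-- The bilinear map `(f, v) ↦ v H f`. -/
def stretch : L2 →L[ℝ] H1 →L[ℝ] L2 := mulL.flip.bilinearComp hilbertL supL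

theorem stretch_apply (f : L2) (v : H1) : stretch f v = mulL (supL v) (hilbertL f) := rfl

/-- The right-hand side `-a q v_x + w H p` of one of the two equations, where `q` transports `v`. -/
def force (a : ℝ) (f g : L2) (v w : H1) : L2 := -(a • transport g v) + stretch f w

theorem norm_transport_le (f : L2) (v : H1) : ‖transport f v‖ ≤ 2 * ‖supL‖ * ‖f‖ * ‖v‖ := by
  have h1 := supL.le_opNorm (velocity f)
  have h2 := mul_le_mul_of_nonneg_left (norm_velocity_le f) (norm_nonneg supL)
  calc ‖transport f v‖ ≤ ‖supL (velocity f)‖ * ‖dx v‖ := norm_mulL_le _ _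
    _ ≤ (2 * ‖supL‖ * ‖f‖) * ‖v‖ :=
      mul_le_mul (by linarith) (norm_dx_le v) (norm_nonneg _) (by positivity)

theorem norm_stretch_le (f : L2) (v : H1) : ‖stretch f v‖ ≤ ‖supL‖ * ‖f‖ * ‖v‖ :=
  calc ‖stretch f v‖ ≤ ‖supL v‖ * ‖hilbertL f‖ := norm_mulL_le _ _
    _ ≤ (‖supL‖ * ‖v‖) * ‖f‖ :=
      mul_le_mul (supL.le_opNorm v) (norm_hilbertL_le f) (norm_nonneg _) (by positivity)
    _ = _ := by ring

theorem norm_force_le (a : ℝ) {f g : L2} {v w : H1} {r s : ℝ} (hf : ‖f‖ ≤ r) (hg : ‖g‖ ≤ r)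
    (hv : ‖v‖ ≤ s) (hw : ‖w‖ ≤ s) : ‖force a f g v w‖ ≤ (2 * |a| + 1) * ‖supL‖ * r * s := by
  have hr : 0 ≤ r := (norm_nonneg _).trans hf
  have h1 : ‖transport g v‖ ≤ 2 * ‖supL‖ * r * s := (norm_transport_le g v).trans (by gcongr)
  have h2 : ‖stretch f w‖ ≤ ‖supL‖ * r * s := (norm_stretch_le f w).trans (by gcongr)
  calc ‖force a f g v w‖ ≤ ‖-(a • transport g v)‖ + ‖stretch f w‖ := norm_add_le _ _
    _ = |a| * ‖transport g v‖ + ‖stretch f w‖ := by rw [norm_neg, norm_smul, Real.norm_eq_abs]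
    _ ≤ |a| * (2 * ‖supL‖ * r * s) + ‖supL‖ * r * s := by gcongr
    _ = _ := by ring

/-- Integration by parts puts the derivative on the velocity, whose derivative is the Hilbert
transform of u; no derivative of v survives. -/
theorem inner_transport_self (u v : H1) : ⟪transport (fn u) v, fn v⟫ =
    -(1 / 2) * ⟪mulL (supL (hilbertH u)) (fn v), fn v⟫ := by
  have h1 := inner_mulL_parts (velocity (fn u)) v v
  have h2 := inner_mulL_comm (supL (velocity (fn u))) (fn v) (dx v)
  have h3 : mulL (supL v) (fn (hilbertH u)) = mulL (supL (hilbertH u)) (fn v) :=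
    mulL_supL_comm _ _
  rw [dx_velocity, ← fn_hilbertH, h3, h2] at h1
  rw [transport_apply]
  linarith

/-- For a vorticity in H¹ the L^∞ factor may be its Hilbert transform, which leaves only the L² norm
of v. -/
theorem stretch_fn (u v : H1) : stretch (fn u) v = mulL (supL (hilbertH u)) (fn v) :=
  mulL_supL_comm v (hilbertH u)

/-- Transport contributes |a|/2, rounded up to |a|, and stretching 1. The estimate serves both the
L² part of the energy and the comparison of two solutions in X. -/
theorem abs_inner_force_le (a : ℝ) {p q v w : H1} {κ r : ℝ} (hp : ‖supL (hilbertH p)‖ ≤ κ)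
    (hq : ‖supL (hilbertH q)‖ ≤ κ) (hv : ‖fn v‖ ≤ r) (hw : ‖fn w‖ ≤ r) :
    |⟪force a (fn p) (fn q) v w, fn v⟫| ≤ (|a| + 1) * κ * r ^ 2 := by
  have hκ : 0 ≤ κ := (norm_nonneg _).trans hp
  have hr : 0 ≤ r := (norm_nonneg _).trans hv
  have h1 : |⟪mulL (supL (hilbertH q)) (fn v), fn v⟫| ≤ κ * r * r :=
    (abs_inner_mulL_le _ _ _).trans (by gcongr)
  have h2 : |⟪mulL (supL (hilbertH p)) (fn w), fn v⟫| ≤ κ * r * r :=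
    (abs_inner_mulL_le _ _ _).trans (by gcongr)
  rw [force, inner_add_left, inner_neg_left, real_inner_smul_left, inner_transport_self, stretch_fn]
  calc _ ≤ |-(a * (-(1 / 2) * ⟪mulL (supL (hilbertH q)) (fn v), fn v⟫))| +
        |⟪mulL (supL (hilbertH p)) (fn w), fn v⟫| := abs_add_le _ _
    _ = |a| * (1 / 2 * |⟪mulL (supL (hilbertH q)) (fn v), fn v⟫|) +
        |⟪mulL (supL (hilbertH p)) (fn w), fn v⟫| := by
      rw [abs_neg, abs_mul, abs_mul, abs_neg, abs_of_pos (by norm_num : (0 : ℝ) < 1 / 2)]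
    _ ≤ |a| * (1 / 2 * (κ * r * r)) + κ * r * r := by gcongr
    _ ≤ _ := by
      have : 0 ≤ |a| * (κ * r * r) := by positivity
      nlinarith

/-- With g = f the cancellation reads 2 ∫ w f Hf = ∫ Hw ((Hf)² - f²), so the bound involves Hw
although the integrand contains w. -/
theorem abs_inner_mulL_hilbert_self_le (w : H1) (f : L2) :
    |⟪mulL (supL w) (hilbertL f), f⟫| ≤ ‖supL (hilbertH w)‖ * ‖f‖ ^ 2 := by
  have h1 := inner_mulL_hilbert w f f
  have h2 := abs_inner_mulL_le (supL (hilbertH w)) f f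
  have h3 : |⟪mulL (supL (hilbertH w)) (hilbertL f), hilbertL f⟫| ≤
      ‖supL (hilbertH w)‖ * ‖f‖ * ‖f‖ :=
    (abs_inner_mulL_le _ _ _).trans (by gcongr <;> exact norm_hilbertL_le f)
  rw [inner_mulL_comm]
  rw [abs_le] at h2 h3 ⊢
  constructor <;> nlinarith

/-- The part of the energy estimate that involves `v_xx = dx v'`, where `v' = v_x`. -/
theorem abs_inner_force_dx_le (a : ℝ) {q v w v' : H1} {κ r : ℝ} (hv' : fn v' = dx v)
    (hp : ‖supL (hilbertH v)‖ ≤ κ) (hq : ‖supL (hilbertH q)‖ ≤ κ) (hw : ‖supL (hilbertH w)‖ ≤ κ)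
    (hv : ‖dx v‖ ≤ r) (hwr : ‖dx w‖ ≤ r) :
    |⟪force a (fn v) (fn q) v w, dx v'⟫| ≤ (|a| + 2) * κ * r ^ 2 := by
  have hκ : 0 ≤ κ := (norm_nonneg _).trans hp
  have hr : 0 ≤ r := (norm_nonneg _).trans hv
  -- Multiplication is symmetric, so this is the transport identity for v' = v_x.
  have h1 : ⟪transport (fn q) v, dx v'⟫ = -(1 / 2) * ⟪mulL (supL (hilbertH q)) (dx v), dx v⟫ := by
    rw [← hv', ← inner_transport_self, transport_apply, transport_apply, hv', inner_mulL_comm]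
  have h2 : |⟪mulL (supL (hilbertH q)) (dx v), dx v⟫| ≤ κ * r * r :=
    (abs_inner_mulL_le _ _ _).trans (by gcongr)
  -- Splits ∫ w Hv v_xx into -∫ w_x Hv v_x, with Hv in L^∞, and -∫ w (H v_x) v_x, which is left to
  -- the analytic cancellation.
  have h3 := inner_mulL_parts w (hilbertH v) v'
  rw [fn_hilbertH, dx_hilbertH, hv'] at h3
  have h4 : |⟪mulL (supL (hilbertH v)) (dx w), dx v⟫| ≤ κ * r * r :=
    (abs_inner_mulL_le _ _ _).trans (by gcongr)
  have h5 : |⟪mulL (supL w) (hilbertL (dx v)), dx v⟫| ≤ κ * r ^ 2 :=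
    (abs_inner_mulL_hilbert_self_le w (dx v)).trans (by gcongr)
  have h6 : |⟪stretch (fn v) w, dx v'⟫| ≤ 2 * κ * r ^ 2 := by
    rw [stretch_apply]
    rw [abs_le] at h4 h5 ⊢
    constructor <;> nlinarith
  rw [force, inner_add_left, inner_neg_left, real_inner_smul_left, h1]
  calc _ ≤ |-(a * (-(1 / 2) * ⟪mulL (supL (hilbertH q)) (dx v), dx v⟫))| +
        |⟪stretch (fn v) w, dx v'⟫| := abs_add_le _ _
    _ = |a| * (1 / 2 * |⟪mulL (supL (hilbertH q)) (dx v), dx v⟫|) +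
        |⟪stretch (fn v) w, dx v'⟫| := by
      rw [abs_neg, abs_mul, abs_mul, abs_neg, abs_of_pos (by norm_num : (0 : ℝ) < 1 / 2)]
    _ ≤ |a| * (1 / 2 * (κ * r * r)) + 2 * κ * r ^ 2 := by gcongr
    _ ≤ _ := by
      have : 0 ≤ |a| * (κ * r * r) := by positivity
      nlinarith

/-- Against a fixed trigonometric function the derivative of v moves onto the velocity or the test
function, so the L² norm of v suffices. -/
theorem exists_inner_trigL_force_le (a : ℝ) (j : ℤ) : ∃ C ≥ 0, ∀ (f g : L2) (v w : H1) (r s : ℝ),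
    ‖f‖ ≤ r → ‖g‖ ≤ r → ‖fn v‖ ≤ s → ‖fn w‖ ≤ s →
    |⟪trigL j, force a f g v w⟫| ≤ C * r * s := by
  set A := ‖supL (trigH j)‖
  set D := ‖dx (trigH j)‖
  refine ⟨|a| * (A + 2 * ‖supL‖ * D) + A, by positivity, fun f g v w r s hf hg hv hw => ?_⟩
  have hr : 0 ≤ r := (norm_nonneg _).trans hf
  have hs : 0 ≤ s := (norm_nonneg _).trans hv
  have hst : ∀ (f : L2) (v : H1), ‖f‖ ≤ r → ‖fn v‖ ≤ s →
      |⟪mulL (supL v) (hilbertL f), fn (trigH j)⟫| ≤ A * r * s := fun f v hf hv => by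
    rw [inner_mulL_comm, mulL_supL_comm]
    refine (abs_inner_mulL_le _ _ _).trans ?_
    rw [mul_right_comm]
    gcongr
    exact (norm_hilbertL_le f).trans hf
  have h1 := inner_mulL_parts (velocity g) v (trigH j)
  rw [dx_velocity] at h1
  have h2 : |⟪mulL (supL (velocity g)) (fn v), dx (trigH j)⟫| ≤ 2 * ‖supL‖ * D * r * s := by
    have h3 : ‖supL (velocity g)‖ ≤ ‖supL‖ * (2 * r) :=
      (supL.le_opNorm _).trans (by gcongr; exact (norm_velocity_le g).trans (by gcongr))
    calc _ ≤ ‖supL (velocity g)‖ * ‖fn v‖ * ‖dx (trigH j)‖ := abs_inner_mulL_le _ _ _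
      _ ≤ (‖supL‖ * (2 * r)) * s * D := by gcongr
      _ = _ := by ring
  have h3 : |⟪transport g v, fn (trigH j)⟫| ≤ (A + 2 * ‖supL‖ * D) * r * s := by
    have h4 := hst g v hg hv
    rw [transport_apply]
    rw [abs_le] at h2 h4 ⊢
    constructor <;> nlinarith
  rw [show trigL j = fn (trigH j) from rfl, real_inner_comm, force, inner_add_left, inner_neg_left,
    real_inner_smul_left]
  calc _ ≤ |-(a * ⟪transport g v, fn (trigH j)⟫)| + |⟪stretch f w, fn (trigH j)⟫| := abs_add_le _ _
    _ = |a| * |⟪transport g v, fn (trigH j)⟫| + |⟪stretch f w, fn (trigH j)⟫| := by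
      rw [abs_neg, abs_mul]
    _ ≤ |a| * ((A + 2 * ‖supL‖ * D) * r * s) + A * r * s := by
      gcongr; exact hst f w hf hw
    _ = _ := by ring

/-! ### The coupled system as an evolution system -/

section Prod

variable {E F G : Type*} [NormedAddCommGroup E] [NormedAddCommGroup F] [NormedAddCommGroup G]

theorem norm_fst_le_norm (u : WithLp 2 (E × F)) : ‖u.fst‖ ≤ ‖u‖ := by
  have h := WithLp.prod_norm_sq_eq_of_L2 u
  exact le_of_sq_le_sq (by nlinarith [sq_nonneg ‖u.snd‖]) (norm_nonneg _)

theorem norm_snd_le_norm (u : WithLp 2 (E × F)) : ‖u.snd‖ ≤ ‖u‖ := by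
  have h := WithLp.prod_norm_sq_eq_of_L2 u
  exact le_of_sq_le_sq (by nlinarith [sq_nonneg ‖u.fst‖]) (norm_nonneg _)

theorem norm_le_norm_fst_add_norm_snd (u : WithLp 2 (E × F)) : ‖u‖ ≤ ‖u.fst‖ + ‖u.snd‖ := by
  have h := WithLp.prod_norm_sq_eq_of_L2 u
  have h1 := norm_nonneg u.fst
  have h2 := norm_nonneg u.snd
  exact le_of_sq_le_sq (by nlinarith) (by positivity)

variable [NormedSpace ℝ E] [NormedSpace ℝ F] [NormedSpace ℝ G]

/-- Pairing of two continuous linear maps into a Hilbert sum. -/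
def pairL (f : E →L[ℝ] F) (g : E →L[ℝ] G) : E →L[ℝ] WithLp 2 (F × G) :=
  (WithLp.prodContinuousLinearEquiv 2 ℝ F G).symm.toContinuousLinearMap.comp (f.prod g)

end Prod

/-- Pairs of `L²` functions. -/
abbrev X : Type := WithLp 2 (L2 × L2)

/-- Pairs of `H¹` functions. -/
abbrev Y : Type := WithLp 2 (H1 × H1)

/-- The inclusion of pairs of `H¹` functions into pairs of `L²` functions. -/
def inclusionL : Y →L[ℝ] X :=
  pairL (fnL.comp (WithLp.fstL 2 ℝ H1 H1)) (fnL.comp (WithLp.sndL 2 ℝ H1 H1))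

@[simp] theorem inclusionL_fst (u : Y) : (inclusionL u).fst = fn u.fst := rfl
@[simp] theorem inclusionL_snd (u : Y) : (inclusionL u).snd = fn u.snd := rfl

/-- The bilinear vector field of the system: `u` supplies the vorticities and `v` is transported. -/
def field (a : ℝ) : Y →L[ℝ] Y →L[ℝ] X :=
  let fs := WithLp.fstL 2 ℝ H1 H1
  let sn := WithLp.sndL 2 ℝ H1 H1
  let inl : L2 →L[ℝ] X := pairL (ContinuousLinearMap.id ℝ L2) 0
  let inr : L2 →L[ℝ] X := pairL 0 (ContinuousLinearMap.id ℝ L2)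
  (ContinuousLinearMap.compL ℝ Y L2 X inl).comp
      (-(a • transport.bilinearComp (fnL.comp sn) fs) + stretch.bilinearComp (fnL.comp fs) sn) +
    (ContinuousLinearMap.compL ℝ Y L2 X inr).comp
      (-(a • transport.bilinearComp (fnL.comp fs) sn) + stretch.bilinearComp (fnL.comp sn) fs)

@[simp] theorem field_fst (a : ℝ) (u v : Y) :
    (field a u v).fst = force a (fn u.fst) (fn u.snd) v.fst v.snd := by
  have : (field a u v).fst = force a (fn u.fst) (fn u.snd) v.fst v.snd + 0 := rfl
  rw [this, add_zero]

@[simp] theorem field_snd (a : ℝ) (u v : Y) :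
    (field a u v).snd = force a (fn u.snd) (fn u.fst) v.snd v.fst := by
  have : (field a u v).snd = 0 + force a (fn u.snd) (fn u.fst) v.snd v.fst := rfl
  rw [this, zero_add]

/-- The trigonometric vectors of `X`. -/
def pairTrigL : ℤ ⊕ ℤ → X :=
  Sum.elim (fun j => WithLp.toLp 2 (trigL j, 0)) (fun j => WithLp.toLp 2 (0, trigL j))

/-- The trigonometric vectors of `Y`. -/
def pairTrigH : ℤ ⊕ ℤ → Y :=
  Sum.elim (fun j => WithLp.toLp 2 (trigH j, 0)) (fun j => WithLp.toLp 2 (0, trigH j))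

theorem inner_pairTrigL_inl (j : ℤ) (x : X) :
    ⟪pairTrigL (Sum.inl j), x⟫ = ⟪trigL j, x.fst⟫ := by
  simp [pairTrigL, WithLp.prod_inner_apply]

theorem inner_pairTrigL_inr (j : ℤ) (x : X) :
    ⟪pairTrigL (Sum.inr j), x⟫ = ⟪trigL j, x.snd⟫ := by
  simp [pairTrigL, WithLp.prod_inner_apply]

theorem inner_pairTrigH_inl (j : ℤ) (u : Y) :
    ⟪pairTrigH (Sum.inl j), u⟫ = ⟪trigH j, u.fst⟫ := by
  rw [WithLp.prod_inner_apply]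
  change ⟪trigH j, u.fst⟫ + ⟪(0 : H1), u.snd⟫ = _
  rw [inner_zero_left, add_zero]

theorem inner_pairTrigH_inr (j : ℤ) (u : Y) :
    ⟪pairTrigH (Sum.inr j), u⟫ = ⟪trigH j, u.snd⟫ := by
  rw [WithLp.prod_inner_apply]
  change ⟪(0 : H1), u.fst⟫ + ⟪trigH j, u.snd⟫ = _
  rw [inner_zero_left, zero_add]

theorem orthonormal_pairTrigL : Orthonormal ℝ pairTrigL := by
  rw [orthonormal_iff_ite]
  rintro (i | i) (j | j)
  · rw [inner_pairTrigL_inl]; simp [pairTrigL, inner_trigL_trigL]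
  · rw [inner_pairTrigL_inl]; simp [pairTrigL]
  · rw [inner_pairTrigL_inr]; simp [pairTrigL]
  · rw [inner_pairTrigL_inr]; simp [pairTrigL, inner_trigL_trigL]

/-- The trigonometric Hilbert basis of `X`. -/
def pairBasis : HilbertBasis (ℤ ⊕ ℤ) ℝ X :=
  HilbertBasis.mkOfOrthogonalEqBot orthonormal_pairTrigL (by
    rw [Submodule.eq_bot_iff]
    intro x hx
    have h : ∀ i, ⟪pairTrigL i, x⟫ = 0 := fun i =>
      (Submodule.mem_orthogonal _ x).1 hx _ (Submodule.subset_span (mem_range_self i))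
    refine WithLp.ofLp_injective 2 (Prod.ext ?_ ?_)
    · exact eq_zero_of_inner_trigL fun j => (inner_pairTrigL_inl j x).symm.trans (h _)
    · exact eq_zero_of_inner_trigL fun j => (inner_pairTrigL_inr j x).symm.trans (h _))

@[simp] theorem pairBasis_apply (i : ℤ ⊕ ℤ) : pairBasis i = pairTrigL i := by
  simp [pairBasis]

/-- Derivatives of trigonometric polynomials are again in H¹; this supplies the second derivative
that the energy estimate pairs with. -/
theorem exists_fn_eq_dx {u : Y} (hu : u ∈ Submodule.span ℝ (range pairTrigH)) :
    ∃ v : Y, fn v.fst = dx u.fst ∧ fn v.snd = dx u.snd := by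
  induction hu using Submodule.span_induction with
  | mem x hx =>
    obtain ⟨j | j, rfl⟩ := hx
    · exact ⟨WithLp.toLp 2 (-(j : ℝ) • trigH (-j), 0), rfl, rfl⟩
    · exact ⟨WithLp.toLp 2 (0, -(j : ℝ) • trigH (-j)), rfl, rfl⟩
  | zero => exact ⟨0, rfl, rfl⟩
  | add x y _ _ hx hy =>
    obtain ⟨v, h1, h2⟩ := hx
    obtain ⟨w, h3, h4⟩ := hy
    exact ⟨v + w, by simp [h1, h3], by simp [h2, h4]⟩
  | smul c x _ hx =>
    obtain ⟨v, h1, h2⟩ := hx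
    exact ⟨c • v, by simp [h1], by simp [h2]⟩

/-- The weight 1 + j² is the symbol of 1 - ∂², so z is v - v_xx. -/
theorem eq_fn_sub_dx {v v' : H1} {z : L2} (hv : fn v' = dx v)
    (hz : ∀ j : ℤ, ⟪trigL j, z⟫ = (1 + (j : ℝ) ^ 2) * ⟪trigL j, fn v⟫) : z = fn v - dx v' :=
  ext_trigL fun j => by
    rw [hz, inner_sub_right, inner_trigL_dx, hv, inner_trigL_dx, neg_neg]
    push_cast
    ring

/-- The control quantity `‖H Ω‖_∞ + ‖H ω‖_∞`. -/
def supHilbert (u : Y) : ℝ := ‖supL (hilbertH u.fst)‖ + ‖supL (hilbertH u.snd)‖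

theorem supHilbert_nonneg (u : Y) : 0 ≤ supHilbert u := by unfold supHilbert; positivity

theorem norm_supL_hilbertH_le (u : H1) : ‖supL (hilbertH u)‖ ≤ ‖supL‖ * ‖u‖ :=
  (supL.le_opNorm _).trans (by gcongr; exact norm_hilbertH_le u)

theorem supHilbert_le (u : Y) : supHilbert u ≤ 2 * ‖supL‖ * ‖u‖ := by
  have h1 : ‖supL (hilbertH u.fst)‖ ≤ ‖supL‖ * ‖u‖ :=
    (norm_supL_hilbertH_le _).trans (by gcongr; exact norm_fst_le_norm u)
  have h2 : ‖supL (hilbertH u.snd)‖ ≤ ‖supL‖ * ‖u‖ :=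
    (norm_supL_hilbertH_le _).trans (by gcongr; exact norm_snd_le_norm u)
  unfold supHilbert
  linarith

theorem exists_norm_supL_hilbertH_le {ε : ℝ} (hε : 0 < ε) :
    ∃ C ≥ 0, ∀ u : H1, ‖supL (hilbertH u)‖ ≤ ε * ‖u‖ + C * ‖fn u‖ := by
  obtain ⟨C, hC, h⟩ := exists_norm_supL_le hε
  refine ⟨C, hC, fun u => (h _).trans ?_⟩
  gcongr
  · exact norm_hilbertH_le u
  · exact norm_hilbertL_le _

theorem exists_abs_supHilbert_sub_le {ε : ℝ} (hε : 0 < ε) :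
    ∃ C, ∀ u w : Y, |supHilbert u - supHilbert w| ≤ ε * ‖u - w‖ + C * ‖inclusionL (u - w)‖ := by
  obtain ⟨C, hC, h⟩ := exists_norm_supL_hilbertH_le (half_pos hε)
  refine ⟨2 * C, fun u w => ?_⟩
  have key : ∀ p q : H1, |‖supL (hilbertH p)‖ - ‖supL (hilbertH q)‖| ≤
      ε / 2 * ‖p - q‖ + C * ‖fn (p - q)‖ := fun p q => by
    refine (abs_norm_sub_norm_le _ _).trans ?_
    rw [← map_sub, ← map_sub]
    exact h _
  have h1 : |‖supL (hilbertH u.fst)‖ - ‖supL (hilbertH w.fst)‖| ≤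
      ε / 2 * ‖u - w‖ + C * ‖inclusionL (u - w)‖ := (key _ _).trans (by
    gcongr
    · exact norm_fst_le_norm (u - w)
    · exact norm_fst_le_norm (inclusionL (u - w)))
  have h2 : |‖supL (hilbertH u.snd)‖ - ‖supL (hilbertH w.snd)‖| ≤
      ε / 2 * ‖u - w‖ + C * ‖inclusionL (u - w)‖ := (key _ _).trans (by
    gcongr
    · exact norm_snd_le_norm (u - w)
    · exact norm_snd_le_norm (inclusionL (u - w)))
  unfold supHilbert
  rw [abs_le] at h1 h2 ⊢
  constructor <;> linarith

/-- The constant multiplying the control quantity in the energy estimate. -/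
def energyConst (a : ℝ) : ℝ := 4 * |a| + 6

theorem energyConst_nonneg (a : ℝ) : 0 ≤ energyConst a := by unfold energyConst; positivity

theorem abs_inner_field_le (a : ℝ) (u : Y) (hu : u ∈ Submodule.span ℝ (range pairTrigH)) (z : X)
    (hz : ∀ i, ⟪pairTrigL i, z⟫ =
      Sum.elim (fun j : ℤ => 1 + (j : ℝ) ^ 2) (fun j : ℤ => 1 + (j : ℝ) ^ 2) i *
        ⟪pairTrigL i, inclusionL u⟫) :
    |⟪field a u u, z⟫| ≤ energyConst a * supHilbert u * ‖u‖ ^ 2 := by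
  obtain ⟨v, h1, h2⟩ := exists_fn_eq_dx hu
  have hz1 : z.fst = fn u.fst - dx v.fst :=
    eq_fn_sub_dx h1 fun j => by
      simpa only [inner_pairTrigL_inl, Sum.elim_inl, inclusionL_fst] using hz (Sum.inl j)
  have hz2 : z.snd = fn u.snd - dx v.snd :=
    eq_fn_sub_dx h2 fun j => by
      simpa only [inner_pairTrigL_inr, Sum.elim_inr, inclusionL_snd] using hz (Sum.inr j)
  have hκ1 : ‖supL (hilbertH u.fst)‖ ≤ supHilbert u := le_add_of_nonneg_right (norm_nonneg _)
  have hκ2 : ‖supL (hilbertH u.snd)‖ ≤ supHilbert u := le_add_of_nonneg_left (norm_nonneg _)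
  have hf1 := norm_fst_le_norm u
  have hf2 := norm_snd_le_norm u
  have n1 := (norm_fn_le u.fst).trans hf1
  have n2 := (norm_fn_le u.snd).trans hf2
  have d1 := (norm_dx_le u.fst).trans hf1
  have d2 := (norm_dx_le u.snd).trans hf2
  have e1 := abs_inner_force_le a hκ1 hκ2 n1 n2
  have e2 := abs_inner_force_le a hκ2 hκ1 n2 n1
  have e3 := abs_inner_force_dx_le a h1 hκ1 hκ2 hκ2 d1 d2
  have e4 := abs_inner_force_dx_le a h2 hκ2 hκ1 hκ1 d2 d1
  rw [WithLp.prod_inner_apply]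
  change |⟪(field a u u).fst, z.fst⟫ + ⟪(field a u u).snd, z.snd⟫| ≤ _
  rw [field_fst, field_snd, hz1, hz2, inner_sub_right, inner_sub_right]
  -- 4|a| + 6 = 2(|a| + 1) + 2(|a| + 2): an L² part and a derivative part for each of the two
  -- components.
  unfold energyConst
  rw [abs_le] at e1 e2 e3 e4 ⊢
  constructor <;> nlinarith

theorem abs_inner_field_inclusionL_le (a : ℝ) (u v : Y) :
    |⟪field a u v, inclusionL v⟫| ≤ 2 * (|a| + 1) * ‖supL‖ * ‖u‖ * ‖inclusionL v‖ ^ 2 := by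
  have hκ1 : ‖supL (hilbertH u.fst)‖ ≤ ‖supL‖ * ‖u‖ :=
    (norm_supL_hilbertH_le _).trans (by gcongr; exact norm_fst_le_norm u)
  have hκ2 : ‖supL (hilbertH u.snd)‖ ≤ ‖supL‖ * ‖u‖ :=
    (norm_supL_hilbertH_le _).trans (by gcongr; exact norm_snd_le_norm u)
  have n1 : ‖fn v.fst‖ ≤ ‖inclusionL v‖ := norm_fst_le_norm (inclusionL v)
  have n2 : ‖fn v.snd‖ ≤ ‖inclusionL v‖ := norm_snd_le_norm (inclusionL v)
  have e1 := abs_inner_force_le a hκ1 hκ2 n1 n2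
  have e2 := abs_inner_force_le a hκ2 hκ1 n2 n1
  rw [WithLp.prod_inner_apply]
  change |⟪(field a u v).fst, fn v.fst⟫ + ⟪(field a u v).snd, fn v.snd⟫| ≤ _
  rw [field_fst, field_snd]
  rw [abs_le] at e1 e2 ⊢
  constructor <;> nlinarith

theorem norm_field_le (a : ℝ) (u v : Y) :
    ‖field a u v‖ ≤ 2 * (2 * |a| + 1) * ‖supL‖ * ‖inclusionL u‖ * ‖v‖ := by
  have n1 : ‖fn u.fst‖ ≤ ‖inclusionL u‖ := norm_fst_le_norm (inclusionL u)
  have n2 : ‖fn u.snd‖ ≤ ‖inclusionL u‖ := norm_snd_le_norm (inclusionL u)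
  have h1 := norm_force_le a n1 n2 (norm_fst_le_norm v) (norm_snd_le_norm v)
  have h2 := norm_force_le a n2 n1 (norm_snd_le_norm v) (norm_fst_le_norm v)
  refine (norm_le_norm_fst_add_norm_snd _).trans ?_
  rw [field_fst, field_snd]
  linarith

theorem exists_inner_pairTrigL_field_le (a : ℝ) (i : ℤ ⊕ ℤ) : ∃ C, ∀ u w : Y,
    |⟪pairTrigL i, field a u w⟫| ≤ C * ‖inclusionL u‖ * ‖inclusionL w‖ := by
  have n1 : ∀ u : Y, ‖fn u.fst‖ ≤ ‖inclusionL u‖ := fun u => norm_fst_le_norm (inclusionL u)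
  have n2 : ∀ u : Y, ‖fn u.snd‖ ≤ ‖inclusionL u‖ := fun u => norm_snd_le_norm (inclusionL u)
  rcases i with j | j
  · obtain ⟨C, -, h⟩ := exists_inner_trigL_force_le a j
    refine ⟨C, fun u w => ?_⟩
    rw [inner_pairTrigL_inl, field_fst]
    exact h _ _ _ _ _ _ (n1 u) (n2 u) (n1 w) (n2 w)
  · obtain ⟨C, -, h⟩ := exists_inner_trigL_force_le a j
    refine ⟨C, fun u w => ?_⟩
    rw [inner_pairTrigL_inr, field_snd]
    exact h _ _ _ _ _ _ (n2 u) (n1 u) (n2 w) (n1 w)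

theorem finite_one_add_sq_le (r : ℝ) : {j : ℤ | 1 + (j : ℝ) ^ 2 ≤ r}.Finite := by
  refine (finite_Icc (-⌈r⌉) ⌈r⌉).subset fun j hj => ?_
  have hj : 1 + (j : ℝ) ^ 2 ≤ r := hj
  have h1 : (1 : ℝ) + (j : ℝ) ^ 2 ≤ ⌈r⌉ := hj.trans (Int.le_ceil r)
  have h2 : 1 + j ^ 2 ≤ ⌈r⌉ := by exact_mod_cast h1
  constructor <;> nlinarith

/-- The system of the two vorticity equations as an abstract evolution system. -/
def system (a : ℝ) : EvolutionSystem X Y (ℤ ⊕ ℤ) where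
  J := inclusionL
  J_injective := fun u v h => by
    have h1 : fn u.fst = fn v.fst := by
      rw [← inclusionL_fst u, ← inclusionL_fst v, h]
    have h2 : fn u.snd = fn v.snd := by
      rw [← inclusionL_snd u, ← inclusionL_snd v, h]
    exact WithLp.ofLp_injective 2 (Prod.ext (fn_injective h1) (fn_injective h2))
  b := pairBasis
  e := pairTrigH
  J_e := fun i => by rw [pairBasis_apply]; rcases i with j | j <;> rfl
  lam := Sum.elim (fun j : ℤ => 1 + (j : ℝ) ^ 2) (fun j : ℤ => 1 + (j : ℝ) ^ 2)
  lam_pos := fun i => by rcases i with j | j <;> simp only [Sum.elim_inl, Sum.elim_inr] <;> positivity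
  finite_lam_le := fun r => by
    refine (((finite_one_add_sq_le r).image Sum.inl).union
      ((finite_one_add_sq_le r).image Sum.inr)).subset ?_
    rintro (j | j) h
    · exact Or.inl ⟨j, h, rfl⟩
    · exact Or.inr ⟨j, h, rfl⟩
  inner_e := fun i u => by
    rw [pairBasis_apply]
    rcases i with j | j
    · rw [inner_pairTrigL_inl, inner_pairTrigH_inl, inner_trigH]; rfl
    · rw [inner_pairTrigL_inr, inner_pairTrigH_inr, inner_trigH]; rfl
  B := field a
  K := fun u => energyConst a * supHilbert u
  -- One constant dominating those of `K_le`, `inner_B_self_le` and `norm_B_le`; the added 1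
  -- guarantees positivity.
  c := (4 * |a| + 12) * (‖supL‖ + 1) + energyConst a * (2 * ‖supL‖)
  c_pos := by have := energyConst_nonneg a; positivity
  K_nonneg := fun u => mul_nonneg (energyConst_nonneg a) (supHilbert_nonneg u)
  K_le := fun u => by
    have h := mul_le_mul_of_nonneg_left (supHilbert_le u) (energyConst_nonneg a)
    have : 0 ≤ (4 * |a| + 12) * (‖supL‖ + 1) * ‖u‖ := by positivity
    linarith
  K_sub_le := fun ε hε => by
    have hk : 0 < energyConst a := by unfold energyConst; positivity
    obtain ⟨C, h⟩ := exists_abs_supHilbert_sub_le (div_pos hε hk)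
    refine ⟨energyConst a * C, fun u w => ?_⟩
    rw [← mul_sub, abs_mul, abs_of_pos hk]
    calc _ ≤ energyConst a * (ε / energyConst a * ‖u - w‖ + C * ‖inclusionL (u - w)‖) :=
          mul_le_mul_of_nonneg_left (h u w) hk.le
      _ = _ := by field_simp
  inner_B_self_le := fun u v => by
    refine (abs_inner_field_inclusionL_le a u v).trans ?_
    have := energyConst_nonneg a
    gcongr
    nlinarith [norm_nonneg supL, abs_nonneg a, mul_nonneg (abs_nonneg a) (norm_nonneg supL),
      mul_nonneg this (norm_nonneg supL)]
  norm_B_le := fun u v => by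
    refine (norm_field_le a u v).trans ?_
    have := energyConst_nonneg a
    gcongr
    nlinarith [norm_nonneg supL, abs_nonneg a, mul_nonneg (abs_nonneg a) (norm_nonneg supL),
      mul_nonneg this (norm_nonneg supL)]
  energy_le := fun u hu z hz => abs_inner_field_le a u hu z fun i => by
    simpa only [pairBasis_apply] using hz i
  inner_basis_B_le := fun i => by
    simp only [pairBasis_apply]
    exact exists_inner_pairTrigL_field_le a i

/-! ### The principal value integral equals the Fourier multiplier -/

theorem hilbertTrunc_congr {f g : S1 → ℝ} (h : f =ᵐ[volume] g) (ε : ℝ) (x : S1) :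
    hilbertTrunc f ε x = hilbertTrunc g ε x := by
  have hm : MeasurePreserving (fun y : S1 => x - y) volume volume :=
    Measure.measurePreserving_sub_left volume x
  have h1 : ∀ᵐ y : S1, f (x - y) = g (x - y) := 
    hm.quasiMeasurePreserving.ae (p := fun y => f y = g y) h
  have h2 : ∀ᵐ s : ℝ ∂volume.restrict (Icc (-Real.pi) Real.pi),
      f (x - (s : S1)) = g (x - (s : S1)) := by
    rw [← restrict_Ioc_eq_restrict_Icc]
    exact measurePreserving_coe.quasiMeasurePreserving.ae (p := fun y => f (x - y) = g (x - y)) h1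
  have h3 := ae_restrict_of_ae_restrict_of_subset
    (s := {s : ℝ | ε < |s| ∧ |s| ≤ Real.pi}) (fun s hs => abs_le.1 hs.2) h2
  unfold hilbertTrunc
  congr 1
  refine integral_congr_ae ?_
  filter_upwards [h3] with s hs
  rw [hs]

theorem sin_half_pos {s : ℝ} (h0 : 0 < s) (h1 : s ≤ Real.pi) : 0 < Real.sin (s / 2) :=
  Real.sin_pos_of_pos_of_lt_pi (by linarith) (by linarith [Real.pi_pos])

theorem continuousOn_cot_half {ε : ℝ} (h0 : 0 < ε) :
    ContinuousOn (fun s : ℝ => Real.cot (s / 2)) (Icc ε Real.pi) := by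
  have : ∀ s : ℝ, Real.cot (s / 2) = Real.cos (s / 2) / Real.sin (s / 2) := fun s =>
    Real.cot_eq_cos_div_sin _
  simp_rw [this]
  exact ContinuousOn.div (by fun_prop) (by fun_prop) fun s hs =>
    (sin_half_pos (h0.trans_le hs.1) hs.2).ne'

theorem cot_neg_half (s : ℝ) : Real.cot (-s / 2) = -Real.cot (s / 2) := by
  rw [Real.cot_eq_cos_div_sin, Real.cot_eq_cos_div_sin, neg_div, Real.cos_neg, Real.sin_neg, div_neg]

/-- The cotangent is odd, so folding s and -s together leaves a difference of values of F. -/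
theorem hilbertTrunc_eq_interval (F : C(S1, ℝ)) {ε : ℝ} (h0 : 0 < ε) (h1 : ε < Real.pi) (x : S1) :
    hilbertTrunc F ε x = (1 / (2 * Real.pi)) * ∫ s in ε..Real.pi,
      (F (x - (s : S1)) - F (x + (s : S1))) * Real.cot (s / 2) := by
  have hset : {s : ℝ | ε < |s| ∧ |s| ≤ Real.pi} = Ioc ε Real.pi ∪ Ico (-Real.pi) (-ε) := by
    ext s
    simp only [mem_ofPred_eq, mem_union, mem_Ioc, mem_Ico]
    rcases le_total 0 s with h | h
    · rw [abs_of_nonneg h]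
      constructor
      · exact fun h => Or.inl h
      · rintro (h | h)
        · exact h
        · linarith
    · rw [abs_of_nonpos h]
      constructor
      · exact fun h => Or.inr ⟨by linarith, by linarith⟩
      · rintro (h | h)
        · linarith
        · exact ⟨by linarith, by linarith⟩
  have hc1 : ContinuousOn (fun s : ℝ => F (x - (s : S1)) * Real.cot (s / 2)) (Icc ε Real.pi) :=
    ContinuousOn.mul (Continuous.continuousOn (F.continuous.comp
      (continuous_const.sub (AddCircle.continuous_mk' _)))) (continuousOn_cot_half h0)
  have hc2 : ContinuousOn (fun s : ℝ => F (x + (s : S1)) * Real.cot (s / 2)) (Icc ε Real.pi) :=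
    ContinuousOn.mul (Continuous.continuousOn (F.continuous.comp
      (continuous_const.add (AddCircle.continuous_mk' _)))) (continuousOn_cot_half h0)
  have hi1 := hc1.intervalIntegrable_of_Icc (μ := volume) h1.le
  have hi2 := hc2.intervalIntegrable_of_Icc (μ := volume) h1.le
  have hneg : ∀ s : ℝ, F (x - ((-s : ℝ) : S1)) * Real.cot (-s / 2) =
      -(F (x + (s : S1)) * Real.cot (s / 2)) := fun s => by
    rw [AddCircle.coe_neg, sub_neg_eq_add, cot_neg_half, mul_neg]
  have hi3 : IntervalIntegrable (fun s : ℝ => F (x - (s : S1)) * Real.cot (s / 2)) volume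
      (-Real.pi) (-ε) := by
    rw [IntervalIntegrable.iff_comp_neg, neg_neg, neg_neg]
    simp_rw [hneg]
    exact hi2.neg.symm
  have h3 : ∫ s in (-Real.pi)..(-ε), F (x - (s : S1)) * Real.cot (s / 2) =
      -∫ s in ε..Real.pi, F (x + (s : S1)) * Real.cot (s / 2) := by
    rw [← intervalIntegral.integral_comp_neg, ← intervalIntegral.integral_neg]
    simp_rw [hneg]
  unfold hilbertTrunc
  congr 1
  rw [hset, setIntegral_union ?_ measurableSet_Ico, integral_Ico_eq_integral_Ioc,
    ← intervalIntegral.integral_of_le h1.le, ← intervalIntegral.integral_of_le (by linarith), h3,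
    ← sub_eq_add_neg, ← intervalIntegral.integral_sub hi1 hi2]
  · simp_rw [sub_mul]
  · exact (intervalIntegrable_iff_integrableOn_Ioc_of_le h1.le).1 hi1
  · rw [integrableOn_congr_set_ae Ico_ae_eq_Ioc]
    exact (intervalIntegrable_iff_integrableOn_Ioc_of_le (by linarith)).1 hi3
  · rw [Set.disjoint_left]
    intro s hs hs'
    linarith [hs.1, hs'.2]

/-- Translating the analytic signal by s multiplies it by exp(i|j|s); the real parts of the two
translates differ by the sine term. -/
theorem trig_sub_sub_trig_add (j : ℤ) (x : S1) (s : ℝ) :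
    trig j (x - (s : S1)) - trig j (x + (s : S1)) =
      2 * (trigC j x).im * Real.sin (j.natAbs * s) := by
  obtain ⟨x, rfl⟩ := QuotientAddGroup.mk_surjective x
  change trig j ((x : S1) - (s : S1)) - trig j ((x : S1) + (s : S1)) =
      2 * (trigC j (x : S1)).im * Real.sin (j.natAbs * s)
  have hn : ((|j| : ℤ) : ℂ) = ((j.natAbs : ℝ) : ℂ) := by
    rw [Nat.cast_natAbs, Complex.ofReal_intCast]
  have h : ∀ r : ℝ, trigC j ((x + r : ℝ) : S1) = trigC j (x : S1) *
      (Real.cos (j.natAbs * r) + Real.sin (j.natAbs * r) * Complex.I) := fun r => by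
    rw [trigC_coe, trigC_coe, hn, mul_assoc (trigCoef j), Complex.ofReal_cos, Complex.ofReal_sin,
      ← Complex.exp_mul_I, ← Complex.exp_add]
    congr 2
    push_cast
    ring
  rw [← AddCircle.coe_sub, ← AddCircle.coe_add, trig_apply, trig_apply, sub_eq_add_neg x s, h, h,
    mul_neg, Real.cos_neg, Real.sin_neg]
  simp only [Complex.mul_re, Complex.add_re, Complex.add_im, Complex.ofReal_re, Complex.ofReal_im,
    Complex.mul_im, Complex.I_re, Complex.I_im]
  ring

/-- Telescoping: the increment of sin(ns) is 2 sin(s/2) cos((n + ½)s), and the cotangent turns it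
into cos((n + 1)s) + cos(ns). -/
theorem sin_mul_cot_half {s : ℝ} (hs : Real.sin (s / 2) ≠ 0) (n : ℕ) :
    Real.sin (n * s) * Real.cot (s / 2) =
      ∑ k ∈ Finset.range n, (Real.cos ((k + 1 : ℕ) * s) + Real.cos (k * s)) := by
  induction n with
  | zero => simp
  | succ n ih =>
    rw [Finset.sum_range_succ, ← ih, Real.cot_eq_cos_div_sin]
    have h1 : ((n + 1 : ℕ) : ℝ) * s = (n * s + s / 2) + s / 2 := by push_cast; ring
    have h2 : (n : ℝ) * s = (n * s + s / 2) - s / 2 := by ring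
    rw [h1]
    generalize hθ : (n : ℝ) * s + s / 2 = θ at *
    rw [h2, Real.sin_add, Real.cos_add, Real.sin_sub, Real.cos_sub]
    field_simp
    ring

/-- The truncated integral of `sin (n s) cot (s / 2)` over half a period. -/
def sinCotIntegral (n : ℕ) (ε : ℝ) : ℝ :=
  ∫ s in ε..Real.pi, Real.sin (n * s) * Real.cot (s / 2)

theorem integral_cos_mul (k : ℕ) (ε : ℝ) : ∫ s in ε..Real.pi, Real.cos ((k + 1 : ℕ) * s) =
    -(Real.sin ((k + 1 : ℕ) * ε) / (k + 1 : ℕ)) := by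
  have hk : ((k + 1 : ℕ) : ℝ) ≠ 0 := by positivity
  rw [intervalIntegral.integral_comp_mul_left (fun s => Real.cos s) hk, integral_cos,
    Real.sin_nat_mul_pi, smul_eq_mul]
  ring

theorem sinCotIntegral_eq (n : ℕ) {ε : ℝ} (h0 : 0 < ε) (h1 : ε ≤ Real.pi) :
    sinCotIntegral n ε = ∑ k ∈ Finset.range n,
      ((∫ s in ε..Real.pi, Real.cos ((k + 1 : ℕ) * s)) + ∫ s in ε..Real.pi, Real.cos (k * s)) := by
  have hi : ∀ k : ℕ, IntervalIntegrable (fun s => Real.cos (k * s)) volume ε Real.pi := fun k =>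
    Continuous.intervalIntegrable (by fun_prop) _ _
  simp_rw [← intervalIntegral.integral_add (hi _) (hi _)]
  rw [← intervalIntegral.integral_finsetSum fun k _ => (hi (k + 1)).add (hi k)]
  refine intervalIntegral.integral_congr fun s hs => ?_
  rw [uIcc_of_le h1] at hs
  exact sin_mul_cot_half (sin_half_pos (h0.trans_le hs.1) hs.2).ne' n

/-- Cosines of positive frequency integrate to 0 over [0, π]; only the constant term k = 0 survives,
and it is present because n ≠ 0. -/
theorem tendsto_sinCotIntegral {n : ℕ} (hn : n ≠ 0) :
    Tendsto (sinCotIntegral n) (𝓝[>] 0) (𝓝 Real.pi) := by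
  have h : ∀ k : ℕ, Tendsto (fun ε => ∫ s in ε..Real.pi, Real.cos (k * s)) (𝓝[>] 0)
      (𝓝 (if k = 0 then Real.pi else 0)) := fun k => by
    refine tendsto_nhdsWithin_of_tendsto_nhds ?_
    rcases k with _ | k
    · have : Tendsto (fun ε : ℝ => Real.pi - ε) (𝓝 0) (𝓝 (Real.pi - 0)) :=
        Continuous.tendsto (by fun_prop) 0
      simpa using this
    · have : Tendsto (fun ε : ℝ => -(Real.sin ((k + 1 : ℕ) * ε) / (k + 1 : ℕ))) (𝓝 0)
          (𝓝 (-(Real.sin ((k + 1 : ℕ) * 0) / (k + 1 : ℕ)))) :=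
        Continuous.tendsto (by fun_prop) 0
      simp_rw [integral_cos_mul]
      simpa using this
  have h1 := tendsto_finsetSum (Finset.range n) fun k _ => (h (k + 1)).add (h k)
  have h2 : ∑ k ∈ Finset.range n, ((if k + 1 = 0 then Real.pi else 0) +
      if k = 0 then Real.pi else 0) = Real.pi := by
    simp [Nat.pos_of_ne_zero hn]
  rw [h2] at h1
  refine h1.congr' ?_
  filter_upwards [Ioo_mem_nhdsGT Real.pi_pos] with ε hε
  rw [sinCotIntegral_eq n hε.1 hε.2.le]

theorem abs_integral_cos_le (k : ℕ) (ε : ℝ) :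
    |∫ s in ε..Real.pi, Real.cos ((k + 1 : ℕ) * s)| ≤ ((k + 1 : ℕ) : ℝ)⁻¹ := by
  have hk : (0 : ℝ) < (k + 1 : ℕ) := by positivity
  rw [integral_cos_mul, abs_neg, abs_div, abs_of_pos hk, div_eq_mul_inv]
  exact mul_le_of_le_one_left (by positivity) (Real.abs_sin_le_one _)

/-- The cosine integrals sum to a harmonic number, hence to logarithmic growth uniformly in ε; the
power 1/4 is a convenient majorant. The constant is 8 + 2 + 4, with π ≤ 4. -/
theorem abs_sinCotIntegral_le (n : ℕ) {ε : ℝ} (h0 : 0 < ε) (h1 : ε ≤ Real.pi) :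
    |sinCotIntegral n ε| ≤ 14 * (n : ℝ) ^ (1 / 4 : ℝ) := by
  rcases n with _ | n
  · rw [sinCotIntegral_eq 0 h0 h1]; simp
  have hpow : (1 : ℝ) ≤ ((n + 1 : ℕ) : ℝ) ^ (1 / 4 : ℝ) :=
    Real.one_le_rpow (by push_cast; linarith [n.cast_nonneg (α := ℝ)]) (by norm_num)
  have hH : ∑ k ∈ Finset.range (n + 1), ((k + 1 : ℕ) : ℝ)⁻¹ ≤
      1 + 4 * ((n + 1 : ℕ) : ℝ) ^ (1 / 4 : ℝ) := by
    have e1 : ((harmonic (n + 1) : ℚ) : ℝ) ≤ 1 + Real.log (n + 1 : ℕ) := by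
      exact_mod_cast harmonic_le_one_add_log (n + 1)
    have e2 : ((harmonic (n + 1) : ℚ) : ℝ) = ∑ k ∈ Finset.range (n + 1), ((k + 1 : ℕ) : ℝ)⁻¹ := by
      rw [harmonic]; push_cast; rfl
    have e3 := Real.log_le_rpow_div (x := ((n + 1 : ℕ) : ℝ)) (by positivity)
      (by norm_num : (0 : ℝ) < 1 / 4)
    rw [← e2]
    linarith
  have hsum : ∑ k ∈ Finset.range (n + 1), |∫ s in ε..Real.pi, Real.cos ((k + 1 : ℕ) * s)| ≤
      1 + 4 * ((n + 1 : ℕ) : ℝ) ^ (1 / 4 : ℝ) :=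
    (Finset.sum_le_sum fun k _ => abs_integral_cos_le k ε).trans hH
  have hsum' : ∑ k ∈ Finset.range (n + 1), |∫ s in ε..Real.pi, Real.cos (k * s)| ≤
      Real.pi + (1 + 4 * ((n + 1 : ℕ) : ℝ) ^ (1 / 4 : ℝ)) := by
    rw [Finset.sum_range_succ']
    have e1 : |∫ s in ε..Real.pi, Real.cos (((0 : ℕ) : ℝ) * s)| ≤ Real.pi := by
      simp [abs_of_nonneg (sub_nonneg.2 h1), h0.le]
    have e2 := hsum
    rw [Finset.sum_range_succ] at e2
    have e3 := abs_nonneg (∫ s in ε..Real.pi, Real.cos ((n + 1 : ℕ) * s))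
    rw [add_comm Real.pi]
    exact add_le_add (le_of_add_le_of_nonneg_left e2 e3) e1
  rw [sinCotIntegral_eq _ h0 h1, Finset.sum_add_distrib]
  have e1 := abs_add_le
    (∑ k ∈ Finset.range (n + 1), ∫ s in ε..Real.pi, Real.cos ((k + 1 : ℕ) * s))
    (∑ k ∈ Finset.range (n + 1), ∫ s in ε..Real.pi, Real.cos (k * s))
  have e2 := Finset.abs_sum_le_sum_abs
    (fun k : ℕ => ∫ s in ε..Real.pi, Real.cos ((k + 1 : ℕ) * s)) (Finset.range (n + 1))
  have e3 := Finset.abs_sum_le_sum_abs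
    (fun k : ℕ => ∫ s in ε..Real.pi, Real.cos (k * s)) (Finset.range (n + 1))
  linarith [Real.pi_le_four]

/-- Writing |j|^(1/4) c as |j|^(-3/4) · |j| c, the product is dominated by |j|^(-3/2) + (1 + j²) c².
-/
theorem summable_rpow_mul_inner_trigL (u : H1) :
    Summable fun j : ℤ => (j.natAbs : ℝ) ^ (1 / 4 : ℝ) * |⟪trigL j, fn u⟫| := by
  have h1 : Summable fun j : ℤ => |(j : ℝ)| ^ (-(3 / 2) : ℝ) :=
    Real.summable_abs_int_rpow (by norm_num)
  have h2 := (hasSum_norm_H1 u).summable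
  refine (h1.add h2).of_nonneg_of_le (fun j => by positivity) fun j => ?_
  rw [Nat.cast_natAbs, Int.cast_abs]
  by_cases hj : j = 0
  · subst hj
    simp only [Int.cast_zero, abs_zero]
    rw [Real.zero_rpow (by norm_num), Real.zero_rpow (by norm_num)]
    nlinarith [sq_nonneg ⟪trigL 0, fn u⟫]
  have hpos : 0 < |(j : ℝ)| := abs_pos.2 (by exact_mod_cast hj)
  set r := |(j : ℝ)| with hr
  set c := |⟪trigL j, fn u⟫| with hc
  have e1 : r ^ (1 / 4 : ℝ) = r ^ (-(3 / 4) : ℝ) * r := by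
    nth_rewrite 3 [← Real.rpow_one r]
    rw [← Real.rpow_add hpos]; norm_num
  have e2 : r ^ (-(3 / 2) : ℝ) = (r ^ (-(3 / 4) : ℝ)) ^ 2 := by
    rw [← Real.rpow_natCast, ← Real.rpow_mul hpos.le]; norm_num
  have e3 : (j : ℝ) ^ 2 = r ^ 2 := (sq_abs _).symm
  have e4 : ⟪trigL j, fn u⟫ ^ 2 = c ^ 2 := (sq_abs _).symm
  rw [e1, e2, e3, e4]
  nlinarith [sq_nonneg (r ^ (-(3 / 4) : ℝ) - r * c), sq_nonneg (r * c), sq_nonneg c,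
    sq_nonneg (r ^ (-(3 / 4) : ℝ))]

/-- Away from 0 the cotangent is bounded and the Fourier coefficients are absolutely summable, so
the series may be integrated term by term. -/
theorem hasSum_hilbertTrunc (u : H1) (x : S1) {ε : ℝ} (h0 : 0 < ε) (h1 : ε < Real.pi) :
    HasSum (fun j : ℤ => ⟪trigL j, fn u⟫ * (trigC j x).im *
      (sinCotIntegral j.natAbs ε / Real.pi)) (hilbertTrunc (contRep u) ε x) := by
  obtain ⟨C, hC⟩ := isCompact_Icc.exists_bound_of_continuousOn (continuousOn_cot_half h0)
  have hsm : Summable fun j : ℤ => |⟪trigL j, fn u⟫| * (2 * C) :=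
    (summable_abs_inner_trigL u).mul_right _
  have hev : ∀ y : S1, HasSum (fun j => ⟪trigL j, fn u⟫ * trig j y) (contRep u y) := fun y =>
    ((ContinuousMap.evalCLM ℝ y).hasSum (hasSum_contRep u))
  have key := intervalIntegral.hasSum_integral_of_dominated_convergence (a := ε) (b := Real.pi)
    (μ := volume)
    (F := fun (j : ℤ) s => ⟪trigL j, fn u⟫ *
      ((trig j (x - (s : S1)) - trig j (x + (s : S1))) * Real.cot (s / 2)))
    (f := fun s : ℝ => (contRep u (x - (s : S1)) - contRep u (x + (s : S1))) * Real.cot (s / 2))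
    (fun j _ => |⟪trigL j, fn u⟫| * (2 * C)) ?_ ?_ ?_ ?_ ?_
  · rw [hilbertTrunc_eq_interval _ h0 h1]
    refine (key.mul_left (1 / (2 * Real.pi))).congr_fun fun j => ?_
    rw [intervalIntegral.integral_const_mul]
    simp_rw [trig_sub_sub_trig_add, mul_assoc]
    rw [intervalIntegral.integral_const_mul, intervalIntegral.integral_const_mul]
    unfold sinCotIntegral
    have := Real.pi_ne_zero
    field_simp
  · intro j
    rw [uIoc_of_le h1.le]
    refine (ContinuousOn.aestronglyMeasurable ?_ measurableSet_Icc).mono_measure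
      (Measure.restrict_mono_set volume (Ioc_subset_Icc_self (a := ε) (b := Real.pi)))
    refine continuousOn_const.mul (ContinuousOn.mul (Continuous.continuousOn ?_)
      (continuousOn_cot_half h0))
    exact ((trig j).continuous.comp (continuous_const.sub (AddCircle.continuous_mk' _))).sub
      ((trig j).continuous.comp (continuous_const.add (AddCircle.continuous_mk' _)))
  · intro j
    refine Eventually.of_forall fun s hs => ?_
    rw [uIoc_of_le h1.le] at hs
    have e1 := hC s (Ioc_subset_Icc_self hs)
    have e2 := ((trig j).norm_coe_le_norm (x - (s : S1))).trans (norm_trig_le j)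
    have e3 := ((trig j).norm_coe_le_norm (x + (s : S1))).trans (norm_trig_le j)
    rw [norm_mul, norm_mul, Real.norm_eq_abs ⟪trigL j, fn u⟫]
    gcongr
    exact (norm_sub_le _ _).trans (by linarith)
  · exact Eventually.of_forall fun _ _ => hsm
  · simp
  · refine Eventually.of_forall fun s _ => ?_
    refine (((hev (x - (s : S1))).sub (hev (x + (s : S1)))).mul_right (Real.cot (s / 2))).congr_fun
      fun j => ?_
    ring

theorem hasSum_contRep_hilbertH (u : H1) (x : S1) :
    HasSum (fun j : ℤ => ⟪trigL j, fn u⟫ * (trigC j x).im) (contRep (hilbertH u) x) := by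
  have h : HasSum (fun j => ⟪trigL j, fn (hilbertH u)⟫ * trig j x) (contRep (hilbertH u) x) :=
    (ContinuousMap.evalCLM ℝ x).hasSum (hasSum_contRep (hilbertH u))
  rw [← (Equiv.neg ℤ).hasSum_iff] at h
  refine h.congr_fun fun j => ?_
  rw [Function.comp_apply, Equiv.neg_apply, fn_hilbertH, inner_hilbertL, neg_neg, trigC_im,
    Int.sign_neg]
  push_cast
  ring

/-- Dominated convergence in the Fourier series: each factor tends to 1 for j ≠ 0, the term j = 0
vanishes identically, and the majorant does not depend on ε. -/
theorem tendsto_hilbertTrunc (u : H1) (x : S1) :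
    Tendsto (fun ε => hilbertTrunc (fn u) ε x) (𝓝[>] 0) (𝓝 (contRep (hilbertH u) x)) := by
  have h1 : Tendsto (fun ε => ∑' j : ℤ, ⟪trigL j, fn u⟫ * (trigC j x).im *
      (sinCotIntegral j.natAbs ε / Real.pi)) (𝓝[>] 0)
      (𝓝 (∑' j : ℤ, ⟪trigL j, fn u⟫ * (trigC j x).im)) := by
    refine tendsto_tsum_of_dominated_convergence
      ((summable_rpow_mul_inner_trigL u).mul_left 14) (fun j => ?_) ?_
    · by_cases hj : j = 0
      · subst hj
        have : (trigC 0 x).im = 0 := by rw [trigC_im]; simp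
        simp [this]
      · have := (tendsto_sinCotIntegral (Int.natAbs_ne_zero.2 hj)).div_const Real.pi
        rw [div_self Real.pi_ne_zero] at this
        simpa using this.const_mul (⟪trigL j, fn u⟫ * (trigC j x).im)
    · filter_upwards [Ioo_mem_nhdsGT Real.pi_pos] with ε hε j
      have e1 : |(trigC j x).im| ≤ 1 := (Complex.abs_im_le_norm _).trans (norm_trigC_apply_le j x)
      have e2 := abs_sinCotIntegral_le j.natAbs hε.1 hε.2.le
      have e3 : |sinCotIntegral j.natAbs ε / Real.pi| ≤ 14 * (j.natAbs : ℝ) ^ (1 / 4 : ℝ) := by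
        rw [abs_div, abs_of_pos Real.pi_pos]
        exact (div_le_self (abs_nonneg _) (by linarith [Real.pi_gt_three])).trans e2
      rw [Real.norm_eq_abs, abs_mul, abs_mul]
      calc _ ≤ |⟪trigL j, fn u⟫| * 1 * (14 * (j.natAbs : ℝ) ^ (1 / 4 : ℝ)) := by gcongr
        _ = _ := by ring
  rw [(hasSum_contRep_hilbertH u x).tsum_eq] at h1
  refine h1.congr' ?_
  filter_upwards [Ioo_mem_nhdsGT Real.pi_pos] with ε hε
  rw [(hasSum_hilbertTrunc u x hε.1 hε.2).tsum_eq, hilbertTrunc_congr (coeFn_contRep u)]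

theorem hilbert_fn (u : H1) : hilbert (fn u) = contRep (hilbertH u) :=
  funext fun x => (tendsto_hilbertTrunc u x).limUnder_eq

theorem hilbert_fn_ae_eq (u : H1) : hilbertL (fn u) =ᵐ[volume] hilbert (fn u) := by
  rw [hilbert_fn, ← fn_hilbertH]
  exact coeFn_contRep _

theorem eLpNorm_hilbert_fn (u : H1) :
    eLpNorm (hilbert (fn u)) ⊤ volume = ENNReal.ofReal ‖supL (hilbertH u)‖ := by
  rw [ofReal_norm, Lp.enorm_def]
  refine eLpNorm_congr_ae ((hilbert_fn_ae_eq u).symm.trans ?_)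
  exact (coeFn_supL (hilbertH u)).symm

/-! ### Equivalence of the two notions of solution -/

theorem inner_trigL_zero_eq_zero_iff (f : L2) : ⟪trigL 0, f⟫ = 0 ↔ ∫ x : S1, f x = 0 := by
  have h : ∀ x : S1, trig 0 x = (Real.sqrt (2 * Real.pi))⁻¹ := fun x => by
    rw [trig_apply, trigC_apply, trigCoef_zero, abs_zero, fourier_zero, mul_one, Complex.ofReal_re]
  have h1 : (Real.sqrt (2 * Real.pi))⁻¹ ≠ 0 := inv_ne_zero (Real.sqrt_pos.2 Real.two_pi_pos).ne'
  rw [inner_trigL]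
  simp_rw [h]
  rw [integral_const_mul, mul_eq_zero, or_iff_right h1]

/-- The derivative determines every nonzero mode of p, and the zero-mean condition determines the
remaining one. -/
theorem isVelocity_iff (p u : H1) : IsVelocity p u ↔ p = velocity (fn u) := by
  have h0 : ⟪trigL 0, potential (fn u)⟫ = 0 := by rw [inner_potential]; simp
  constructor
  · rintro ⟨h1, h2⟩
    have h3 : dx p = dx (velocity (fn u)) := Lp.ext (h1.trans (hilbert_fn_ae_eq u).symm)
    refine fn_injective (ext_trigL fun j => ?_)
    by_cases hj : j = 0
    · subst hj
      rw [(inner_trigL_zero_eq_zero_iff _).2 h2, fn_velocity, h0]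
    · have h4 := congrArg (fun f : L2 => ⟪trigL (-j), f⟫) h3
      simp only [inner_trigL_dx, neg_neg] at h4
      exact mul_left_cancel₀ (by exact_mod_cast neg_ne_zero.2 hj) h4
  · rintro rfl
    exact ⟨hilbert_fn_ae_eq u, (inner_trigL_zero_eq_zero_iff _).1 h0⟩

theorem eq_force_iff (a : ℝ) (d f g : L2) (v w : H1) : d = force a f g v w ↔
    ∀ᵐ x : S1, d x + a * fn (velocity g) x * dx v x - fn w x * dx (velocity f) x = 0 := by
  have h : force a f g v w =ᵐ[volume] fun x =>
      -(a * fn (velocity g) x * dx v x) + fn w x * dx (velocity f) x := by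
    unfold force
    rw [transport_apply, stretch_apply]
    filter_upwards [Lp.coeFn_add (-(a • mulL (supL (velocity g)) (dx v)))
      (mulL (supL w) (hilbertL f)), Lp.coeFn_neg (a • mulL (supL (velocity g)) (dx v)),
      Lp.coeFn_smul a (mulL (supL (velocity g)) (dx v)), coeFn_mulL (supL (velocity g)) (dx v),
      coeFn_mulL (supL w) (hilbertL f), coeFn_supL (velocity g), coeFn_supL w]
      with x h1 h2 h3 h4 h5 h6 h7
    rw [h1, Pi.add_apply, h2, Pi.neg_apply, h3, Pi.smul_apply, h4, h5, h6, h7, smul_eq_mul,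
      dx_velocity]
    ring
  rw [Lp.ext_iff]
  constructor
  · intro h1
    filter_upwards [h, h1] with x h2 h3
    rw [h3, h2]
    ring
  · intro h1
    filter_upwards [h, h1] with x h2 h3
    rw [h2]
    linarith

theorem equations_iff (a : ℝ) (d d' : L2) (u : Y) :
    (∃ p m : H1, IsVelocity p u.fst ∧ IsVelocity m u.snd ∧
      (∀ᵐ x : S1, d x + a * fn m x * dx u.fst x - fn u.snd x * dx p x = 0) ∧
      (∀ᵐ x : S1, d' x + a * fn p x * dx u.snd x - fn u.fst x * dx m x = 0)) ↔
    d = (field a u u).fst ∧ d' = (field a u u).snd := by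
  rw [field_fst, field_snd, eq_force_iff, eq_force_iff]
  simp only [isVelocity_iff]
  constructor
  · rintro ⟨_, _, rfl, rfl, h1, h2⟩
    exact ⟨h1, h2⟩
  · exact fun h => ⟨_, _, rfl, rfl, h⟩

theorem hasDerivWithinAt_inclusionL_iff {u : ℝ → Y} {d : X} {s : Set ℝ} {t : ℝ} :
    HasDerivWithinAt (fun t => inclusionL (u t)) d s t ↔
      HasDerivWithinAt (fun t => fn (u t).fst) d.fst s t ∧
      HasDerivWithinAt (fun t => fn (u t).snd) d.snd s t := by
  constructor
  · exact fun h => ⟨(WithLp.fstL 2 ℝ L2 L2).hasFDerivAt.comp_hasDerivWithinAt (f := fun t => inclusionL (u t)) t h,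
      (WithLp.sndL 2 ℝ L2 L2).hasFDerivAt.comp_hasDerivWithinAt (f := fun t => inclusionL (u t)) t h⟩
  · exact fun h => (WithLp.prodContinuousLinearEquiv 2 ℝ L2 L2).symm.toContinuousLinearMap
      |>.hasFDerivAt.comp_hasDerivWithinAt t (h.1.prodMk h.2)

/-- The C¹ condition in L² is automatic: the equation gives the derivative, and the vector field is
continuous along a curve continuous in H¹. -/
theorem isSolution_iff (a T : ℝ) (u : ℝ → Y) :
    IsSolution a (u 0).fst (u 0).snd T (fun t => (u t).fst) (fun t => (u t).snd) ↔
      ContinuousOn u (Ico 0 T) ∧ ∀ t ∈ Ico 0 T,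
        HasDerivWithinAt (fun t => inclusionL (u t)) (field a (u t) (u t)) (Ico 0 T) t := by
  have huniq : UniqueDiffOn ℝ (Ico 0 T) := uniqueDiffOn_Ico 0 T
  constructor
  · intro h
    refine ⟨(WithLp.prodContinuousLinearEquiv 2 ℝ H1 H1).symm.continuous.comp_continuousOn
      (h.continuousOn_Omega.prodMk h.continuousOn_omega), fun t ht => ?_⟩
    obtain ⟨h1, h2⟩ := (equations_iff a _ _ (u t)).1 (h.equations t ht)
    rw [hasDerivWithinAt_inclusionL_iff, ← h1, ← h2]
    exact ⟨(h.contDiffOn_Omega.differentiableOn one_ne_zero t ht).hasDerivWithinAt,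
      (h.contDiffOn_omega.differentiableOn one_ne_zero t ht).hasDerivWithinAt⟩
  · rintro ⟨hc, hd⟩
    have hd1 := fun t ht => (hasDerivWithinAt_inclusionL_iff.1 (hd t ht)).1
    have hd2 := fun t ht => (hasDerivWithinAt_inclusionL_iff.1 (hd t ht)).2
    have hF : ContinuousOn (fun t => field a (u t) (u t)) (Ico 0 T) :=
      (system a).continuous_B_self.comp_continuousOn hc
    have hcd : ∀ {f g : ℝ → L2}, (∀ t ∈ Ico 0 T, HasDerivWithinAt f (g t) (Ico 0 T) t) →
        ContinuousOn g (Ico 0 T) → ContDiffOn ℝ 1 f (Ico 0 T) := fun hf hg => by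
      rw [contDiffOn_one_iff_derivWithin huniq]
      exact ⟨fun t ht => (hf t ht).differentiableWithinAt,
        hg.congr fun t ht => (hf t ht).derivWithin (huniq t ht)⟩
    exact
      { initial_Omega := rfl
        initial_omega := rfl
        continuousOn_Omega := (WithLp.fstL 2 ℝ H1 H1).continuous.comp_continuousOn hc
        continuousOn_omega := (WithLp.sndL 2 ℝ H1 H1).continuous.comp_continuousOn hc
        contDiffOn_Omega := hcd hd1 ((WithLp.fstL 2 ℝ L2 L2).continuous.comp_continuousOn hF)
        contDiffOn_omega := hcd hd2 ((WithLp.sndL 2 ℝ L2 L2).continuous.comp_continuousOn hF)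
        equations := fun t ht => (equations_iff a _ _ (u t)).2
          ⟨(hd1 t ht).derivWithin (huniq t ht), (hd2 t ht).derivWithin (huniq t ht)⟩ }

theorem eLpNorm_hilbert_add (u : Y) :
    eLpNorm (hilbert (fn u.fst)) ⊤ volume + eLpNorm (hilbert (fn u.snd)) ⊤ volume =
      ENNReal.ofReal (supHilbert u) := by
  rw [eLpNorm_hilbert_fn, eLpNorm_hilbert_fn, supHilbert,
    ENNReal.ofReal_add (norm_nonneg _) (norm_nonneg _)]

theorem exists_integral_supHilbert_le {T : ℝ} {u : ℝ → Y} (hc : ContinuousOn u (Ico 0 T))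
    (h : ∫⁻ t in Ioo 0 T, ENNReal.ofReal (supHilbert (u t)) < ⊤) :
    ∃ M, ∀ t ∈ Ico 0 T, ∫ r in (0 : ℝ)..t, supHilbert (u r) ≤ M := by
  refine ⟨(∫⁻ t in Ioo 0 T, ENNReal.ofReal (supHilbert (u t))).toReal, fun t ht => ?_⟩
  have hsub : Ioc 0 t ⊆ Ioo 0 T := fun s hs => ⟨hs.1, hs.2.trans_lt ht.2⟩
  have hK : Continuous supHilbert := by unfold supHilbert; fun_prop
  have hm : AEStronglyMeasurable (fun r => supHilbert (u r)) (volume.restrict (Ioc 0 t)) :=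
    (hK.comp_continuousOn (hc.mono (hsub.trans Ioo_subset_Ico_self))).aestronglyMeasurable
      measurableSet_Ioc
  rw [intervalIntegral.integral_of_le ht.1, integral_eq_lintegral_of_nonneg_ae
    (Eventually.of_forall fun r => supHilbert_nonneg _) hm]
  exact ENNReal.toReal_mono h.ne (lintegral_mono_set hsub)

end MHD1D

end

theorem mainTheorem2 (a T : ℝ) (hT : 0 < T) (Ω₀ ω₀ : MHD1D.H1) (Ω ω : ℝ → MHD1D.H1)
    (hsol : MHD1D.IsSolution a Ω₀ ω₀ T Ω ω)
    (hcrit : (∫⁻ t in Set.Ioo 0 T,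
      (MeasureTheory.eLpNorm (MHD1D.hilbert (MHD1D.fn (Ω t))) ⊤ MeasureTheory.volume
        + MeasureTheory.eLpNorm (MHD1D.hilbert (MHD1D.fn (ω t))) ⊤ MeasureTheory.volume)) < ⊤) :
    ∃ T' : ℝ, T < T' ∧ ∃ Ω' ω' : ℝ → MHD1D.H1,
      MHD1D.IsSolution a Ω₀ ω₀ T' Ω' ω' ∧
      (∀ t ∈ Set.Ico 0 T, Ω' t = Ω t ∧ ω' t = ω t) := by
  obtain ⟨u, h1, h2⟩ : ∃ u : ℝ → MHD1D.Y, (∀ t, (u t).fst = Ω t) ∧ ∀ t, (u t).snd = ω t :=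
    ⟨fun t => WithLp.toLp 2 (Ω t, ω t), fun _ => rfl, fun _ => rfl⟩
  obtain rfl := hsol.initial_Omega
  obtain rfl := hsol.initial_omega
  have hsol' : MHD1D.IsSolution a (u 0).fst (u 0).snd T (fun t => (u t).fst)
      (fun t => (u t).snd) := by
    simpa only [h1, h2] using hsol
  obtain ⟨hc, hd⟩ := (MHD1D.isSolution_iff a T u).1 hsol'
  simp_rw [← h1, ← h2, MHD1D.eLpNorm_hilbert_add] at hcrit
  obtain ⟨M, hM⟩ := MHD1D.exists_integral_supHilbert_le hc hcrit
  -- The growth functional K is `energyConst a` times the control quantity, so its integrals are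
  -- bounded by the same multiple of M.
  obtain ⟨T', hT', u', hu', hc', hd'⟩ := (MHD1D.system a).exists_extension
    (M := MHD1D.energyConst a * M) hT hc hd fun t ht => by
      have := mul_le_mul_of_nonneg_left (hM t ht) (MHD1D.energyConst_nonneg a)
      rwa [← intervalIntegral.integral_const_mul] at this
  have hsol'' := (MHD1D.isSolution_iff a T' u').2 ⟨hc', hd'⟩
  rw [hu' 0 ⟨le_rfl, hT⟩, h1, h2] at hsol''
  exact ⟨T', hT', _, _, hsol'', fun t ht => by rw [hu' t ht, h1, h2]; exact ⟨rfl, rfl⟩⟩
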